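/- Let $n\ge 2$. An $n$-knot is the image $K\subset S^{n+2}$ of a smooth embedding of an oriented smooth $n$-manifold homeomorphic to $S^n$. Assume that $K$ is fibered: there is a locally trivial fiber bundle $\pi:S^{n+2}\setminus K\to S^1\subset\mathbb C$ such that for each $s\in S^1$ the closure of $\pi^{-1}(s)$ in $S^{n+2}$ is a Seifert surface of $K$, i.e. a compact orientable smoothly embedded $(n+1)$-manifold with boundary $K$. Let $N$ be a closed tubular neighborhood of $K$ and $E=S^{n+2}\setminus\operatorname{int}N$. A *meridional disk* is a smoothly embedded oriented disk $D$, properly embedded in $N$, which meets $K$ in exactly one point, transversely and with intersection number $+1$. For $p\in E$, a *noose* based at $p$ is a pair $(D,\alpha)$ of a meridional disk $D$ and a path $\alpha$ in $E$ from a point of $\partial D$ to $p$. Two nooses are homotopic if there are a homotopy $H_D:D^2\times[0,1]\to N$ between the (orientedly parametrized) disks and a homotopy $H_P:[0,1]^2\to E$ between the paths such that, at each time $t$, the disk $H_D(\cdot,t)$ (not necessarily embedded) sends exactly $\partial D^2$ into $\partial N$ and has exactly one point on $K$, and $H_P(\cdot,t)$ is a path from a point of the boundary of that disk (the image of a point of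 $\partial D^2$ depending continuously on $t$) to $p$. The *knot quandle* $Q(K)$ is the set of homotopy classes of nooses based at $p$ with the operation $$[(D,\alpha)]*[(D',\beta)]=[(D,\ \alpha\cdot\beta^{-1}\cdot\partial D'\cdot\beta)],$$ where $\partial D'$ is the loop running once around $\partial D'$ along its orientation from the initial point of $\beta$. For a group $G$ and $\varphi\in\operatorname{Aut}(G)$, the *generalized Alexander quandle* $(G,\varphi)$ is the set $G$ with $x*y=\varphi(xy^{-1})y$. Let $D_0$ be a meridional disk and let $p_0\in\partial D_0$ be a point with $\pi(p_0)=1$. Let $F=\pi^{-1}(1)$ be the fiber and $G=\pi_1(F,p_0)$. Then there is a unique automorphism $\varphi$ of $G$, the *monodromy*, such that $\varphi([\gamma])=[\delta]$ if and only if $(\partial D_0)^{-1}\cdot\gamma\cdot\partial D_0$ is homotopic in $S^{n+2}\setminus K$, relative to $p_0$, to $\delta$, for all loops $\gamma,\delta$ in $F$ based at $p_0$; and the knot quandle $Q(K)$, with base point $p_0$, is isomorphic to the generalized Alexander quandle $(G,\varphi)$. -/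

import Mathlib

open scoped Manifold ContDiff unitInterval Topology

noncomputable section

/-! ### Generalized Alexander quandles -/

/-- The operation `x ∗ y = φ (x * y⁻¹) * y` on a group. -/
def genAlexanderOp {G : Type*} [Group G] (φ : G ≃* G) (x y : G) : G := φ (x * y⁻¹) * y

theorem genAlexanderOp_self {G : Type*} [Group G] (φ : G ≃* G) (x : G) :
    genAlexanderOp φ x x = x := by
  simp [genAlexanderOp]

theorem genAlexanderOp_symm_left {G : Type*} [Group G] (φ : G ≃* G) (x y : G) :
    genAlexanderOp φ.symm (genAlexanderOp φ x y) y = x := by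
  simp [genAlexanderOp]

theorem genAlexanderOp_symm_right {G : Type*} [Group G] (φ : G ≃* G) (x y : G) :
    genAlexanderOp φ (genAlexanderOp φ.symm x y) y = x := by
  simp [genAlexanderOp]

theorem genAlexanderOp_distrib {G : Type*} [Group G] (φ : G ≃* G) (x y z : G) :
    genAlexanderOp φ (genAlexanderOp φ z y) x =
      genAlexanderOp φ (genAlexanderOp φ z x) (genAlexanderOp φ y x) := by
  simp only [genAlexanderOp, map_mul, map_inv, mul_inv_rev]
  group

/-- The generalized Alexander quandle `(G, φ)`: the group `G` with `x ∗ y = φ (x * y⁻¹) * y`. -/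
def GenAlexanderQuandle {G : Type*} [Group G] (_φ : G ≃* G) : Type _ := G

/-- `Shelf.act y x` (written `y ◃ x` in Mathlib) is the product `x ∗ y`. -/
instance GenAlexanderQuandle.instQuandle {G : Type*} [Group G] (φ : G ≃* G) :
    Quandle (GenAlexanderQuandle φ) where
  act y x := genAlexanderOp (G := G) φ x y
  self_distrib {x y z} := genAlexanderOp_distrib (G := G) φ x y z
  invAct y x := genAlexanderOp (G := G) φ.symm x y
  left_inv y x := genAlexanderOp_symm_left (G := G) φ x y
  right_inv y x := genAlexanderOp_symm_right (G := G) φ x y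
  fix {x} := genAlexanderOp_self (G := G) φ x

/-! ### Knots, tubular neighbourhoods, Seifert surfaces, fibered knots -/

/-- The unit sphere `S^m` of `ℝ^(m+1)`. -/
abbrev Sph (m : ℕ) : Type := Metric.sphere (0 : EuclideanSpace ℝ (Fin (m + 1))) 1

/-- An orientation of a `d`-dimensional smooth manifold, possibly with boundary: an orientation of
every tangent space which is locally constant in the local trivializations of the tangent bundle. -/
structure ManifoldOrientation {d : ℕ} {H : Type*} [TopologicalSpace H]
    (J : ModelWithCorners ℝ (EuclideanSpace ℝ (Fin d)) H) (M : Type*) [TopologicalSpace M]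
    [ChartedSpace H M] [IsManifold J ∞ M] where
  orient : ∀ x : M, Orientation ℝ (TangentSpace J x) (Fin d)
  locally_const : ∀ x₀ : M, ∃ c : Orientation ℝ (EuclideanSpace ℝ (Fin d)) (Fin d),
    ∀ᶠ y in 𝓝 x₀, ∀ hy : y ∈ (trivializationAt (EuclideanSpace ℝ (Fin d))
        (TangentSpace J : M → Type _) x₀).baseSet,
      Orientation.map (Fin d) ((trivializationAt (EuclideanSpace ℝ (Fin d))
        (TangentSpace J : M → Type _) x₀).linearEquivAt ℝ y hy) (orient y) = c

/-- An (oriented) `n`-knot: a smooth embedding into `S^(n+2)` of an oriented smooth `n`-manifold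
which is homeomorphic to `S^n`. -/
structure Knot (n : ℕ) where
  source : Type
  [topologicalSpace : TopologicalSpace source]
  [chartedSpace : ChartedSpace (EuclideanSpace ℝ (Fin n)) source]
  [isManifold : IsManifold (𝓡 n) ∞ source]
  homeo : Nonempty (source ≃ₜ Sph n)
  orientation : ManifoldOrientation (𝓡 n) source
  embed : source → Sph (n + 2)
  isSmoothEmbedding : Manifold.IsSmoothEmbedding (𝓡 n) (𝓡 (n + 2)) ∞ embed

attribute [instance] Knot.topologicalSpace Knot.chartedSpace Knot.isManifold

namespace Knot

variable {n : ℕ}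

/-- The knot as a subset of the sphere. -/
def carrier (K : Knot n) : Set (Sph (n + 2)) := Set.range K.embed

/-- `N` is a closed tubular neighbourhood of `K`: the closed unit disk bundle in an open tubular
neighbourhood `K × ℂ ↪ S^(n+2)` (the normal bundle of an `n`-knot is trivial). -/
def IsTubularNeighborhood (K : Knot n) (N : Set (Sph (n + 2))) : Prop :=
  ∃ τ : K.source × ℂ → Sph (n + 2),
    IsLocalDiffeomorph ((𝓡 n).prod 𝓘(ℝ, ℂ)) (𝓡 (n + 2)) ∞ τ ∧ Function.Injective τ ∧
      (∀ p, τ (p, 0) = K.embed p) ∧ N = τ '' (Set.univ ×ˢ Metric.closedBall 0 1)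

/-- `V` is a Seifert surface of `K`: a compact orientable `(n+1)`-manifold smoothly embedded
into `S^(n+2)` whose boundary is `K`. -/
def IsSeifertSurface (K : Knot n) (V : Set (Sph (n + 2))) : Prop :=
  ∃ (W : Type) (_ : TopologicalSpace W) (_ : ChartedSpace (EuclideanHalfSpace (n + 1)) W)
    (_ : IsManifold (𝓡∂ (n + 1)) ∞ W) (g : W → Sph (n + 2)),
    CompactSpace W ∧ Nonempty (ManifoldOrientation (𝓡∂ (n + 1)) W) ∧
      Manifold.IsSmoothEmbedding (𝓡∂ (n + 1)) (𝓡 (n + 2)) ∞ g ∧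
      Set.range g = V ∧ g '' (𝓡∂ (n + 1)).boundary W = K.carrier

/-- The complement `S^(n+2) \ K`. -/
abbrev Complement (K : Knot n) : Type := {x : Sph (n + 2) // x ∉ K.carrier}

/-- The fiber of `π` over `s`. The fiber of a fibered knot is `K.Fiber π 1`. -/
abbrev Fiber (K : Knot n) (π : C(K.Complement, Circle)) (s : Circle) : Type :=
  {x : K.Complement // π x = s}

/-- `π` makes `K` a fibered knot: it is a locally trivial fiber bundle over the circle and the
closure in `S^(n+2)` of every fiber is a Seifert surface of `K`. -/
def IsFibration (K : Knot n) (π : C(K.Complement, Circle)) : Prop :=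
  (∀ s : Circle, ∃ e : Bundle.Trivialization (K.Fiber π 1) π, s ∈ e.baseSet) ∧
    ∀ s : Circle,
      K.IsSeifertSurface (closure {x | ∃ y : K.Complement, π y = s ∧ (y : Sph (n + 2)) = x})

/-- The exterior `E(K)`, the complement of the interior of the tubular neighbourhood. -/
abbrev Exterior (N : Set (Sph (n + 2))) : Type := {x : Sph (n + 2) // x ∉ interior N}

end Knot

/-! ### Meridional disks -/

/-- The closed unit disk `D²`. -/
abbrev Disk : Type := Metric.closedBall (0 : ℂ) 1

namespace Disk

/-- Rotation of the disk through the angle `2πt`. -/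
def rotate (t : ℝ) (z : Disk) : Disk :=
  ⟨Circle.exp (2 * Real.pi * t) * z, by
    have := z.2
    simp only [mem_closedBall_zero_iff, norm_mul, Circle.norm_coe, one_mul] at this ⊢
    exact this⟩

/-- The point `1` of the boundary of the disk. -/
def one : Disk := ⟨1, by simp⟩

/-- The point `exp (2πit)` of the boundary of the disk. -/
def circlePt (t : ℝ) : Disk := rotate t one

theorem norm_rotate (t : ℝ) (z : Disk) : ‖(rotate t z : ℂ)‖ = ‖(z : ℂ)‖ := by
  rw [rotate, norm_mul, Circle.norm_coe, one_mul]

theorem norm_circlePt (t : ℝ) : ‖(circlePt t : ℂ)‖ = 1 := by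
  simp [circlePt, norm_rotate, one]

theorem rotate_zero (z : Disk) : rotate 0 z = z := by
  apply Subtype.ext; simp [rotate]

theorem rotate_one (z : Disk) : rotate 1 z = z := by
  apply Subtype.ext; simp [rotate]

theorem circlePt_zero : circlePt 0 = one := rotate_zero _

theorem circlePt_one : circlePt 1 = one := rotate_one _

theorem rotate_rotate (s t : ℝ) (z : Disk) : rotate s (rotate t z) = rotate (s + t) z := by
  apply Subtype.ext; simp [rotate, mul_add, Circle.exp_add, mul_assoc]

theorem continuous_rotate : Continuous fun p : ℝ × Disk => rotate p.1 p.2 := by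
  unfold rotate
  fun_prop

@[fun_prop]
theorem continuous_circlePt : Continuous circlePt :=
  continuous_rotate.comp (by fun_prop : Continuous fun t : ℝ => (t, one))

end Disk

namespace Knot

variable {n : ℕ}

/-- A singular meridional disk: a continuous map of the disk into `N` which is proper, in that
exactly the boundary of the disk is sent to the boundary of `N`, and which meets `K` at exactly one
point, an interior one. -/
structure IsSingularDisk (K : Knot n) (N : Set (Sph (n + 2))) (d : C(Disk, Sph (n + 2))) :
    Prop where
  mem : ∀ z, d z ∈ N
  mem_frontier_iff : ∀ z, d z ∈ frontier N ↔ ‖(z : ℂ)‖ = 1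
  existsUnique : ∃ z₀ : Disk, ‖(z₀ : ℂ)‖ < 1 ∧ ∀ z, d z ∈ K.carrier ↔ z = z₀

/-- The tangent plane of the parametrized disk `g` at `z₀` is complementary to the tangent space of
`K` at `p` in the tangent space of the sphere, and the local intersection number is `+1`: an
oriented basis of `T_p K` followed by the oriented basis `∂g/∂x, ∂g/∂y` is an oriented basis of the
tangent space of the sphere, the sphere being oriented by its outward normal. -/
def IntersectsPositively (K : Knot n) (g : ℂ → EuclideanSpace ℝ (Fin (n + 2 + 1))) (z₀ : ℂ)
    (p : K.source) : Prop :=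
  ∀ b : Module.Basis (Fin n) ℝ (TangentSpace (𝓡 n) p), b.orientation = K.orientation.orient p →
    0 < Matrix.det (Matrix.of fun i j =>
      (Fin.cons (K.embed p : EuclideanSpace ℝ (Fin (n + 2 + 1)))
        (Fin.append
          (fun i : Fin n => (mfderiv (𝓡 n) 𝓘(ℝ, EuclideanSpace ℝ (Fin (n + 2 + 1)))
            (fun q => (K.embed q : EuclideanSpace ℝ (Fin (n + 2 + 1)))) p (b i) :
              EuclideanSpace ℝ (Fin (n + 2 + 1))))
          ![fderiv ℝ g z₀ 1, fderiv ℝ g z₀ Complex.I]) :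
            Fin (n + 2 + 1) → EuclideanSpace ℝ (Fin (n + 2 + 1))) i j)

/-- A (positive) meridional disk of `K`, with an oriented parametrization: a smooth embedding of the
closed disk (smooth up to the boundary, that is, with a smooth extension `g` to the plane), proper
in `N`, meeting `K` in exactly one point, transversely and with intersection number `+1`. -/
structure MeridionalDisk (K : Knot n) (N : Set (Sph (n + 2))) where
  toMap : C(Disk, Sph (n + 2))
  isSingularDisk : K.IsSingularDisk N toMap
  injective : Function.Injective toMap
  smooth : ∃ g : ℂ → EuclideanSpace ℝ (Fin (n + 2 + 1)), ContDiff ℝ ∞ g ∧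
    (∀ z : Disk, g z = toMap z) ∧ (∀ z : Disk, Function.Injective (fderiv ℝ g z)) ∧
    ∀ (z : Disk) (p : K.source), toMap z = K.embed p → K.IntersectsPositively g z p

variable {K : Knot n} {N : Set (Sph (n + 2))}

theorem IsSingularDisk.circlePt_mem_frontier {d : C(Disk, Sph (n + 2))}
    (h : K.IsSingularDisk N d) (t : ℝ) : d (Disk.circlePt t) ∈ frontier N :=
  (h.mem_frontier_iff _).2 (Disk.norm_circlePt t)

theorem IsSingularDisk.circlePt_not_mem_interior {d : C(Disk, Sph (n + 2))}
    (h : K.IsSingularDisk N d) (t : ℝ) : d (Disk.circlePt t) ∉ interior N :=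
  (h.circlePt_mem_frontier t).2

theorem IsSingularDisk.circlePt_not_mem {d : C(Disk, Sph (n + 2))}
    (h : K.IsSingularDisk N d) (t : ℝ) : d (Disk.circlePt t) ∉ K.carrier := by
  obtain ⟨z₀, hz₀, hz⟩ := h.existsUnique
  rw [hz]
  rintro rfl
  rw [Disk.norm_circlePt] at hz₀
  exact lt_irrefl _ hz₀

theorem IsSingularDisk.rotate {d : C(Disk, Sph (n + 2))} (h : K.IsSingularDisk N d) (t : ℝ)
    (d' : C(Disk, Sph (n + 2))) (hd' : ∀ z, d' z = d (Disk.rotate t z)) :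
    K.IsSingularDisk N d' where
  mem z := by rw [hd']; exact h.mem _
  mem_frontier_iff z := by rw [hd', h.mem_frontier_iff, Disk.norm_rotate]
  existsUnique := by
    obtain ⟨z₀, hz₀, hz⟩ := h.existsUnique
    refine ⟨Disk.rotate (-t) z₀, by rwa [Disk.norm_rotate], fun z => ?_⟩
    rw [hd', hz]
    constructor
    · rintro rfl
      rw [Disk.rotate_rotate, neg_add_cancel, Disk.rotate_zero]
    · rintro rfl
      rw [Disk.rotate_rotate, add_neg_cancel, Disk.rotate_zero]

/-- The point `exp (2πit)` of the boundary of a singular disk, as a point of the exterior. -/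
def bdryPt {d : C(Disk, Sph (n + 2))} (h : K.IsSingularDisk N d) (t : ℝ) : Exterior N :=
  ⟨d (Disk.circlePt t), h.circlePt_not_mem_interior t⟩

/-- The boundary loop of a singular disk in the exterior. -/
def bdryLoop {d : C(Disk, Sph (n + 2))} (h : K.IsSingularDisk N d) :
    Path (bdryPt h 0) (bdryPt h 0) where
  toFun t := bdryPt h t
  continuous_toFun := by unfold bdryPt; fun_prop
  source' := rfl
  target' := by
    simp [bdryPt, Disk.circlePt_zero, Disk.circlePt_one]

/-- The base point of the meridional disk in the complement of the knot. -/
def MeridionalDisk.basePt (D : K.MeridionalDisk N) : K.Complement :=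
  ⟨D.toMap (Disk.circlePt 0), D.isSingularDisk.circlePt_not_mem 0⟩

/-- The boundary loop `∂D` of a meridional disk in the complement of the knot. -/
def MeridionalDisk.loop (D : K.MeridionalDisk N) : Path D.basePt D.basePt where
  toFun t := ⟨D.toMap (Disk.circlePt t), D.isSingularDisk.circlePt_not_mem t⟩
  continuous_toFun := by fun_prop
  source' := rfl
  target' := by
    simp [MeridionalDisk.basePt, Disk.circlePt_zero, Disk.circlePt_one]

/-- The base point of the meridional disk in the exterior. -/
abbrev MeridionalDisk.exteriorPt (D : K.MeridionalDisk N) : Exterior N := bdryPt D.isSingularDisk 0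

/-! ### Nooses and the knot quandle -/

/-- A noose `(D, α)`: a meridional disk and a path in the exterior from a boundary point of the disk
to the base point. The disk is parametrized so that the path starts at the image of `1`. -/
structure Noose (K : Knot n) (N : Set (Sph (n + 2))) (p : Exterior N) where
  disk : K.MeridionalDisk N
  path : Path disk.exteriorPt p

/-- A homotopy of nooses: a homotopy of disks through singular meridional disks, together with a
homotopy of paths in the exterior from the boundary of the moving disk to the base point. (The
intermediate disks need not be embedded: embedded meridional disks can be knotted. Their
intersection number with `K` is constant during the homotopy.) -/
structure NooseHomotopy {p : Exterior N} (ν μ : K.Noose N p) where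
  disk : C(I × Disk, Sph (n + 2))
  path : C(I × I, Exterior N)
  isSingularDisk : ∀ t, K.IsSingularDisk N (disk.comp ((ContinuousMap.const _ t).prodMk (.id _)))
  path_zero : ∀ t, (path (t, 0) : Sph (n + 2)) = disk (t, Disk.circlePt 0)
  path_one : ∀ t, path (t, 1) = p
  disk_left : ∀ z, disk (0, z) = ν.disk.toMap z
  path_left : ∀ s, path (0, s) = ν.path s
  disk_right : ∀ z, disk (1, z) = μ.disk.toMap z
  path_right : ∀ s, path (1, s) = μ.path s

/-- Two nooses are homotopic. -/
def Noose.Homotopic {p : Exterior N} (ν μ : K.Noose N p) : Prop := Nonempty (NooseHomotopy ν μ)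

/-- The underlying set of the knot quandle: homotopy classes of nooses. -/
def KnotQuandle (K : Knot n) (N : Set (Sph (n + 2))) (p : Exterior N) : Type :=
  Quot (Noose.Homotopic : K.Noose N p → K.Noose N p → Prop)

variable {p : Exterior N}

/-- The path of the noose homotopy at time `t`. -/
def NooseHomotopy.pathAt {ν μ : K.Noose N p} (h : NooseHomotopy ν μ) (t : I) :
    Path (bdryPt (h.isSingularDisk t) 0) p where
  toFun s := h.path (t, s)
  continuous_toFun := by fun_prop
  source' := Subtype.ext (h.path_zero t)
  target' := h.path_one t

/-- The boundary loop (`b = true`) or its inverse (`b = false`). -/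
def signedLoop {d : C(Disk, Sph (n + 2))} (h : K.IsSingularDisk N d) (b : Bool) :
    Path (bdryPt h 0) (bdryPt h 0) :=
  if b then bdryLoop h else (bdryLoop h).symm

/-- For `b = true`, the product `(D, α) ∗ (E, β) = (D, α · β⁻¹ · ∂E · β)` of nooses; for
`b = false`, the inverse operation `(D, α · β⁻¹ · (∂E)⁻¹ · β)`. -/
def Noose.op (b : Bool) (ν μ : K.Noose N p) : K.Noose N p where
  disk := ν.disk
  path := ν.path.trans (μ.path.symm.trans ((signedLoop μ.disk.isSingularDisk b).trans μ.path))

theorem path_trans_congr {X : Type*} [TopologicalSpace X] {a b c a' b' c' : X} {γ : Path a b}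
    {δ : Path b c} {γ' : Path a' b'} {δ' : Path b' c'} (h : ∀ t, γ t = γ' t)
    (h' : ∀ t, δ t = δ' t) (t : I) : (γ.trans δ) t = (γ'.trans δ') t := by
  simp only [Path.trans_apply, h, h']

theorem Noose.homotopic_of_path {D : K.MeridionalDisk N} {α β : Path D.exteriorPt p}
    (h : α.Homotopic β) : Noose.Homotopic (⟨D, α⟩ : K.Noose N p) ⟨D, β⟩ := by
  obtain ⟨F⟩ := h
  exact ⟨{
    disk := D.toMap.comp ContinuousMap.snd
    path := F.toContinuousMap
    isSingularDisk := fun t => D.isSingularDisk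
    path_zero := fun t => congrArg Subtype.val (F.source t)
    path_one := fun t => F.target t
    disk_left := fun z => rfl
    path_left := fun s => F.apply_zero s
    disk_right := fun z => rfl
    path_right := fun s => F.apply_one s }⟩

theorem Noose.Homotopic.refl (ν : K.Noose N p) : ν.Homotopic ν :=
  Noose.homotopic_of_path (Path.Homotopic.refl _)

theorem signedLoop_congr {d d' : C(Disk, Sph (n + 2))} (h : K.IsSingularDisk N d)
    (h' : K.IsSingularDisk N d') (e : ∀ z, d z = d' z) (b : Bool) (t : I) :
    signedLoop h b t = signedLoop h' b t := by
  obtain rfl : d = d' := ContinuousMap.ext e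
  rfl

theorem Noose.op_congr (b : Bool) {ν ν' μ μ' : K.Noose N p} (h : ν.Homotopic ν')
    (h' : μ.Homotopic μ') : (ν.op b μ).Homotopic (ν'.op b μ') := by
  obtain ⟨F⟩ := h
  obtain ⟨G⟩ := h'
  have hF : Continuous ↿F.pathAt := F.path.continuous
  have hG : Continuous ↿G.pathAt := G.path.continuous
  have hL : Continuous ↿fun t => signedLoop (G.isSingularDisk t) b := by
    have h1 : Continuous ↿fun t => bdryLoop (G.isSingularDisk t) := by
      refine Continuous.subtype_mk
        (f := fun q : I × I => G.disk (q.1, Disk.circlePt q.2)) ?_ _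
      fun_prop
    cases b
    · exact Path.symm_continuous_family _ h1
    · exact h1
  have hP := Path.trans_continuous_family _ hF _ (Path.trans_continuous_family _
    (Path.symm_continuous_family _ hG) _ (Path.trans_continuous_family _ hL _ hG))
  refine ⟨{
    disk := F.disk
    path := ⟨_, hP⟩
    isSingularDisk := F.isSingularDisk
    path_zero := fun t => congrArg Subtype.val ((F.pathAt t).trans _).source
    path_one := fun t => ((F.pathAt t).trans _).target
    disk_left := F.disk_left
    path_left := fun s => ?_
    disk_right := F.disk_right
    path_right := fun s => ?_ }⟩
  · refine path_trans_congr F.path_left (path_trans_congr (fun t => G.path_left _)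
      (path_trans_congr (signedLoop_congr _ _ ?_ b) G.path_left)) s
    exact G.disk_left
  · refine path_trans_congr F.path_right (path_trans_congr (fun t => G.path_right _)
      (path_trans_congr (signedLoop_congr _ _ ?_ b) G.path_right)) s
    exact G.disk_right

/-- The arc of the boundary of a disk from `exp (2πit)` to `exp (2πi) = 1`. -/
def bdryArc {d : C(Disk, Sph (n + 2))} (h : K.IsSingularDisk N d) (t : I) :
    Path (bdryPt h t) (bdryPt h 0) where
  toFun s := bdryPt h (t + s * (1 - t))
  continuous_toFun := by unfold bdryPt; fun_prop
  source' := by simp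
  target' := by
    simp [bdryPt, Disk.circlePt_zero, Disk.circlePt_one]

/-- Rotating the disk removes a turn around its boundary. -/
theorem Noose.homotopic_loop_trans (D : K.MeridionalDisk N) (α : Path D.exteriorPt p) :
    Noose.Homotopic (⟨D, (bdryLoop D.isSingularDisk).trans α⟩ : K.Noose N p)
      ⟨D, (Path.refl _).trans α⟩ := by
  have hA : Continuous ↿fun t => bdryArc D.isSingularDisk t := by
    refine Continuous.subtype_mk
      (f := fun q : I × I => D.toMap (Disk.circlePt (q.1 + q.2 * (1 - q.1)))) ?_ _
    fun_prop
  have hP := Path.trans_continuous_family _ hA (fun _ => α)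
    (by exact α.continuous.comp continuous_snd)
  have hR : Continuous fun q : I × Disk => D.toMap (Disk.rotate q.1 q.2) :=
    D.toMap.continuous.comp (Disk.continuous_rotate.comp
      (by fun_prop : Continuous fun q : I × Disk => ((q.1 : ℝ), q.2)))
  refine ⟨{
    disk := ⟨_, hR⟩
    path := ⟨_, hP⟩
    isSingularDisk := fun t => D.isSingularDisk.rotate t _ fun z => rfl
    path_zero := fun t => ?_
    path_one := fun t => ((bdryArc D.isSingularDisk t).trans α).target
    disk_left := fun z => ?_
    path_left := fun s => ?_
    disk_right := fun z => ?_
    path_right := fun s => ?_ }⟩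
  · refine (congrArg Subtype.val ((bdryArc D.isSingularDisk t).trans α).source).trans ?_
    simp [bdryPt, Disk.circlePt, Disk.rotate_zero]
  · simp [Disk.rotate_zero]
  · refine path_trans_congr (fun t => ?_) (fun t => rfl) s
    simp [bdryArc, bdryLoop]
  · simp [Disk.rotate_one]
  · refine path_trans_congr (fun t => ?_) (fun t => rfl) s
    refine Subtype.ext (congrArg D.toMap ?_)
    change Disk.circlePt (1 + t * (1 - 1)) = Disk.circlePt 0
    rw [sub_self, mul_zero, add_zero, Disk.circlePt_zero, Disk.circlePt_one]

/-- The operation induced on homotopy classes. -/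
def KnotQuandle.op (b : Bool) : K.KnotQuandle N p → K.KnotQuandle N p → K.KnotQuandle N p :=
  Quot.map₂ (Noose.op b) (fun _ _ _ h => Noose.op_congr b (.refl _) h)
    (fun _ _ _ h => Noose.op_congr b h (.refl _))

theorem Noose.mk_eq_of_path {D : K.MeridionalDisk N} {α β : Path D.exteriorPt p}
    
    (h : Path.Homotopic.Quotient.mk α = Path.Homotopic.Quotient.mk β) : (Quot.mk _ ⟨D, α⟩ : K.KnotQuandle N p) = Quot.mk _ ⟨D, β⟩ :=
  Quot.sound (Noose.homotopic_of_path (Path.Homotopic.Quotient.exact h))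

theorem symm_trans_cancel {X : Type*} [TopologicalSpace X] {a b c : X}
    (P : Path.Homotopic.Quotient a b) (Q : Path.Homotopic.Quotient b c) :
    P.symm.trans (P.trans Q) = Q := by
  rw [← Path.Homotopic.Quotient.trans_assoc]; simp

theorem trans_symm_cancel {X : Type*} [TopologicalSpace X] {a b c : X}
    (P : Path.Homotopic.Quotient b a) (Q : Path.Homotopic.Quotient b c) :
    P.trans (P.symm.trans Q) = Q := by
  rw [← Path.Homotopic.Quotient.trans_assoc]; simp

/-- The knot quandle `Q(K)`, with `[(D, α)] ∗ [(E, β)] = [(D, α · β⁻¹ · ∂E · β)]`; in Mathlib's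
notation the product `x ∗ y` is `Shelf.act y x`. -/
instance KnotQuandle.instQuandle : Quandle (K.KnotQuandle N p) where
  act y x := KnotQuandle.op true x y
  self_distrib {x y z} := by
    induction x using Quot.ind
    induction y using Quot.ind
    induction z using Quot.ind
    refine Noose.mk_eq_of_path ?_
    simp [Noose.op, signedLoop, symm_trans_cancel, trans_symm_cancel]
  invAct y x := KnotQuandle.op false x y
  left_inv y x := by
    induction x using Quot.ind
    induction y using Quot.ind
    refine Noose.mk_eq_of_path ?_
    simp [Noose.op, signedLoop, trans_symm_cancel]
  right_inv y x := by
    induction x using Quot.ind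
    induction y using Quot.ind
    refine Noose.mk_eq_of_path ?_
    simp [Noose.op, signedLoop, trans_symm_cancel, symm_trans_cancel]
  fix {x} := by
    induction x using Quot.ind with | mk ν =>
    obtain ⟨D, α⟩ := ν
    calc (Quot.mk _ (Noose.op true ⟨D, α⟩ ⟨D, α⟩) : K.KnotQuandle N p)
        = Quot.mk _ ⟨D, (bdryLoop D.isSingularDisk).trans α⟩ := by
          refine Noose.mk_eq_of_path ?_
          simp [signedLoop, trans_symm_cancel]
      _ = Quot.mk _ ⟨D, (Path.refl _).trans α⟩ := Quot.sound (Noose.homotopic_loop_trans D α)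
      _ = Quot.mk _ ⟨D, α⟩ := Noose.mk_eq_of_path (by simp)

/-! ### The monodromy -/

/-- The inclusion of a fiber into the complement. -/
def fiberIncl (K : Knot n) (π : C(K.Complement, Circle)) (s : Circle) :
    C(K.Fiber π s, K.Complement) := ⟨Subtype.val, continuous_subtype_val⟩

/-- Concatenation of loops is the opposite of the multiplication of `FundamentalGroup`; inversion is
an isomorphism between the generalized Alexander quandles of `(G, φ)` and of `(Gᵒᵖ, φ)`, so the
convention does not matter.

`φ` is the monodromy of the fibered knot, with respect to the meridional disk `D`: it sends
`[γ]` to `[δ]` exactly when the loop `(∂D)⁻¹ · γ · ∂D` is homotopic, in the complement of `K`, to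
the loop `δ` of the fiber. -/
def IsMonodromy {π : C(K.Complement, Circle)} {s : Circle} (D : K.MeridionalDisk N)
    (h : π D.basePt = s)
    (φ : FundamentalGroup (K.Fiber π s) ⟨D.basePt, h⟩ ≃*
      FundamentalGroup (K.Fiber π s) ⟨D.basePt, h⟩) : Prop :=
  ∀ γ δ : Path (⟨D.basePt, h⟩ : K.Fiber π s) ⟨D.basePt, h⟩,
    φ (FundamentalGroup.fromPath (Path.Homotopic.Quotient.mk γ)) =
        FundamentalGroup.fromPath (Path.Homotopic.Quotient.mk δ) ↔
      (D.loop.symm.trans ((γ.map (K.fiberIncl π s).continuous).trans D.loop)).Homotopic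
        (δ.map (K.fiberIncl π s).continuous)

end Knot

end

noncomputable section


/-! ### Simply connected spaces -/

/-! Write `m` for the boundary loop of `D₀` in the fundamental group Γ of the exterior, and products
of loops in the order of concatenation. The knot quandle is the set of cosets ⟨m⟩P in Γ, and the
group `G` of the fiber is a set of representatives of these cosets.

Nooses as cosets. Any two meridional disks are homotopic through singular ones
(`exists_homotopyWith`). In tubular coordinates a disk has a component in `K`, which can be
contracted, and a normal component with a single zero. The zero is moved to the centre by Möbius
maps. Transversality with sign `+1` makes the derivative there orientation preserving, and an angle
function then deforms the normal component to the identity or, for all disks alike, to conjugation.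
So the disk of a noose can be moved to `D₀`, and its path becomes a loop, determined up to a loop in
the boundary of the tube put in front of it. This boundary is `K × S¹` with `K` simply connected,
because `n ≥ 2`, so such loops are powers of `m` (`exists_zpow_bdryLoop`). These in turn are
absorbed by rotating the disk. The product of the cosets of P and Q contains PQ⁻¹mQ, and therefore
also m⁻¹(PQ⁻¹)mQ (`represents_op`).

The fiber. Parallel transport in the bundle shows that `G` embeds in Γ as the kernel of the total
angle of `π` along loops (`exists_fiberHom`). Conjugation by `m` preserves this kernel, and this is
the monodromy φ. Since the angle of `m` is ±2π, every coset of ⟨m⟩ meets `G` exactly once, and the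
product formula reads φ(PQ⁻¹)Q.

The angle of `m` (`abs_angle_bdryLoop`). Near `K` the map `π` has the form `z ^ d * exp h` in polar
coordinates, and `d = ±1` must be extracted from the hypothesis that the closures of the fibers are
Seifert surfaces: near a point of `K`, a fiber is connected, and so is the union of the other
fibers. If `d = 0`, then `π` has a logarithm on the whole complement. The local structure bounds it,
while parallel transport makes it grow without bound. If `|d| ≥ 2`, a `d`-th root of `π` is constant
on the connected local fiber and misses another root of unity, although it has degree one on small
circles around `K`. -/

theorem IsSimplyConnected.path_homotopic {X : Type*} [TopologicalSpace X] {U : Set X}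
    (hU : IsSimplyConnected U) {x y : X} (p q : Path x y) (hp : ∀ t, p t ∈ U) (hq : ∀ t, q t ∈ U) :
    p.Homotopic q := by
  have := hU.simplyConnectedSpace
  have hx : x ∈ U := by simpa using hp 0
  have hy : y ∈ U := by simpa using hp 1
  let p' : Path (⟨x, hx⟩ : U) ⟨y, hy⟩ :=
    { toFun := fun t => ⟨p t, hp t⟩
      source' := by simp
      target' := by simp }
  let q' : Path (⟨x, hx⟩ : U) ⟨y, hy⟩ :=
    { toFun := fun t => ⟨q t, hq t⟩
      source' := by simp
      target' := by simp }
  exact (SimplyConnectedSpace.paths_homotopic p' q').map ⟨Subtype.val, continuous_subtype_val⟩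

/-- A choice of path classes from `x₀` which is compatible with short paths computes the classes of
all paths. -/
theorem Path.mk_trans_eq_of_forall_mem {X ι : Type*} [TopologicalSpace X] {x₀ : X} {U : ι → Set X}
    (hU : ∀ i, IsOpen (U i)) (hcov : ∀ x, ∃ i, x ∈ U i)
    (c : ∀ y : X, Path.Homotopic.Quotient x₀ y)
    (hc : ∀ i (y z : X) (δ : Path y z), (∀ t, δ t ∈ U i) → (c y).trans (.mk δ) = c z)
    {y z : X} (γ : Path y z) : (c y).trans (.mk γ) = c z := by
  -- The Lebesgue number lemma cuts `γ` into finitely many pieces, each inside one `U i`; the claim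
  -- is propagated from piece to piece.
  obtain ⟨t, t0, tm, ⟨N, hN⟩, ht⟩ := exists_monotone_Icc_subset_open_cover_unitInterval
    (c := fun i => γ ⁻¹' U i) (fun i => (hU i).preimage γ.continuous)
    (fun s _ => Set.mem_iUnion.2 (hcov (γ s)))
  have key : ∀ k, (c (γ (t 0))).trans (.mk (γ.subpath (t 0) (t k))) = c (γ (t k)) := by
    intro k
    induction k with
    | zero => simp
    | succ k ih =>
      obtain ⟨i, hi⟩ := ht k
      have h1 := hc i _ _ (γ.subpath (t k) (t (k + 1))) (fun s => by
        have : γ.subpath (t k) (t (k + 1)) s ∈ Set.range (γ.subpath (t k) (t (k + 1))) := ⟨s, rfl⟩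
        rw [Path.range_subpath_of_le _ _ _ (tm (Nat.le_succ k))] at this
        obtain ⟨u, hu, hu'⟩ := this
        rw [← hu']
        exact hi hu)
      have h2 := Path.Homotopic.Quotient.eq.2
        ⟨Path.Homotopy.subpathTransSubpath γ (t 0) (t k) (t (k + 1))⟩
      rw [← h2, Path.Homotopic.Quotient.mk_trans, ← Path.Homotopic.Quotient.trans_assoc, ih, h1]
  have h3 := key N
  rw [hN N le_rfl, t0] at h3
  have hγ : γ.subpath 0 1 = γ.cast γ.source γ.target := γ.subpath_zero_one
  rw [hγ] at h3
  have hcast : ∀ {y' z' : X} (hy : y' = y) (hz : z' = z),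
      (c y').trans (.mk (γ.cast hy hz)) = c z' → (c y).trans (.mk γ) = c z := by
    rintro _ _ rfl rfl h
    exact h
  exact hcast _ _ h3

/-- The simplest case of the Seifert–van Kampen theorem. -/
theorem simplyConnectedSpace_of_union {X : Type*} [TopologicalSpace X] {U V : Set X}
    (hU : IsOpen U) (hV : IsOpen V) (hUV : U ∪ V = Set.univ) (hU' : IsSimplyConnected U)
    (hV' : IsSimplyConnected V) (hi : IsPathConnected (U ∩ V)) : SimplyConnectedSpace X := by
  classical
  obtain ⟨x₀, hx₀, hj⟩ := hi
  have hcov : ∀ y, y ∉ U → y ∈ V := fun y hy =>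
    (hUV.symm.subset (Set.mem_univ y)).resolve_left hy
  have jU : ∀ y ∈ U, JoinedIn U x₀ y := fun y hy => hU'.isPathConnected.joinedIn _ hx₀.1 _ hy
  have jV : ∀ y ∈ V, JoinedIn V x₀ y := fun y hy => hV'.isPathConnected.joinedIn _ hx₀.2 _ hy
  -- The class of a path inside `U` or inside `V` from `x₀`. Over the intersection the two choices
  -- agree: both are compared with a path inside `U ∩ V`, which is path connected.
  let c : ∀ y : X, Path.Homotopic.Quotient x₀ y := fun y =>
    if h : y ∈ U then .mk (jU y h).somePath else .mk (jV y (hcov y h)).somePath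
  have cU : ∀ y (δ : Path x₀ y), (∀ t, δ t ∈ U) → c y = .mk δ := by
    intro y δ hδ
    have hy : y ∈ U := by simpa using hδ 1
    simp only [c, dif_pos hy]
    exact Path.Homotopic.Quotient.eq.2
      (hU'.path_homotopic _ _ (fun t => (jU y hy).somePath_mem t) hδ)
  have cV : ∀ y (δ : Path x₀ y), (∀ t, δ t ∈ V) → c y = .mk δ := by
    intro y δ hδ
    have hy : y ∈ V := by simpa using hδ 1
    by_cases h : y ∈ U
    · have hj' := hj ⟨h, hy⟩
      rw [cU y hj'.somePath (fun t => (hj'.somePath_mem t).1)]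
      exact Path.Homotopic.Quotient.eq.2
        (hV'.path_homotopic _ _ (fun t => (hj'.somePath_mem t).2) hδ)
    · simp only [c, dif_neg h]
      exact Path.Homotopic.Quotient.eq.2
        (hV'.path_homotopic _ _ (fun t => (jV y hy).somePath_mem t) hδ)
  have trans_mem : ∀ (W : Set X) {y z : X} (p : Path x₀ y) (δ : Path y z), (∀ t, p t ∈ W) →
      (∀ t, δ t ∈ W) → ∀ t, (p.trans δ) t ∈ W := by
    intro W y z p δ hp hδ t
    rw [Path.trans_apply]
    split_ifs
    · exact hp _
    · exact hδ _
  have key := fun {y z : X} (γ : Path y z) => Path.mk_trans_eq_of_forall_mem (ι := Bool)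
    (U := fun b => if b then U else V) (by rintro (_ | _) <;> simpa) (fun y => by
      by_cases h : y ∈ U
      · exact ⟨true, by simpa using h⟩
      · exact ⟨false, by simpa using hcov y h⟩) c (by
      rintro (_ | _) y z δ hδ
      · simp only [Bool.false_eq_true, if_false] at hδ
        have hy : y ∈ V := by simpa using hδ 0
        rw [cV y _ (jV y hy).somePath_mem, ← Path.Homotopic.Quotient.mk_trans,
          cV z _ (trans_mem V _ _ (jV y hy).somePath_mem hδ)]
      · simp only [if_true] at hδ
        have hy : y ∈ U := by simpa using hδ 0
        rw [cU y _ (jU y hy).somePath_mem, ← Path.Homotopic.Quotient.mk_trans,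
          cU z _ (trans_mem U _ _ (jU y hy).somePath_mem hδ)]) γ
  rw [simply_connected_iff_paths_homotopic']
  refine ⟨⟨⟨x₀⟩, fun x y => ?_⟩, fun {x y} p q => ?_⟩
  · have : ∀ y, Joined x₀ y := fun y => by
      by_cases h : y ∈ U
      · exact (jU y h).joined
      · exact (jV y (hcov y h)).joined
    exact (this x).symm.trans (this y)
  · have h := (key p).trans (key q).symm
    apply Path.Homotopic.Quotient.exact
    have := congrArg (fun r => (c x).symm.trans r) h
    simpa only [Knot.symm_trans_cancel] using this

/-- The complements of two antipodal points are simply connected by stereographic projection, and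
their intersection corresponds to a hyperplane of dimension at least two minus a point. -/
theorem simplyConnectedSpace_sphere {E : Type*} [NormedAddCommGroup E] [InnerProductSpace ℝ E]
    [FiniteDimensional ℝ E] (h : 2 < Module.finrank ℝ E) :
    SimplyConnectedSpace (Metric.sphere (0 : E) 1) := by
  have hr : 1 < Module.rank ℝ E := by
    rw [← Module.finrank_eq_rank]
    exact_mod_cast (by lia : 1 < Module.finrank ℝ E)
  have : Nontrivial E := Module.nontrivial_of_finrank_pos (R := ℝ) (by lia)
  obtain ⟨v, hv⟩ : ∃ v : E, ‖v‖ = 1 := exists_norm_eq E zero_le_one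
  have main : ∀ w : Metric.sphere (0 : E) 1, IsSimplyConnected ({w}ᶜ : Set (Metric.sphere (0 : E) 1)) := by
    intro w
    have hw : ‖(w : E)‖ = 1 := by simpa using w.2
    have e := (stereographic hw).toHomeomorphSourceTarget
    have h1 : IsSimplyConnected (stereographic hw).target := by
      rw [stereographic_target]
      have : SimplyConnectedSpace (ℝ ∙ (w : E))ᗮ := inferInstance
      exact (Homeomorph.Set.univ _).toHomotopyEquiv.simplyConnectedSpace_iff.2 this
    have h2 : IsSimplyConnected (stereographic hw).source :=
      e.toHomotopyEquiv.simplyConnectedSpace_iff.2 h1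
    rwa [stereographic_source] at h2
  let a : Metric.sphere (0 : E) 1 := ⟨v, by simp [hv]⟩
  have hne : -a ≠ a := by
    intro h
    have h0 : -v = v := congrArg Subtype.val h
    have : v = 0 := by
      have : (2 : ℝ) • v = 0 := by
        rw [two_smul]; nth_rewrite 1 [← h0]; simp
      simpa using this
    simp [this] at hv
  refine simplyConnectedSpace_of_union (U := {a}ᶜ) (V := {-a}ᶜ) isOpen_compl_singleton
    isOpen_compl_singleton ?_ (main a) (main (-a)) ?_
  · rw [← Set.compl_inter, Set.compl_univ_iff, Set.singleton_inter_eq_empty]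
    simpa using hne.symm
  · have hF : 1 < Module.finrank ℝ (ℝ ∙ v)ᗮ := by
      have := Submodule.finrank_add_finrank_orthogonal (ℝ ∙ v)
      rw [finrank_span_singleton (by rintro rfl; simp at hv)] at this
      lia
    have hF' : 1 < Module.rank ℝ (ℝ ∙ v)ᗮ := by
      rw [← Module.finrank_eq_rank]; exact_mod_cast hF
    -- Projecting from `a`, the intersection of the two open sets is the hyperplane without the
    -- image of `-a`.
    have hp := isPathConnected_compl_singleton_of_one_lt_rank hF' (stereographic hv (-a))
    have hp2 := hp.image (isOpenEmbedding_stereographic_symm hv).continuous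
    convert hp2 using 1
    have hsrc := stereographic_source hv
    ext y
    constructor
    · rintro ⟨hy1, hy2⟩
      refine ⟨stereographic hv y, ?_, (stereographic hv).left_inv ?_⟩
      · intro h
        exact hy2 ((stereographic hv).injOn (by rw [hsrc]; exact hy1) (by rw [hsrc]; exact hne) h)
      · rw [hsrc]; exact hy1
    · rintro ⟨w, hw, rfl⟩
      have hm : (stereographic hv).symm w ∈ (stereographic hv).source :=
        (stereographic hv).map_target (by simp)
      refine ⟨by rw [hsrc] at hm; exact hm, fun h => hw ?_⟩
      rw [Set.mem_singleton_iff] at h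
      rw [Set.mem_singleton_iff, ← h, (stereographic hv).right_inv (by simp)]

instance SimplyConnectedSpace.prod {X Y : Type*} [TopologicalSpace X] [TopologicalSpace Y]
    [SimplyConnectedSpace X] [SimplyConnectedSpace Y] : SimplyConnectedSpace (X × Y) := by
  rw [simply_connected_iff_paths_homotopic]
  refine ⟨inferInstance, fun x y => ⟨fun p q => ?_⟩⟩
  rw [← Path.Homotopic.prod_projLeft_projRight p, ← Path.Homotopic.prod_projLeft_projRight q,
    Subsingleton.elim (Path.Homotopic.projLeft p) (Path.Homotopic.projLeft q),
    Subsingleton.elim (Path.Homotopic.projRight p) (Path.Homotopic.projRight q)]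

instance unitInterval.contractibleSpace : ContractibleSpace I :=
  (convex_Icc (0 : ℝ) 1).contractibleSpace ⟨0, by simp⟩

/-- The sides of a continuous square. -/
theorem Path.homotopic_of_square {X : Type*} [TopologicalSpace X] (F : C(I × I, X)) {a b c d : X}
    (l : Path a b) (t : Path b d) (u : Path a c) (r : Path c d)
    (hl : ∀ s, l s = F (0, s)) (ht : ∀ s, t s = F (s, 1)) (hu : ∀ s, u s = F (s, 0))
    (hr : ∀ s, r s = F (1, s)) : (l.trans t).Homotopic (u.trans r) := by
  obtain rfl : a = F (0, 0) := by rw [← hl, l.source]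
  obtain rfl : b = F (0, 1) := by rw [← hl, l.target]
  obtain rfl : c = F (1, 0) := by rw [← hr, r.source]
  obtain rfl : d = F (1, 1) := by rw [← hr, r.target]
  let l' : Path ((0, 0) : I × I) (0, 1) := ⟨⟨fun s => (0, s), by fun_prop⟩, rfl, rfl⟩
  let t' : Path ((0, 1) : I × I) (1, 1) := ⟨⟨fun s => (s, 1), by fun_prop⟩, rfl, rfl⟩
  let u' : Path ((0, 0) : I × I) (1, 0) := ⟨⟨fun s => (s, 0), by fun_prop⟩, rfl, rfl⟩
  let r' : Path ((1, 0) : I × I) (1, 1) := ⟨⟨fun s => (1, s), by fun_prop⟩, rfl, rfl⟩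
  have h := (SimplyConnectedSpace.paths_homotopic (l'.trans t') (u'.trans r')).map F
  rw [Path.map_trans, Path.map_trans] at h
  convert h
  · ext s; exact hl s
  · ext s; exact ht s
  · ext s; exact hu s
  · ext s; exact hr s

end

noncomputable section


/-! ### Angles of maps to the circle -/

instance unitInterval.locallyPathConnectedSpace : LocallyPathConnectedSpace I :=
  (isQuotientMap_projIcc (h := zero_le_one (α := ℝ))).locallyPathConnectedSpace

theorem Circle.exists_lift {A : Type*} [TopologicalSpace A] [SimplyConnectedSpace A]
    [LocallyPathConnectedSpace A] (f : C(A, Circle)) : ∃ h : C(A, ℝ), ∀ a, Circle.exp (h a) = f a := by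
  obtain ⟨a₀⟩ : Nonempty A := inferInstance
  obtain ⟨h, ⟨-, hh⟩, -⟩ := Circle.isCoveringMap_exp.existsUnique_continuousMap_lifts f a₀
    (Complex.arg (f a₀)) (by simp)
  exact ⟨h, congrFun hh⟩

theorem Circle.exp_sub_eq_one_of_lifts {A : Type*} {h k : A → ℝ}
    (e : ∀ a, Circle.exp (h a) = Circle.exp (k a)) (a : A) : Circle.exp (h a - k a) = 1 := by
  rw [Circle.exp_sub, e, div_self']

theorem Circle.eq_of_exp_eq_const {A : Type*} [TopologicalSpace A] [PreconnectedSpace A] {h : A → ℝ}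
    (hh : Continuous h) {c : Circle} (e : ∀ a, Circle.exp (h a) = c) (a b : A) : h a = h b := by
  have := Circle.isCoveringMap_exp.eq_of_comp_eq (g₁ := h) (g₂ := fun _ => h b) hh continuous_const
    (funext fun x => by simp [e]) b rfl
  exact congrFun this a

theorem Circle.sub_eq_of_lifts {A : Type*} [TopologicalSpace A] [PreconnectedSpace A] {h k : A → ℝ}
    (hh : Continuous h) (hk : Continuous k) (e : ∀ a, Circle.exp (h a) = Circle.exp (k a)) (a b : A) :
    h a - k a = h b - k b :=
  Circle.eq_of_exp_eq_const (hh.sub hk) (Circle.exp_sub_eq_one_of_lifts e) a b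

section Wind

variable {X : Type*} [TopologicalSpace X] (f : C(X, Circle)) {x y z : X}

theorem Path.exists_circle_lift (γ : Path x y) :
    ∃ h : C(I, ℝ), ∀ t, Circle.exp (h t) = f (γ t) :=
  Circle.exists_lift (f.comp γ.toContinuousMap)

/-- The total change of the angle of `f` along a path. -/
def Path.angle (γ : Path x y) : ℝ :=
  (γ.exists_circle_lift f).choose 1 - (γ.exists_circle_lift f).choose 0

/-- Two lifts of the same path differ by a constant, so any lift computes the angle. -/
theorem Path.angle_eq (γ : Path x y) {h : I → ℝ} (hh : Continuous h)
    (e : ∀ t, Circle.exp (h t) = f (γ t)) : γ.angle f = h 1 - h 0 := by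
  have := Circle.sub_eq_of_lifts hh (γ.exists_circle_lift f).choose.continuous
    (fun t => (e t).trans ((γ.exists_circle_lift f).choose_spec t).symm) 0 1
  unfold Path.angle
  linarith

/-- The homotopy lifts as a whole square, and the lift is constant on the two sides where the
endpoints are fixed. -/
theorem Path.Homotopic.angle_eq {γ δ : Path x y} (h : γ.Homotopic δ) : γ.angle f = δ.angle f := by
  obtain ⟨H⟩ := h
  obtain ⟨k, hk⟩ := Circle.exists_lift (f.comp H.toContinuousMap)
  rw [γ.angle_eq f (h := fun s => k (0, s)) (by fun_prop) (fun t => by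
      rw [hk]; exact congrArg f (H.apply_zero t)),
    δ.angle_eq f (h := fun s => k (1, s)) (by fun_prop) (fun t => by
      rw [hk]; exact congrArg f (H.apply_one t)),
    Circle.eq_of_exp_eq_const (h := fun t : I => k (t, 0)) (c := f x) (by fun_prop) (fun t => by
      rw [hk]; exact congrArg f (H.source t)) 0 1,
    Circle.eq_of_exp_eq_const (h := fun t : I => k (t, 1)) (c := f y) (by fun_prop) (fun t => by
      rw [hk]; exact congrArg f (H.target t)) 0 1]

theorem Path.angle_trans (γ : Path x y) (δ : Path y z) :
    (γ.trans δ).angle f = γ.angle f + δ.angle f := by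
  obtain ⟨h, hh⟩ := γ.exists_circle_lift f
  obtain ⟨k, hk⟩ := δ.exists_circle_lift f
  have e : Circle.exp (h 1 - k 0) = 1 := by
    rw [Circle.exp_sub, hh, hk, γ.target, δ.source, div_self']
  -- The second lift is shifted by a multiple of `2π` so that it starts where the first one ends;
  -- the concatenation is then a lift.
  let h' : Path (h 0) (h 1) := ⟨h, rfl, rfl⟩
  let k' : Path (h 1) (k 1 + (h 1 - k 0)) :=
    ⟨⟨fun t => k t + (h 1 - k 0), by fun_prop⟩, by simp, rfl⟩
  rw [γ.angle_eq f h.continuous hh, δ.angle_eq f k.continuous hk,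
    Path.angle_eq f _ (h'.trans k').continuous fun t => ?_]
  · simp only [Path.source, Path.target]; ring
  · rw [Path.trans_apply, Path.trans_apply]
    split_ifs with ht
    · exact hh _
    · change Circle.exp (k _ + (h 1 - k 0)) = _
      rw [Circle.exp_add, e, mul_one, hk]

theorem Path.angle_symm (γ : Path x y) : γ.symm.angle f = - γ.angle f := by
  obtain ⟨h, hh⟩ := γ.exists_circle_lift f
  rw [γ.angle_eq f h.continuous hh, Path.angle_eq f γ.symm (h := fun t => h (σ t)) (by fun_prop)
    fun t => by rw [hh]; rfl]
  simp

theorem Path.angle_refl (x : X) : (Path.refl x).angle f = 0 := by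
  rw [Path.angle_eq f _ (h := fun _ => Complex.arg (f x)) continuous_const (fun t => by simp)]
  simp

/-- The total change of the angle of `f` along a path class. -/
def Path.Homotopic.Quotient.angle (P : Path.Homotopic.Quotient x y) : ℝ :=
  Quotient.lift (fun γ : Path x y => γ.angle f) (fun _ _ h => Path.Homotopic.angle_eq f h) P

namespace Path.Homotopic.Quotient

theorem angle_mk (γ : Path x y) : (mk γ).angle f = γ.angle f := rfl

theorem angle_trans (P : Path.Homotopic.Quotient x y) (Q : Path.Homotopic.Quotient y z) :
    (P.trans Q).angle f = P.angle f + Q.angle f := by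
  induction P using Path.Homotopic.Quotient.ind
  induction Q using Path.Homotopic.Quotient.ind
  rw [← mk_trans]
  exact Path.angle_trans f _ _

theorem angle_symm (P : Path.Homotopic.Quotient x y) : P.symm.angle f = - P.angle f := by
  induction P using Path.Homotopic.Quotient.ind
  rw [← mk_symm]
  exact Path.angle_symm f _

theorem angle_refl (x : X) : (refl x).angle f = 0 := Path.angle_refl f x

theorem exists_int_angle_eq (P : Path.Homotopic.Quotient x x) :
    ∃ k : ℤ, P.angle f = k * (2 * Real.pi) := by
  induction P using Path.Homotopic.Quotient.ind with | mk γ =>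
  obtain ⟨h, hh⟩ := γ.exists_circle_lift f
  rw [angle_mk, γ.angle_eq f h.continuous hh]
  obtain ⟨k, hk⟩ := Circle.exp_eq_exp.1 (((hh 1).trans (congrArg f (γ.target.trans γ.source.symm))).trans (hh 0).symm)
  exact ⟨k, by rw [hk]; ring⟩

end Path.Homotopic.Quotient

end Wind

/-! ### Locally trivial maps to the circle -/

/-- Let `c` be the supremum of the points up to which `p` is trivial from `a`. A trivialization near
`c`, glued to one that ends slightly before `c`, shows that `c` is attained. As base sets are open,
`c < b` would allow going further. -/
theorem Bundle.Trivialization.exists_Icc_subset_baseSet {Z F : Type*} [TopologicalSpace Z]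
    [TopologicalSpace F] {p : Z → ℝ} (hp : ∀ b, ∃ e : Bundle.Trivialization F p, b ∈ e.baseSet)
    (a b : ℝ) : ∃ e : Bundle.Trivialization F p, Set.Icc a b ⊆ e.baseSet := by
  obtain ⟨ea, hea⟩ := hp a
  rcases lt_or_ge b a with hba | hab
  · exact ⟨ea, by simp [*]⟩
  set s : Set ℝ := {x ∈ Set.Icc a b | ∃ e : Bundle.Trivialization F p, Set.Icc a x ⊆ e.baseSet}
  have ha : a ∈ s := ⟨Set.left_mem_Icc.2 hab, ea, by simp [hea]⟩
  have sne : s.Nonempty := ⟨a, ha⟩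
  have hsb : b ∈ upperBounds s := fun x hx => hx.1.2
  have sbd : BddAbove s := ⟨b, hsb⟩
  set c := sSup s
  have hsc : IsLUB s c := isLUB_csSup sne sbd
  have hc : c ∈ Set.Icc a b := ⟨hsc.1 ha, hsc.2 hsb⟩
  obtain ⟨-, ec, hec⟩ : c ∈ s := by
    rcases hc.1.eq_or_lt with heq | hlt
    · rwa [← heq]
    refine ⟨hc, ?_⟩
    obtain ⟨ec, hc⟩ := hp c
    obtain ⟨c', hc', hc'e⟩ : ∃ c' ∈ Set.Ico a c, Set.Ioc c' c ⊆ ec.baseSet :=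
      (mem_nhdsLE_iff_exists_mem_Ico_Ioc_subset hlt).1
        (mem_nhdsWithin_of_mem_nhds <| IsOpen.mem_nhds ec.open_baseSet hc)
    obtain ⟨d, ⟨hdab, ead, had⟩, hd⟩ : ∃ d ∈ s, d ∈ Set.Ioc c' c := hsc.exists_between hc'.2
    refine ⟨ead.piecewiseLe ec d (had ⟨hdab.1, le_rfl⟩) (hc'e hd), Set.subset_ite.2 ?_⟩
    exact ⟨fun x hx => had ⟨hx.1.1, hx.2⟩, fun x hx => hc'e ⟨hd.1.trans (not_le.1 hx.2), hx.1.2⟩⟩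
  rcases hc.2.eq_or_lt with heq | hlt
  · exact ⟨ec, heq ▸ hec⟩
  obtain ⟨d, hdcb, hd⟩ : ∃ d ∈ Set.Ioc c b, Set.Ico c d ⊆ ec.baseSet :=
    (mem_nhdsGE_iff_exists_mem_Ioc_Ico_subset hlt).1
      (mem_nhdsWithin_of_mem_nhds <| IsOpen.mem_nhds ec.open_baseSet (hec ⟨hc.1, le_rfl⟩))
  obtain ⟨d', hcd', hd'd⟩ := exists_between hdcb.1
  have had : Set.Ico a d ⊆ ec.baseSet :=
    Set.Ico_subset_Icc_union_Ico.trans (Set.union_subset hec hd)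
  have : d' ∈ s := ⟨⟨hc.1.trans hcd'.le, hd'd.le.trans hdcb.2⟩, ec,
    (Set.Icc_subset_Ico_right hd'd).trans had⟩
  exact absurd (hsc.1 this) (not_le.2 hcd')

section CircleBundle

variable {X F : Type*} [TopologicalSpace X] [TopologicalSpace F] (p : C(X, Circle))

/-- The pullback of `p` along the universal covering of the circle. -/
abbrev CirclePullback : Type _ := {q : X × ℝ // p q.1 = Circle.exp q.2}

/-- The pullback of a trivialization along the universal covering of the circle. -/
def Bundle.Trivialization.circlePullback (e : Bundle.Trivialization F p) :
    Bundle.Trivialization F (fun q : CirclePullback p => q.1.2) where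
  toFun q := (q.1.2, (e q.1.1).2)
  -- The second branch is a default value outside the target: any point of the total space together
  -- with some argument of its image.
  invFun r := open Classical in
    if h : Circle.exp r.1 ∈ e.baseSet then
      ⟨(e.toOpenPartialHomeomorph.symm (Circle.exp r.1, r.2), r.1), e.proj_symm_apply' h⟩
    else ⟨((e.toOpenPartialHomeomorph.symm (Circle.exp r.1, r.2)),
      Complex.arg (p (e.toOpenPartialHomeomorph.symm (Circle.exp r.1, r.2)))), by simp⟩
  source := {q | Circle.exp q.1.2 ∈ e.baseSet}
  target := (Circle.exp ⁻¹' e.baseSet) ×ˢ Set.univ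
  map_source' q hq := ⟨hq, trivial⟩
  map_target' r hr := by
    have hr1 : Circle.exp r.1 ∈ e.baseSet := hr.1
    simpa [hr1] using hr1
  left_inv' q hq := by
    have hq1 : Circle.exp q.1.2 ∈ e.baseSet := hq
    simp only [hq1, dif_pos]
    apply Subtype.ext
    refine Prod.ext ?_ rfl
    have h2 : q.1.1 ∈ e.source := by rw [e.mem_source, q.2]; exact hq1
    change e.toOpenPartialHomeomorph.symm (Circle.exp q.1.2, (e q.1.1).2) = q.1.1
    rw [← q.2]
    exact e.symm_apply_mk_proj h2
  right_inv' r hr := by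
    have hr1 : Circle.exp r.1 ∈ e.baseSet := hr.1
    simp only [hr1, dif_pos]
    refine Prod.ext rfl ?_
    change (e (e.toOpenPartialHomeomorph.symm (Circle.exp r.1, r.2))).2 = r.2
    rw [e.apply_symm_apply' hr1]
  open_source := by
    have : Continuous fun q : CirclePullback p => Circle.exp q.1.2 := by fun_prop
    exact e.open_baseSet.preimage this
  open_target := (e.open_baseSet.preimage Circle.exp.continuous).prod isOpen_univ
  continuousOn_toFun := by
    refine ContinuousOn.prodMk (by fun_prop) (continuous_snd.comp_continuousOn
      (e.continuousOn_toFun.comp (by fun_prop) fun q hq => ?_))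
    rw [e.source_eq, Set.mem_preimage, q.2]
    exact hq
  continuousOn_invFun := by
    refine continuousOn_iff_continuous_domRestrict.2 ?_
    refine Topology.IsInducing.subtypeVal.continuous_iff.2 ?_
    have : ContinuousOn (fun r : ℝ × F => (e.toOpenPartialHomeomorph.symm (Circle.exp r.1, r.2), r.1))
        ((Circle.exp ⁻¹' e.baseSet) ×ˢ Set.univ) := by
      refine ContinuousOn.prodMk (e.continuousOn_invFun.comp
        (Continuous.continuousOn (by fun_prop)) fun r hr => ?_) (by fun_prop)
      rw [e.target_eq]
      exact ⟨hr.1, trivial⟩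
    refine (continuousOn_iff_continuous_domRestrict.1 this).congr fun r => ?_
    have hr1 : Circle.exp r.1.1 ∈ e.baseSet := r.2.1
    simp [hr1]
  baseSet := Circle.exp ⁻¹' e.baseSet
  open_baseSet := e.open_baseSet.preimage Circle.exp.continuous
  source_eq := rfl
  target_eq := rfl
  proj_toFun q hq := rfl

variable {p}

/-- Parallel transport over a bounded interval in the pullback to the line. -/
theorem exists_transport (hp : ∀ s, ∃ e : Bundle.Trivialization F p, s ∈ e.baseSet) (a b : ℝ) :
    ∃ T : CirclePullback p × ℝ → X,
      ContinuousOn T {r | r.1.1.2 ∈ Set.Icc a b ∧ r.2 ∈ Set.Icc a b} ∧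
      ∀ r : CirclePullback p × ℝ, r.1.1.2 ∈ Set.Icc a b → r.2 ∈ Set.Icc a b →
        p (T r) = Circle.exp r.2 ∧ (r.2 = r.1.1.2 → T r = r.1.1.1) := by
  obtain ⟨e, he⟩ := Bundle.Trivialization.exists_Icc_subset_baseSet
    (p := fun q : CirclePullback p => q.1.2) (F := F) (fun t => by
      obtain ⟨e, he⟩ := hp (Circle.exp t)
      exact ⟨e.circlePullback p, he⟩) a b
  -- In a trivialization over the whole interval, transport keeps the fiber coordinate and changes
  -- the base coordinate.
  refine ⟨fun r => (e.toOpenPartialHomeomorph.symm (r.2, (e r.1).2)).1.1, ?_, ?_⟩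
  · refine (continuous_fst.comp continuous_subtype_val).comp_continuousOn
      (e.continuousOn_invFun.comp (ContinuousOn.prodMk (by fun_prop)
        (continuous_snd.comp_continuousOn (e.continuousOn_toFun.comp (by fun_prop) ?_))) ?_)
    · intro r hr
      rw [e.source_eq]
      exact he hr.1
    · intro r hr
      rw [e.target_eq]
      exact ⟨he hr.2, trivial⟩
  · intro r h1 h2
    refine ⟨?_, fun h => ?_⟩
    · rw [(e.toOpenPartialHomeomorph.symm (r.2, (e r.1).2)).2]
      congr 1
      exact e.proj_symm_apply' (he h2)
    · change (e.toOpenPartialHomeomorph.symm (r.2, (e r.1).2)).1.1 = _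
      rw [h]
      have : e.toOpenPartialHomeomorph.symm (r.1.1.2, (e r.1).2) = r.1 :=
        e.symm_apply_mk_proj (by rw [e.source_eq]; exact he h1)
      rw [this]

/-- Transport of `x` along the universal covering of the circle. A logarithm of `p` grows by exactly
`a` along this path, which is how global logarithms are excluded later. -/
theorem exists_path_over_line (hp : ∀ s, ∃ e : Bundle.Trivialization F p, s ∈ e.baseSet) (a : ℝ)
    (ha : 0 ≤ a) {x : X} (hx : p x = 1) :
    ∃ c : ℝ → X, ContinuousOn c (Set.Icc 0 a) ∧ c 0 = x ∧
      ∀ t ∈ Set.Icc 0 a, p (c t) = Circle.exp t := by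
  obtain ⟨T, hT, hT'⟩ := exists_transport hp 0 a
  have h0 : (0 : ℝ) ∈ Set.Icc 0 a := ⟨le_rfl, ha⟩
  refine ⟨fun t => T (⟨(x, 0), by simp [hx]⟩, t), ?_, ?_, ?_⟩
  · exact hT.comp (Continuous.continuousOn (by fun_prop)) fun t ht => ⟨h0, ht⟩
  · exact (hT' _ h0 h0).2 rfl
  · exact fun t ht => (hT' (_, t) h0 ht).1

theorem exists_bound_of_compact {A : Type*} [TopologicalSpace A] [CompactSpace A] (h : C(A, ℝ)) :
    ∃ M : ℝ, 0 ≤ M ∧ ∀ a, h a ∈ Set.Icc (-M) M := by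
  refine ⟨‖h‖, norm_nonneg _, fun a => ?_⟩
  have := h.norm_coe_le_norm a
  rw [Real.norm_eq_abs] at this
  exact abs_le.1 this

/-- The fundamental groupoid of the fibre injects into that of the total space. -/
theorem Path.homotopic_of_map_fiber (hp : ∀ s, ∃ e : Bundle.Trivialization F p, s ∈ e.baseSet)
    {x y : {x : X // p x = 1}} (γ δ : Path x y)
    (h : (γ.map continuous_subtype_val).Homotopic (δ.map continuous_subtype_val)) :
    γ.Homotopic δ := by
  obtain ⟨H⟩ := h
  obtain ⟨k, hk⟩ := Circle.exists_lift (p.comp H.toContinuousMap)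
  obtain ⟨m, hm⟩ : ∃ m, k (0, 0) = m := ⟨_, rfl⟩
  have hm1 : Circle.exp m = 1 := by
    rw [← hm, hk]
    change p (H (0, 0)) = 1
    rw [H.source, x.2]
  -- All four sides of the square lie in the fiber over `1`, so the lifted angle is the constant `m`
  -- along the whole boundary.
  have e0 : ∀ s, k (0, s) = m := fun s => by
    rw [← hm]
    refine Circle.eq_of_exp_eq_const (h := fun s : I => k (0, s)) (c := 1) (by fun_prop)
      (fun s => ?_) s 0
    rw [hk]
    change p (H (0, s)) = 1
    rw [H.apply_zero]
    exact (γ s).2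
  have ex : ∀ s, k (s, 0) = m := fun s => by
    rw [← hm]
    refine Circle.eq_of_exp_eq_const (h := fun s : I => k (s, 0)) (c := 1) (by fun_prop)
      (fun s => ?_) s 0
    rw [hk]
    change p (H (s, 0)) = 1
    rw [H.source, x.2]
  have ey : ∀ s, k (s, 1) = m := fun s => by
    rw [← e0 1]
    refine Circle.eq_of_exp_eq_const (h := fun s : I => k (s, 1)) (c := 1) (by fun_prop)
      (fun s => ?_) s 0
    rw [hk]
    change p (H (s, 1)) = 1
    rw [H.target, y.2]
  have e1 : ∀ s, k (1, s) = m := fun s => by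
    rw [← ex 1]
    refine Circle.eq_of_exp_eq_const (h := fun s : I => k (1, s)) (c := 1) (by fun_prop)
      (fun s => ?_) s 0
    rw [hk]
    change p (H (1, s)) = 1
    rw [H.apply_one]
    exact (δ s).2
  have hkm : ∀ r, p (H r) = Circle.exp (k r - m) := fun r => by
    rw [Circle.exp_sub, hm1, div_one, hk]; rfl
  let k' : C(I × I, ℝ) := ⟨fun r => k r - m, by fun_prop⟩
  obtain ⟨M, hM, hMk⟩ := exists_bound_of_compact k'
  obtain ⟨T, hT, hT'⟩ := exists_transport hp (-M) M
  have h0 : (0 : ℝ) ∈ Set.Icc (-M) M := ⟨by linarith, hM⟩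
  -- Each point of the homotopy has height `k r - m`; transporting it to height `0` yields a
  -- homotopy inside the fiber, unchanged on the boundary of the square.
  let q : I × I → CirclePullback p := fun r => ⟨(H r, k r - m), hkm r⟩
  have hTq : ∀ r, p (T (q r, 0)) = 1 := fun r => by
    rw [(hT' (q r, 0) (hMk r) h0).1, Circle.exp_zero]
  have hTq' : ∀ r, k r = m → T (q r, 0) = H r := fun r hr =>
    (hT' (q r, 0) (hMk r) h0).2 (by simp [q, hr])
  refine ⟨{
    toFun := fun r => ⟨T (q r, 0), hTq r⟩
    continuous_toFun := ?_
    map_zero_left := fun s => Subtype.ext ?_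
    map_one_left := fun s => Subtype.ext ?_
    prop' := ?_ }⟩
  · refine Continuous.subtype_mk ?_ _
    refine hT.comp_continuous (f := fun r => (q r, (0 : ℝ))) ?_ fun r => ⟨hMk r, h0⟩
    refine Continuous.prodMk (Continuous.subtype_mk ?_ _) continuous_const
    fun_prop
  · change T (q (0, s), 0) = _
    rw [hTq' _ (e0 s), H.apply_zero]
    rfl
  · change T (q (1, s), 0) = _
    rw [hTq' _ (e1 s), H.apply_one]
    rfl
  · rintro t s (rfl | rfl)
    · refine Subtype.ext ?_
      change T (q (t, 0), 0) = γ 0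
      rw [hTq' _ (ex t), H.source, γ.source]
    · refine Subtype.ext ?_
      change T (q (t, 1), 0) = γ 1
      rw [hTq' _ (ey t), H.target, γ.target]

/-- A loop along which the angle does not change is homotopic to a loop in the fibre. -/
theorem Path.exists_homotopic_map_fiber (hp : ∀ s, ∃ e : Bundle.Trivialization F p, s ∈ e.baseSet)
    {x y : {x : X // p x = 1}} (γ : Path (x : X) y) (h : γ.angle p = 0) :
    ∃ δ : Path x y, γ.Homotopic (δ.map continuous_subtype_val) := by
  obtain ⟨k, hk⟩ := γ.exists_circle_lift p
  rw [γ.angle_eq p k.continuous hk] at h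
  have hk01 : Circle.exp (k 0) = 1 := by rw [hk, γ.source, x.2]
  let k' : C(I, ℝ) := ⟨fun t => k t - k 0, by fun_prop⟩
  have hk' : ∀ t, p (γ t) = Circle.exp (k' t) := fun t => by
    change _ = Circle.exp (k t - k 0)
    rw [Circle.exp_sub, hk01, div_one, hk]
  have k0 : k' 0 = 0 := sub_self _
  have k1 : k' 1 = 0 := h
  obtain ⟨M, hM, hMk⟩ := exists_bound_of_compact k'
  obtain ⟨T, hT, hT'⟩ := exists_transport hp (-M) M
  have h0 : (0 : ℝ) ∈ Set.Icc (-M) M := ⟨by linarith, hM⟩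
  let q : I → CirclePullback p := fun t => ⟨(γ t, k' t), hk' t⟩
  have hq : Continuous q := Continuous.subtype_mk (by fun_prop) _
  have hmem : ∀ s t : I, (1 - (s : ℝ)) * k' t ∈ Set.Icc (-M) M := fun s t => by
    obtain ⟨h1, h2⟩ := hMk t
    obtain ⟨h3, h4⟩ := s.2
    constructor <;> nlinarith
  -- The point of height `k' t` slides down to height `(1 - s) * k' t`. Both endpoints of the path
  -- have height `0`, the final one because the angle vanishes, so they stay fixed.
  let G : I × I → X := fun r => T (q r.2, (1 - (r.1 : ℝ)) * k' r.2)
  have hG : Continuous G := hT.comp_continuous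
    (f := fun r : I × I => (q r.2, (1 - (r.1 : ℝ)) * k' r.2)) (by fun_prop)
    fun r => ⟨hMk r.2, hmem r.1 r.2⟩
  have hG0 : ∀ t, G (0, t) = γ t := fun t =>
    (hT' (q t, _) (hMk t) (hmem 0 t)).2 (by simp [q])
  have hG1 : ∀ t, p (G (1, t)) = 1 := fun t => by
    rw [(hT' (q t, _) (hMk t) (hmem 1 t)).1]; simp
  have hGx : ∀ s, G (s, 0) = x := fun s => by
    refine ((hT' (q 0, _) (hMk 0) (hmem s 0)).2 (by simp [q, k0])).trans ?_; simp [q]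
  have hGy : ∀ s, G (s, 1) = y := fun s => by
    refine ((hT' (q 1, _) (hMk 1) (hmem s 1)).2 (by simp [q, k1])).trans ?_; simp [q]
  refine ⟨{
    toFun := fun t => ⟨G (1, t), hG1 t⟩
    continuous_toFun := Continuous.subtype_mk (by fun_prop) _
    source' := Subtype.ext (hGx 1)
    target' := Subtype.ext (hGy 1) }, ⟨{
    toFun := G
    continuous_toFun := hG
    map_zero_left := hG0
    map_one_left := fun t => rfl
    prop' := ?_ }⟩⟩
  rintro s t (rfl | rfl)
  · change G (s, 0) = γ 0
    rw [hGx, γ.source]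
  · change G (s, 1) = γ 1
    rw [hGy, γ.target]

end CircleBundle

end

noncomputable section


namespace Knot

variable {n : ℕ} {K : Knot n} {N : Set (Sph (n + 2))}

/-! ### Tubular neighbourhoods -/

instance (K : Knot n) : CompactSpace K.source :=
  K.homeo.some.symm.compactSpace

theorem Sph.simplyConnectedSpace {m : ℕ} (hm : 2 ≤ m) : SimplyConnectedSpace (Sph m) :=
  simplyConnectedSpace_sphere (by simp; lia)

theorem source_simplyConnectedSpace (hn : 2 ≤ n) (K : Knot n) : SimplyConnectedSpace K.source :=
  K.homeo.some.toHomotopyEquiv.simplyConnectedSpace_iff.2 (Sph.simplyConnectedSpace hn)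

instance (m : ℕ) : LocallyPathConnectedSpace (Sph m) :=
  ChartedSpace.locallyPathConnectedSpace (EuclideanSpace ℝ (Fin m)) _

instance (K : Knot n) : LocallyPathConnectedSpace K.source :=
  ChartedSpace.locallyPathConnectedSpace (EuclideanSpace ℝ (Fin n)) _

/-- `τ` exhibits `N` as a closed tubular neighbourhood of `K`. -/
structure IsTube (K : Knot n) (N : Set (Sph (n + 2))) (τ : K.source × ℂ → Sph (n + 2)) : Prop where
  isLocalDiffeomorph : IsLocalDiffeomorph ((𝓡 n).prod 𝓘(ℝ, ℂ)) (𝓡 (n + 2)) ∞ τ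
  injective : Function.Injective τ
  apply_zero : ∀ p, τ (p, 0) = K.embed p
  eq_image : N = τ '' (Set.univ ×ˢ Metric.closedBall 0 1)

namespace IsTube

variable {τ : K.source × ℂ → Sph (n + 2)} (hτ : K.IsTube N τ)

include hτ

theorem isOpenEmbedding : Topology.IsOpenEmbedding τ :=
  hτ.isLocalDiffeomorph.isLocalHomeomorph.isOpenEmbedding_of_injective hτ.injective

theorem continuous : Continuous τ := hτ.isOpenEmbedding.continuous

theorem mem_carrier_iff {p : K.source} {c : ℂ} : τ (p, c) ∈ K.carrier ↔ c = 0 := by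
  constructor
  · rintro ⟨q, hq⟩
    rw [← hτ.apply_zero] at hq
    exact (congrArg Prod.snd (hτ.injective hq)).symm
  · rintro rfl
    exact ⟨p, (hτ.apply_zero p).symm⟩

theorem mem_iff {p : K.source} {c : ℂ} : τ (p, c) ∈ N ↔ ‖c‖ ≤ 1 := by
  rw [hτ.eq_image, hτ.injective.mem_set_image]
  simp

theorem isCompact : IsCompact N := by
  rw [hτ.eq_image]
  exact (isCompact_univ.prod (isCompact_closedBall 0 1)).image hτ.continuous

theorem isClosed : IsClosed N := hτ.isCompact.isClosed

theorem preimage_eq : τ ⁻¹' N = Set.univ ×ˢ Metric.closedBall (0 : ℂ) 1 := by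
  rw [hτ.eq_image, hτ.injective.preimage_image]

theorem mem_interior_iff {p : K.source} {c : ℂ} : τ (p, c) ∈ interior N ↔ ‖c‖ < 1 := by
  rw [← Set.mem_preimage, hτ.isOpenEmbedding.isOpenMap.preimage_interior_eq_interior_preimage
    hτ.continuous, hτ.preimage_eq, interior_prod_eq, interior_closedBall _ one_ne_zero]
  simp

theorem mem_frontier_iff {p : K.source} {c : ℂ} : τ (p, c) ∈ frontier N ↔ ‖c‖ = 1 := by
  rw [frontier, hτ.isClosed.closure_eq, Set.mem_sdiff, hτ.mem_iff, hτ.mem_interior_iff, not_lt]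
  exact ⟨fun h => le_antisymm h.1 h.2, fun h => ⟨h.le, h.ge⟩⟩

theorem exists_of_mem {x : Sph (n + 2)} (hx : x ∈ N) : ∃ p c, ‖c‖ ≤ 1 ∧ τ (p, c) = x := by
  rw [hτ.eq_image] at hx
  obtain ⟨⟨p, c⟩, hc, rfl⟩ := hx
  exact ⟨p, c, by simpa using hc, rfl⟩

theorem carrier_subset : K.carrier ⊆ interior N := by
  rintro _ ⟨p, rfl⟩
  rw [← hτ.apply_zero, hτ.mem_interior_iff]
  simp

theorem isClosed_carrier : IsClosed K.carrier := by
  have : K.carrier = (fun p => τ (p, 0)) '' Set.univ := by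
    rw [Set.image_univ]
    exact congrArg Set.range (funext fun p => (hτ.apply_zero p).symm)
  rw [this]
  exact (isCompact_univ.image (hτ.continuous.comp (by fun_prop))).isClosed

end IsTube

/-- The inclusion of the exterior into the complement. -/
def exteriorIncl (h : K.carrier ⊆ interior N) : C(Exterior N, K.Complement) where
  toFun x := ⟨x, fun hx => x.2 (h hx)⟩
  continuous_toFun := by fun_prop

/-- The radial factor of the retraction onto the exterior. -/
def radialFactor (s r : ℝ) : ℝ := 1 - s + s * max 1 r⁻¹

theorem radialFactor_zero (r : ℝ) : radialFactor 0 r = 1 := by simp [radialFactor]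

theorem radialFactor_of_one_le (s : ℝ) {r : ℝ} (hr : 1 ≤ r) : radialFactor s r = 1 := by
  rw [radialFactor, max_eq_left (inv_le_one_of_one_le₀ hr)]
  ring

theorem radialFactor_pos {s : ℝ} (hs : s ∈ Set.Icc (0 : ℝ) 1) (r : ℝ) : 0 < radialFactor s r := by
  unfold radialFactor
  have h1 : 1 ≤ max 1 r⁻¹ := le_max_left _ _
  nlinarith [hs.1, hs.2]

/-- At time one the norm `r` becomes `max r 1`: every point off the knot is pushed out of the open
disk. -/
theorem one_le_radialFactor_one_mul {r : ℝ} (hr : 0 < r) : 1 ≤ radialFactor 1 r * r := by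
  have h1 : r⁻¹ ≤ max 1 r⁻¹ := le_max_right _ _
  calc (1 : ℝ) = r⁻¹ * r := (inv_mul_cancel₀ hr.ne').symm
    _ ≤ max 1 r⁻¹ * r := by gcongr
    _ = radialFactor 1 r * r := by simp [radialFactor]

/-- The radial deformation of the complement of `K` into the exterior. -/
def radialPush (τ : K.source × ℂ → Sph (n + 2)) (s : ℝ) (x : Sph (n + 2)) : Sph (n + 2) :=
  open Classical in
  if h : ∃ q, τ q = x then τ (h.choose.1, radialFactor s ‖h.choose.2‖ • h.choose.2) else x

namespace IsTube

variable {τ : K.source × ℂ → Sph (n + 2)} (hτ : K.IsTube N τ)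

include hτ

theorem radialPush_apply (s : ℝ) (p : K.source) (c : ℂ) :
    radialPush τ s (τ (p, c)) = τ (p, radialFactor s ‖c‖ • c) := by
  have h : ∃ q, τ q = τ (p, c) := ⟨_, rfl⟩
  have h2 : h.choose = (p, c) := hτ.injective h.choose_spec
  rw [radialPush, dif_pos h, h2]

theorem radialPush_of_notMem_interior (s : ℝ) {x : Sph (n + 2)} (hx : x ∉ interior N) :
    radialPush τ s x = x := by
  by_cases h : ∃ q, τ q = x
  · obtain ⟨⟨p, c⟩, rfl⟩ := h
    rw [hτ.mem_interior_iff, not_lt] at hx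
    rw [hτ.radialPush_apply, radialFactor_of_one_le _ hx, one_smul]
  · rw [radialPush, dif_neg h]

theorem radialPush_zero (x : Sph (n + 2)) : radialPush τ 0 x = x := by
  by_cases h : ∃ q, τ q = x
  · obtain ⟨⟨p, c⟩, rfl⟩ := h
    rw [hτ.radialPush_apply, radialFactor_zero, one_smul]
  · rw [radialPush, dif_neg h]

theorem radialPush_notMem_carrier {s : ℝ} (hs : s ∈ Set.Icc (0 : ℝ) 1) {x : Sph (n + 2)}
    (hx : x ∉ K.carrier) : radialPush τ s x ∉ K.carrier := by
  by_cases h : ∃ q, τ q = x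
  · obtain ⟨⟨p, c⟩, rfl⟩ := h
    rw [hτ.radialPush_apply, hτ.mem_carrier_iff, smul_eq_zero]
    rw [hτ.mem_carrier_iff] at hx
    exact not_or.2 ⟨(radialFactor_pos hs _).ne', hx⟩
  · rwa [radialPush, dif_neg h]

theorem radialPush_one_notMem_interior {x : Sph (n + 2)} (hx : x ∉ K.carrier) :
    radialPush τ 1 x ∉ interior N := by
  by_cases h : ∃ q, τ q = x
  · obtain ⟨⟨p, c⟩, rfl⟩ := h
    rw [hτ.mem_carrier_iff] at hx
    rw [hτ.radialPush_apply, hτ.mem_interior_iff, not_lt, norm_smul, Real.norm_eq_abs,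
      abs_of_pos (radialFactor_pos (by simp) _)]
    exact one_le_radialFactor_one_mul (norm_pos_iff.2 hx)
  · rw [radialPush, dif_neg h]
    intro hx'
    obtain ⟨p, c, -, hpc⟩ := hτ.exists_of_mem (interior_subset hx')
    exact h ⟨_, hpc⟩

/-- Near a point of `N` the push is given by a formula in the open tube, continuous as long as the
normal coordinate is nonzero. Near a point outside the closed set `N` it is the identity. -/
theorem continuousAt_radialPush (s : ℝ) {x : Sph (n + 2)} (hx : x ∉ K.carrier) :
    ContinuousAt (fun r : ℝ × Sph (n + 2) => radialPush τ r.1 r.2) (s, x) := by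
  by_cases h : x ∈ N
  · obtain ⟨p, c, -, rfl⟩ := hτ.exists_of_mem h
    rw [hτ.mem_carrier_iff] at hx
    have he : Topology.IsOpenEmbedding (Prod.map (id : ℝ → ℝ) τ) :=
      Topology.IsOpenEmbedding.id.prodMap hτ.isOpenEmbedding
    refine (he.continuousAt_iff (x := (s, (p, c)))).1 ?_
    have : (fun r : ℝ × Sph (n + 2) => radialPush τ r.1 r.2) ∘ Prod.map (id : ℝ → ℝ) τ =
        fun r => τ (r.2.1, radialFactor r.1 ‖r.2.2‖ • r.2.2) := by
      funext r
      exact hτ.radialPush_apply _ _ _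
    rw [this]
    refine hτ.continuous.continuousAt.comp (f := fun r : ℝ × K.source × ℂ =>
      (r.2.1, radialFactor r.1 ‖r.2.2‖ • r.2.2)) ?_
    unfold radialFactor
    have : ‖c‖ ≠ 0 := by simpa using hx
    fun_prop (disch := exact this)
  · have : ∀ᶠ r : ℝ × Sph (n + 2) in 𝓝 (s, x), radialPush τ r.1 r.2 = r.2 := by
      have : ∀ᶠ y in 𝓝 x, y ∉ N := hτ.isClosed.isOpen_compl.mem_nhds h
      filter_upwards [continuous_snd.continuousAt.eventually this] with r hr
      exact hτ.radialPush_of_notMem_interior _ fun h => hr (interior_subset h)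
    exact continuous_snd.continuousAt.congr (this.mono fun r hr => hr.symm)

theorem continuous_radialPush :
    Continuous fun r : ℝ × K.Complement => radialPush τ r.1 r.2 :=
  continuous_iff_continuousAt.2 fun r =>
    (hτ.continuousAt_radialPush r.1 r.2.2).comp
      (f := fun r : ℝ × K.Complement => (r.1, (r.2 : Sph (n + 2)))) (by fun_prop)

/-- The retraction of the complement onto the exterior. -/
def retraction : C(K.Complement, Exterior N) where
  toFun x := ⟨radialPush τ 1 x, hτ.radialPush_one_notMem_interior x.2⟩
  continuous_toFun := Continuous.subtype_mk
    (hτ.continuous_radialPush.comp (by fun_prop : Continuous fun x : K.Complement => ((1 : ℝ), x))) _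

theorem retraction_exteriorIncl (x : Exterior N) :
    hτ.retraction (exteriorIncl hτ.carrier_subset x) = x :=
  Subtype.ext (hτ.radialPush_of_notMem_interior 1 x.2)

/-- Apply the retraction of the complement onto the exterior. With the next lemma, the exterior and
the complement have the same path classes between points of the exterior. -/
theorem homotopic_of_map_exteriorIncl {a b : Exterior N} {γ δ : Path a b}
    (h : (γ.map (exteriorIncl hτ.carrier_subset).continuous).Homotopic
      (δ.map (exteriorIncl hτ.carrier_subset).continuous)) : γ.Homotopic δ := by
  have h2 := (h.map hτ.retraction).pathCast (hτ.retraction_exteriorIncl a).symm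
    (hτ.retraction_exteriorIncl b).symm
  convert h2 using 1
  · exact Path.ext (funext fun s => (hτ.retraction_exteriorIncl (γ s)).symm)
  · exact Path.ext (funext fun s => (hτ.retraction_exteriorIncl (δ s)).symm)

theorem exists_homotopic_map_exteriorIncl {a b : Exterior N}
    (γ : Path (exteriorIncl hτ.carrier_subset a) (exteriorIncl hτ.carrier_subset b)) :
    ∃ δ : Path a b, γ.Homotopic (δ.map (exteriorIncl hτ.carrier_subset).continuous) := by
  -- The radial deformation fixes the exterior pointwise, so it is a homotopy relative to the
  -- endpoints.
  refine ⟨(γ.map hτ.retraction.continuous).cast (hτ.retraction_exteriorIncl a).symm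
    (hτ.retraction_exteriorIncl b).symm, ⟨{
      toFun := fun r => ⟨radialPush τ r.1 (γ r.2), hτ.radialPush_notMem_carrier r.1.2 (γ r.2).2⟩
      continuous_toFun := Continuous.subtype_mk (hτ.continuous_radialPush.comp
        (by fun_prop : Continuous fun r : I × I => ((r.1 : ℝ), γ r.2))) _
      map_zero_left := fun s => Subtype.ext (hτ.radialPush_zero _)
      map_one_left := fun s => rfl
      prop' := ?_ }⟩⟩
  rintro t s (rfl | rfl)
  · refine Subtype.ext ?_
    change radialPush τ t (γ 0) = (γ 0 : Sph (n + 2))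
    rw [γ.source]
    exact hτ.radialPush_of_notMem_interior _ a.2
  · refine Subtype.ext ?_
    change radialPush τ t (γ 1) = (γ 1 : Sph (n + 2))
    rw [γ.target]
    exact hτ.radialPush_of_notMem_interior _ b.2

end IsTube

end Knot

end

noncomputable section


/-! ### Determinants of adapted frames -/

section AdaptedFrame

variable {V : Type*} {n : ℕ}

/-- The family `k, b₁, …, bₙ, x, y`. -/
def adaptedFrame (k : V) (b : Fin n → V) (x y : V) : Fin (n + 2 + 1) → V :=
  Fin.cons k (Fin.append b ![x, y])

/-- This and the two lemmas below present a change in one argument of a frame as a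
`Function.update`, so that multilinearity of an alternating form applies. -/
theorem adaptedFrame_update_mid (k : V) (b : Fin n → V) (x y : V) (i : Fin n) (w : V) :
    adaptedFrame k (Function.update b i w) x y =
      Function.update (adaptedFrame k b x y) (Fin.castAdd 2 i).succ w := by
  unfold adaptedFrame
  rw [← Fin.cons_update]
  congr 1
  funext j
  refine Fin.addCases (fun j => ?_) (fun j => ?_) j
  · rw [Fin.append_left]
    by_cases h : j = i
    · subst h; simp
    · rw [Function.update_of_ne h, Function.update_of_ne, Fin.append_left]
      exact fun h' => h (Fin.castAdd_injective _ _ h')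
  · rw [Fin.append_right, Function.update_of_ne, Fin.append_right]
    intro h'
    have := congrArg Fin.val h'
    simp at this
    lia

theorem adaptedFrame_eq_update_left (k : V) (b : Fin n → V) (x x' y : V) :
    adaptedFrame k b x y =
      Function.update (adaptedFrame k b x' y) (Fin.natAdd n 0).succ x := by
  unfold adaptedFrame
  rw [← Fin.cons_update]
  congr 1
  funext j
  refine Fin.addCases (fun j => ?_) (fun j => ?_) j
  · rw [Fin.append_left, Function.update_of_ne, Fin.append_left]
    intro h'
    have := congrArg Fin.val h'
    simp at this
    lia
  · rw [Fin.append_right]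
    by_cases h : j = 0
    · subst h; simp
    · rw [Function.update_of_ne, Fin.append_right]
      · fin_cases j
        · exact absurd rfl h
        · rfl
      · exact fun h' => h (Fin.natAdd_injective _ _ h')

theorem adaptedFrame_eq_update_right (k : V) (b : Fin n → V) (x y y' : V) :
    adaptedFrame k b x y =
      Function.update (adaptedFrame k b x y') (Fin.natAdd n 1).succ y := by
  unfold adaptedFrame
  rw [← Fin.cons_update]
  congr 1
  funext j
  refine Fin.addCases (fun j => ?_) (fun j => ?_) j
  · rw [Fin.append_left, Function.update_of_ne, Fin.append_left]
    intro h'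
    have := congrArg Fin.val h'
    simp at this
    lia
  · rw [Fin.append_right]
    by_cases h : j = 1
    · subst h; simp
    · rw [Function.update_of_ne, Fin.append_right]
      · fin_cases j
        · rfl
        · exact absurd rfl h
      · exact fun h' => h (Fin.natAdd_injective _ _ h')

theorem adaptedFrame_mid (k : V) (b : Fin n → V) (x y : V) (i : Fin n) :
    adaptedFrame k b x y (Fin.castAdd 2 i).succ = b i := by
  rw [adaptedFrame, Fin.cons_succ, Fin.append_left]

theorem adaptedFrame_left (k : V) (b : Fin n → V) (x y : V) :
    adaptedFrame k b x y (Fin.natAdd n 0).succ = x := by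
  rw [adaptedFrame, Fin.cons_succ, Fin.append_right]; rfl

theorem adaptedFrame_right (k : V) (b : Fin n → V) (x y : V) :
    adaptedFrame k b x y (Fin.natAdd n 1).succ = y := by
  rw [adaptedFrame, Fin.cons_succ, Fin.append_right]; rfl

variable [AddCommGroup V] [Module ℝ V] (f : V [⋀^Fin (n + 2 + 1)]→ₗ[ℝ] ℝ)

/-- The value of an alternating form on an adapted frame as a function of the last two vectors. -/
def adaptedForm (k : V) (b : Fin n → V) : V →ₗ[ℝ] V →ₗ[ℝ] ℝ :=
  LinearMap.mk₂ ℝ (fun x y => f (adaptedFrame k b x y))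
    (fun x x' y => by
      rw [adaptedFrame_eq_update_left k b (x + x') 0 y, adaptedFrame_eq_update_left k b x 0 y,
        adaptedFrame_eq_update_left k b x' 0 y, f.map_update_add])
    (fun c x y => by
      rw [adaptedFrame_eq_update_left k b (c • x) 0 y, adaptedFrame_eq_update_left k b x 0 y,
        f.map_update_smul])
    (fun x y y' => by
      rw [adaptedFrame_eq_update_right k b x (y + y') 0, adaptedFrame_eq_update_right k b x y 0,
        adaptedFrame_eq_update_right k b x y' 0, f.map_update_add])
    (fun c x y => by
      rw [adaptedFrame_eq_update_right k b x (c • y) 0, adaptedFrame_eq_update_right k b x y 0,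
        f.map_update_smul])

theorem adaptedForm_apply (k : V) (b : Fin n → V) (x y : V) :
    adaptedForm f k b x y = f (adaptedFrame k b x y) := rfl

theorem adaptedForm_self (k : V) (b : Fin n → V) (x : V) : adaptedForm f k b x x = 0 := by
  refine f.map_eq_zero_of_eq _ (i := (Fin.natAdd n 0).succ) (j := (Fin.natAdd n 1).succ) ?_ ?_
  · rw [adaptedFrame_left, adaptedFrame_right]
  · intro h
    exact zero_ne_one (Fin.natAdd_injective _ _ (Fin.succ_injective _ h))

theorem adaptedForm_swap (k : V) (b : Fin n → V) (x y : V) :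
    adaptedForm f k b y x = - adaptedForm f k b x y := by
  have h := adaptedForm_self f k b (x + y)
  simp only [map_add, LinearMap.add_apply, adaptedForm_self] at h
  linarith

theorem adaptedForm_eq_zero_of_mem_span (k : V) (b : Fin n → V) {x : V}
    (hx : x ∈ Submodule.span ℝ (Set.range b)) (y : V) : adaptedForm f k b x y = 0 := by
  have : Submodule.span ℝ (Set.range b) ≤ LinearMap.ker ((adaptedForm f k b).flip y) := by
    rw [Submodule.span_le]
    rintro _ ⟨i, rfl⟩
    refine f.map_eq_zero_of_eq _ (i := (Fin.castAdd 2 i).succ) (j := (Fin.natAdd n 0).succ) ?_ ?_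
    · rw [adaptedFrame_mid, adaptedFrame_left]
    · intro h
      have := congrArg Fin.val (Fin.succ_injective _ h)
      simp at this
      lia
  exact this hx

/-- Vectors in the span of the middle ones contribute nothing. For a meridional disk this discards
the part of its derivative tangent to the knot. -/
theorem adaptedForm_add_of_mem_span (k : V) (b : Fin n → V) {x x' : V}
    (hx : x ∈ Submodule.span ℝ (Set.range b)) (hx' : x' ∈ Submodule.span ℝ (Set.range b)) (y y' : V) :
    adaptedForm f k b (x + y) (x' + y') = adaptedForm f k b y y' := by
  simp only [map_add, LinearMap.add_apply, adaptedForm_eq_zero_of_mem_span f k b hx]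
  rw [adaptedForm_swap f k b x' y, adaptedForm_eq_zero_of_mem_span f k b hx']
  simp

/-- The oriented area of the parallelogram spanned by two complex numbers. -/
def Complex.wedge (c d : ℂ) : ℝ := c.re * d.im - c.im * d.re

/-- An alternating bilinear form on a plane is determined by its value on a basis; `Complex.wedge`
is the determinant of the two vectors. -/
theorem adaptedForm_comp_complex (k : V) (b : Fin n → V) (L : ℂ →ₗ[ℝ] V) (c d : ℂ) :
    adaptedForm f k b (L c) (L d) =
      Complex.wedge c d * adaptedForm f k b (L 1) (L Complex.I) := by
  have hc : ∀ c : ℂ, L c = c.re • L 1 + c.im • L Complex.I := fun c => by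
    rw [← map_smul, ← map_smul, ← map_add]
    congr 1
    simp
  rw [hc c, hc d]
  simp only [map_add, map_smul, LinearMap.add_apply, LinearMap.smul_apply, adaptedForm_self,
    adaptedForm_swap f k b (L 1) (L Complex.I), smul_eq_mul, Complex.wedge]
  ring

/-- The value of an alternating form on an adapted frame as a function of the middle vectors. -/
def adaptedMidForm {W : Type*} [AddCommGroup W] [Module ℝ W] (L : W →ₗ[ℝ] V) (k x y : V) :
    W [⋀^Fin n]→ₗ[ℝ] ℝ where
  toFun b := f (adaptedFrame k (fun i => L (b i)) x y)
  map_update_add' {inst} b i w w' := by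
    obtain rfl : inst = instDecidableEqFin n := Subsingleton.elim _ _
    have : ∀ w, (fun j => L (Function.update b i w j)) = Function.update (fun j => L (b j)) i (L w) :=
      fun w => by
        funext j
        by_cases h : j = i
        · subst h; simp
        · simp [Function.update_of_ne h]
    rw [this, this, this, adaptedFrame_update_mid, adaptedFrame_update_mid, adaptedFrame_update_mid,
      map_add, f.map_update_add]
  map_update_smul' {inst} b i c w := by
    obtain rfl : inst = instDecidableEqFin n := Subsingleton.elim _ _
    have : ∀ w, (fun j => L (Function.update b i w j)) = Function.update (fun j => L (b j)) i (L w) :=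
      fun w => by
        funext j
        by_cases h : j = i
        · subst h; simp
        · simp [Function.update_of_ne h]
    rw [this, this, adaptedFrame_update_mid, adaptedFrame_update_mid, map_smul, f.map_update_smul]
  map_eq_zero_of_eq' b i j h hij := by
    refine f.map_eq_zero_of_eq _ (i := (Fin.castAdd 2 i).succ) (j := (Fin.castAdd 2 j).succ) ?_ ?_
    · rw [adaptedFrame_mid, adaptedFrame_mid, h]
    · exact fun h' => hij (Fin.castAdd_injective _ _ (Fin.succ_injective _ h'))

theorem adaptedMidForm_apply {W : Type*} [AddCommGroup W] [Module ℝ W] (L : W →ₗ[ℝ] V) (k x y : V)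
    (b : Fin n → W) : adaptedMidForm f L k x y b = f (adaptedFrame k (fun i => L (b i)) x y) := rfl

/-- Frames adapted to bases of the same orientation have determinants of the same sign. -/
theorem exists_pos_adaptedFrame_eq_mul {W : Type*} [AddCommGroup W] [Module ℝ W] (L : W →ₗ[ℝ] V)
    (k x y : V) (b b' : Module.Basis (Fin n) ℝ W) (h : b.orientation = b'.orientation) :
    ∃ c : ℝ, 0 < c ∧ f (adaptedFrame k (fun i => L (b' i)) x y) =
      c * f (adaptedFrame k (fun i => L (b i)) x y) := by
  refine ⟨b.det b', (Module.Basis.orientation_eq_iff_det_pos b b').1 h, ?_⟩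
  rw [← adaptedMidForm_apply, ← adaptedMidForm_apply,
    (adaptedMidForm f L k x y).eq_smul_basis_det b]
  simp only [AlternatingMap.smul_apply, smul_eq_mul, b.det_self]
  ring

end AdaptedFrame

/-- The determinant of a family of vectors of Euclidean space. -/
def euclideanDet (m : ℕ) : EuclideanSpace ℝ (Fin m) [⋀^Fin m]→ₗ[ℝ] ℝ :=
  (Matrix.detRowAlternating (R := ℝ) (n := Fin m)).compLinearMap
    (WithLp.linearEquiv 2 ℝ (Fin m → ℝ)).toLinearMap

theorem euclideanDet_apply {m : ℕ} (v : Fin m → EuclideanSpace ℝ (Fin m)) :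
    euclideanDet m v = Matrix.det (Matrix.of fun i j => v i j) := rfl

theorem continuous_euclideanDet {m : ℕ} : Continuous (euclideanDet m) := by
  have : ⇑(euclideanDet m) = fun v => Matrix.det (Matrix.of fun i j => v i j) := rfl
  rw [this]
  refine Continuous.matrix_det ?_
  refine continuous_matrix fun i j => ?_
  simp only [Matrix.of_apply]
  fun_prop

theorem euclideanDet_ne_zero {m : ℕ} {v : Fin m → EuclideanSpace ℝ (Fin m)}
    (hv : ∀ a : Fin m → ℝ, ∑ i, a i • v i = 0 → a = 0) : euclideanDet m v ≠ 0 := by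
  intro h
  rw [euclideanDet_apply] at h
  obtain ⟨a, ha, ha'⟩ := Matrix.exists_vecMul_eq_zero_iff.2 h
  refine ha (hv a ?_)
  ext j
  have := congrFun ha' j
  simp only [Matrix.vecMul, dotProduct, Matrix.of_apply, Pi.zero_apply] at this
  simpa using this

/-- An adapted frame consisting of a unit vector and of the image under an injective linear map,
with values orthogonal to that vector, of a basis is independent. -/
theorem euclideanDet_adaptedFrame_ne_zero {n : ℕ} {W : Type*} [AddCommGroup W] [Module ℝ W]
    {k : EuclideanSpace ℝ (Fin (n + 2 + 1))} (hk : k ≠ 0)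
    (L : W × ℂ →ₗ[ℝ] EuclideanSpace ℝ (Fin (n + 2 + 1))) (hL : Function.Injective L)
    (hkL : ∀ w, inner ℝ k (L w) = 0) (b : Module.Basis (Fin n) ℝ W) :
    euclideanDet _ (adaptedFrame k (fun i => L (b i, 0)) (L (0, 1)) (L (0, Complex.I))) ≠ 0 := by
  refine euclideanDet_ne_zero fun a ha => ?_
  rw [Fin.sum_univ_succ, Fin.sum_univ_add, Fin.sum_univ_two] at ha
  simp only [adaptedFrame_mid, adaptedFrame_left, adaptedFrame_right] at ha
  have h0 : adaptedFrame k (fun i => L (b i, 0)) (L (0, 1)) (L (0, Complex.I)) 0 = k := rfl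
  rw [h0] at ha
  set a0 := a 0
  set a1 := a (Fin.natAdd n 0).succ
  set a2 := a (Fin.natAdd n 1).succ
  have hL' : ∑ i : Fin n, a (Fin.castAdd 2 i).succ • L (b i, 0) + (a1 • L (0, 1) + a2 • L (0, Complex.I)) =
      L (∑ i : Fin n, a (Fin.castAdd 2 i).succ • b i, (a1 : ℂ) + a2 * Complex.I) := by
    have : ((∑ i : Fin n, a (Fin.castAdd 2 i).succ • b i, (a1 : ℂ) + a2 * Complex.I) : W × ℂ) =
        ∑ i : Fin n, a (Fin.castAdd 2 i).succ • ((b i, 0) : W × ℂ) +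
          (a1 • ((0, 1) : W × ℂ) + a2 • ((0, Complex.I) : W × ℂ)) := by
      refine Prod.ext ?_ ?_
      · simp [Prod.fst_sum]
      · simp [Prod.snd_sum]
    rw [this]
    simp only [map_add, map_sum, map_smul]
  rw [hL'] at ha
  have ha0 : a0 = 0 := by
    have := congrArg (inner ℝ k) ha
    rw [inner_add_right, hkL, inner_smul_right, real_inner_self_eq_norm_sq, inner_zero_right,
      add_zero] at this
    simpa [hk] using this
  rw [ha0, zero_smul, zero_add] at ha
  have hz := hL (ha.trans (map_zero L).symm)
  have hz1 := congrArg Prod.fst hz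
  have hz2 := congrArg Prod.snd hz
  simp only [Prod.fst_zero, Prod.snd_zero] at hz1 hz2
  have hb := Fintype.linearIndependent_iff.1 b.linearIndependent _ hz1
  have h1 := congrArg Complex.re hz2
  have h2 := congrArg Complex.im hz2
  simp at h1 h2
  funext i
  refine Fin.cases ha0 (fun i => ?_) i
  refine Fin.addCases (fun i => hb i) (fun i => ?_) i
  fin_cases i
  · exact h1
  · exact h2

end

/-! ### First order expansions and the derivative of the tube along the knot -/

noncomputable section

open Asymptotics Filter

/-- A continuous solution of `T (y a) = g` has a first order expansion if the derivative of `T` is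
injective. -/
theorem HasFDerivAt.exists_isLittleO_of_injective {α E F G : Type*} [NormedAddCommGroup E]
    [NormedSpace ℝ E] [NormedAddCommGroup F] [NormedSpace ℝ F] [FiniteDimensional ℝ F]
    [NormedAddCommGroup G] [NormedSpace ℝ G] [FiniteDimensional ℝ G]
    {l : Filter α} {T : F → G} {L : F →L[ℝ] G} {y₀ : F} (hT : HasFDerivAt T L y₀)
    (hL : Function.Injective L) {y : α → F} (hy : Tendsto y l (𝓝 y₀)) {Z : α → E} {g : E →L[ℝ] G}
    (hg : (fun a => T (y a) - T y₀ - g (Z a)) =o[l] Z) :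
    ∃ B : E →L[ℝ] F, (fun a => y a - y₀ - B (Z a)) =o[l] Z ∧
      (fun a => (L.comp B - g) (Z a)) =o[l] Z := by
  -- The derivative `B` sought is `g` followed by a linear left inverse of `L`.
  obtain ⟨Λ', hΛ'⟩ := (L : F →ₗ[ℝ] G).exists_leftInverse_of_injective (LinearMap.ker_eq_bot.2 hL)
  let Λ : G →L[ℝ] F := LinearMap.toContinuousLinearMap Λ'
  have hΛ : ∀ w, Λ (L w) = w := fun w => LinearMap.congr_fun hΛ' w
  have h1 : (fun a => T (y a) - T y₀ - L (y a - y₀)) =o[l] fun a => y a - y₀ :=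
    (hasFDerivAt_iff_isLittleO.1 hT).comp_tendsto hy
  have hid : ∀ a, y a - y₀ - (Λ.comp g) (Z a) =
      Λ (T (y a) - T y₀ - g (Z a)) - Λ (T (y a) - T y₀ - L (y a - y₀)) := fun a => by
    simp only [map_sub, hΛ, ContinuousLinearMap.comp_apply]
    abel
  have h2 : (fun a => Λ (T (y a) - T y₀ - g (Z a))) =o[l] Z := (Λ.isBigO_comp _ l).trans_isLittleO hg
  have h3 : (fun a => Λ (T (y a) - T y₀ - L (y a - y₀))) =o[l] fun a => y a - y₀ :=
    (Λ.isBigO_comp _ l).trans_isLittleO h1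
  -- A priori the error of `T` is only small relative to `y a - y₀`; being little-o, it is absorbed
  -- on the left, which bounds `y a - y₀` by `Z`.
  have h4 : (fun a => y a - y₀) =O[l] Z := by
    have h5 : (fun a => Λ (T (y a) - T y₀ - g (Z a)) + (Λ.comp g) (Z a)) =O[l] Z :=
      h2.isBigO.add ((Λ.comp g).isBigO_comp _ l)
    have h6 : (fun a => (y a - y₀) + Λ (T (y a) - T y₀ - L (y a - y₀))) =O[l] Z := by
      exact h5.congr_left fun a => (sub_eq_sub_iff_add_eq_add.1 (hid a)).symm
    exact h3.right_isBigO_add'.trans h6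
  have h5 : (fun a => y a - y₀ - (Λ.comp g) (Z a)) =o[l] Z :=
    (h2.sub (h3.trans_isBigO h4)).congr_left fun a => (hid a).symm
  refine ⟨Λ.comp g, h5, ?_⟩
  have h6 : (fun a => L (y a - y₀ - (Λ.comp g) (Z a))) =o[l] Z :=
    (L.isBigO_comp _ l).trans_isLittleO h5
  refine ((hg.sub h6).sub (h1.trans_isBigO h4)).congr_left fun a => ?_
  simp only [map_sub, sub_apply, ContinuousLinearMap.comp_apply]
  abel

theorem ContinuousLinearMap.eq_zero_of_isLittleO {E F : Type*} [NormedAddCommGroup E]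
    [NormedSpace ℝ E] [NormedAddCommGroup F] [NormedSpace ℝ F] {A : E →L[ℝ] F} {x₀ : E}
    (h : (fun x => A (x - x₀)) =o[𝓝 x₀] fun x => x - x₀) : A = 0 := by
  have h1 : HasFDerivAt (fun x => A (x - x₀)) (0 : E →L[ℝ] F) x₀ := by
    rw [hasFDerivAt_iff_isLittleO]
    simpa using h
  have h2 : HasFDerivAt (fun x => A (x - x₀)) A x₀ := by
    have := A.hasFDerivAt.comp x₀ ((hasFDerivAt_id x₀).sub_const x₀)
    exact this
  exact h2.unique h1

open scoped EuclideanSpace in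
theorem Knot.Sph.contMDiff_coe (m : ℕ) : ContMDiff (𝓡 m)
    𝓘(ℝ, EuclideanSpace ℝ (Fin (m + 1))) ∞ ((↑) : Sph m → EuclideanSpace ℝ (Fin (m + 1))) :=
  contMDiff_coe_sphere (E := EuclideanSpace ℝ (Fin (m + 1))) (n := m)

open scoped EuclideanSpace in
-- Tangent vectors are orthogonal to the position vector `x`, which can therefore serve as the
-- outward normal in a frame of the ambient space.
theorem Knot.Sph.exists_hasMFDerivAt_coe {m : ℕ} (x : Sph m) :
    ∃ C : EuclideanSpace ℝ (Fin m) →L[ℝ] EuclideanSpace ℝ (Fin (m + 1)),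
      HasMFDerivAt (𝓡 m) 𝓘(ℝ, EuclideanSpace ℝ (Fin (m + 1)))
        ((↑) : Sph m → EuclideanSpace ℝ (Fin (m + 1))) x C ∧ Function.Injective C ∧
      ∀ w, inner ℝ (x : EuclideanSpace ℝ (Fin (m + 1))) (C w) = 0 := by
  refine ⟨_, ((Knot.Sph.contMDiff_coe m).mdifferentiable (by simp) x).hasMFDerivAt,
    injective_mvfderiv_subtypeVal_sphere (n := m) x, fun w => ?_⟩
  have h5 := range_mvfderiv_subtypeVal (n := m) x
  refine Submodule.mem_orthogonal_singleton_iff_inner_right.1 ?_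
  rw [← h5]
  exact ⟨_, rfl⟩

namespace Knot

variable {n : ℕ} {K : Knot n} {N : Set (Sph (n + 2))}

/-- The derivative of a tubular parametrization along the knot. -/
def tubeDeriv (τ : K.source × ℂ → Sph (n + 2)) (p : K.source) :
    EuclideanSpace ℝ (Fin n) × ℂ →L[ℝ] EuclideanSpace ℝ (Fin (n + 2 + 1)) :=
  mfderiv ((𝓡 n).prod 𝓘(ℝ, ℂ)) 𝓘(ℝ, EuclideanSpace ℝ (Fin (n + 2 + 1)))
    (fun q => (τ q : EuclideanSpace ℝ (Fin (n + 2 + 1)))) (p, 0)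

/-- A tubular parametrization in the chart of `K` at `x₀`. -/
def tubeChart (τ : K.source × ℂ → Sph (n + 2)) (x₀ : K.source)
    (w : EuclideanSpace ℝ (Fin n) × ℂ) : EuclideanSpace ℝ (Fin (n + 2 + 1)) :=
  τ ((extChartAt (𝓡 n) x₀).symm w.1, w.2)

namespace IsTube

variable {τ : K.source × ℂ → Sph (n + 2)} (hτ : K.IsTube N τ)

include hτ

theorem contMDiff : ContMDiff ((𝓡 n).prod 𝓘(ℝ, ℂ)) (𝓡 (n + 2)) ∞ τ :=
  hτ.isLocalDiffeomorph.contMDiff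

theorem contMDiff_coe : ContMDiff ((𝓡 n).prod 𝓘(ℝ, ℂ))
    𝓘(ℝ, EuclideanSpace ℝ (Fin (n + 2 + 1))) ∞
    (fun q => (τ q : EuclideanSpace ℝ (Fin (n + 2 + 1)))) :=
  (Sph.contMDiff_coe _).comp hτ.contMDiff

theorem hasMFDerivAt (p : K.source) : HasMFDerivAt ((𝓡 n).prod 𝓘(ℝ, ℂ))
    𝓘(ℝ, EuclideanSpace ℝ (Fin (n + 2 + 1)))
    (fun q => (τ q : EuclideanSpace ℝ (Fin (n + 2 + 1)))) (p, (0 : ℂ)) (tubeDeriv τ p) :=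
  (hτ.contMDiff_coe.mdifferentiable (by simp) _).hasMFDerivAt

theorem mfderiv_embed (p : K.source) (b : EuclideanSpace ℝ (Fin n)) :
    (mfderiv (𝓡 n) 𝓘(ℝ, EuclideanSpace ℝ (Fin (n + 2 + 1)))
      (fun q => (K.embed q : EuclideanSpace ℝ (Fin (n + 2 + 1)))) p b :
        EuclideanSpace ℝ (Fin (n + 2 + 1))) = tubeDeriv τ p (b, 0) := by
  have h1 : HasMFDerivAt (𝓡 n) ((𝓡 n).prod 𝓘(ℝ, ℂ)) (fun q : K.source => (q, (0 : ℂ))) p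
      ((ContinuousLinearMap.id ℝ (EuclideanSpace ℝ (Fin n))).prod
        (0 : EuclideanSpace ℝ (Fin n) →L[ℝ] ℂ)) :=
    (hasMFDerivAt_id p).prodMk (hasMFDerivAt_const (0 : ℂ) p)
  have h2 := (hτ.hasMFDerivAt p).comp p h1
  have h3 : (fun q : K.source => (K.embed q : EuclideanSpace ℝ (Fin (n + 2 + 1)))) =
      (fun q => (τ q : EuclideanSpace ℝ (Fin (n + 2 + 1)))) ∘ fun q : K.source => (q, (0 : ℂ)) := by
    funext q
    simp [hτ.apply_zero]
  rw [h3, h2.mfderiv]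
  rfl

theorem injective_tubeDeriv (p : K.source) : Function.Injective (tubeDeriv τ p) := by
  obtain ⟨C, h1, h5, -⟩ := Sph.exists_hasMFDerivAt_coe (τ (p, 0))
  have h2 := (hτ.contMDiff.mdifferentiable (by simp) (p, 0)).hasMFDerivAt
  have h4 : tubeDeriv τ p = _ := (h1.comp (p, (0 : ℂ)) h2).mfderiv
  rw [h4]
  intro x y hxy
  have h6 := ((hτ.isLocalDiffeomorph (p, 0)).mfderivToContinuousLinearEquiv (by simp)).injective
  exact h6 (h5 hxy)

theorem inner_tubeDeriv (p : K.source) (w : EuclideanSpace ℝ (Fin n) × ℂ) :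
    inner ℝ (K.embed p : EuclideanSpace ℝ (Fin (n + 2 + 1))) (tubeDeriv τ p w) = 0 := by
  obtain ⟨C, h1, -, h5⟩ := Sph.exists_hasMFDerivAt_coe (τ (p, 0))
  have h2 := (hτ.contMDiff.mdifferentiable (by simp) (p, 0)).hasMFDerivAt
  have h4 : tubeDeriv τ p = _ := (h1.comp (p, (0 : ℂ)) h2).mfderiv
  rw [h4, ← hτ.apply_zero]
  exact h5 _

theorem contDiffOn_tubeChart (x₀ : K.source) :
    ContDiffOn ℝ ∞ (tubeChart τ x₀) ((extChartAt (𝓡 n) x₀).target ×ˢ Set.univ) := by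
  rw [← contMDiffOn_iff_contDiffOn]
  have h1 : ContMDiffOn 𝓘(ℝ, EuclideanSpace ℝ (Fin n) × ℂ) (𝓡 n) ∞
      (fun w : EuclideanSpace ℝ (Fin n) × ℂ => (extChartAt (𝓡 n) x₀).symm w.1)
      ((extChartAt (𝓡 n) x₀).target ×ˢ Set.univ) :=
    (contMDiffOn_extChartAt_symm x₀).comp contDiff_fst.contMDiff.contMDiffOn fun w hw => hw.1
  exact hτ.contMDiff_coe.comp_contMDiffOn (h1.prodMk contDiff_snd.contMDiff.contMDiffOn)

/-- In a chart the tube becomes a map of vector spaces, whose derivative can be followed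
continuously along the knot. The derivative `C` of the chart is kept explicit because it is also the
trivialization of the tangent bundle in which the orientation is locally constant. -/
theorem hasFDerivAt_tubeChart (x₀ : K.source) {y : K.source}
    (hy : y ∈ (extChartAt (𝓡 n) x₀).source) :
    ∃ C : EuclideanSpace ℝ (Fin n) ≃L[ℝ] EuclideanSpace ℝ (Fin n),
      (C : EuclideanSpace ℝ (Fin n) →L[ℝ] EuclideanSpace ℝ (Fin n)) =
        mfderiv (𝓡 n) 𝓘(ℝ, EuclideanSpace ℝ (Fin n)) (extChartAt (𝓡 n) x₀) y ∧
      HasFDerivAt (tubeChart τ x₀)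
        ((tubeDeriv τ y).comp ((C.symm : EuclideanSpace ℝ (Fin n) →L[ℝ] _).prodMap
          (ContinuousLinearMap.id ℝ ℂ))) (extChartAt (𝓡 n) x₀ y, 0) := by
  obtain ⟨C', hC⟩ := isInvertible_mfderiv_extChartAt hy
  let C : EuclideanSpace ℝ (Fin n) ≃L[ℝ] EuclideanSpace ℝ (Fin n) := C'
  refine ⟨C, hC, ?_⟩
  have hy' := (extChartAt (𝓡 n) x₀).map_source hy
  have hinv := (extChartAt (𝓡 n) x₀).left_inv hy
  have h0 : HasMFDerivAt 𝓘(ℝ, EuclideanSpace ℝ (Fin n)) (𝓡 n) (extChartAt (𝓡 n) x₀).symm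
      (extChartAt (𝓡 n) x₀ y)
      (C.symm : EuclideanSpace ℝ (Fin n) →L[ℝ] EuclideanSpace ℝ (Fin n)) := by
    have h1 := ContMDiffOn.contMDiffAt (contMDiffOn_extChartAt_symm (n := ∞) x₀)
      ((isOpen_extChartAt_target x₀).mem_nhds hy')
    have h2 := (h1.mdifferentiableAt (by simp)).hasMFDerivAt
    have h3 := mfderiv_extChartAt_comp_mfderivWithin_extChartAt_symm hy'
    rw [(extChartAt (𝓡 n) x₀).left_inv hy, ← hC] at h3
    rw [ModelWithCorners.Boundaryless.range_eq_univ, mfderivWithin_univ] at h3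
    have h6 : mfderiv 𝓘(ℝ, EuclideanSpace ℝ (Fin n)) (𝓡 n) (extChartAt (𝓡 n) x₀).symm
        (extChartAt (𝓡 n) x₀ y) =
        (C.symm : EuclideanSpace ℝ (Fin n) →L[ℝ] EuclideanSpace ℝ (Fin n)) :=
      ContinuousLinearMap.ext fun v => (C.symm_apply_apply _).symm.trans
        (congrArg C.symm (congrFun (congrArg DFunLike.coe h3) v))
    rw [h6] at h2
    exact h2
  have h1 : HasMFDerivAt 𝓘(ℝ, EuclideanSpace ℝ (Fin n) × ℂ) (𝓡 n)
      (fun w : EuclideanSpace ℝ (Fin n) × ℂ => (extChartAt (𝓡 n) x₀).symm w.1)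
      (extChartAt (𝓡 n) x₀ y, 0) _ :=
    HasMFDerivAt.comp (g := (extChartAt (𝓡 n) x₀).symm) (extChartAt (𝓡 n) x₀ y, (0 : ℂ)) h0
      hasFDerivAt_fst.hasMFDerivAt
  have h2 := h1.prodMk (hasFDerivAt_snd (𝕜 := ℝ) (E := EuclideanSpace ℝ (Fin n)) (F := ℂ)
    (p := (extChartAt (𝓡 n) x₀ y, 0))).hasMFDerivAt
  have h3 := hτ.hasMFDerivAt y
  rw [← hinv] at h3
  have h4 := HasMFDerivAt.comp (f := fun w : EuclideanSpace ℝ (Fin n) × ℂ =>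
    ((extChartAt (𝓡 n) x₀).symm w.1, w.2)) (extChartAt (𝓡 n) x₀ y, (0 : ℂ)) h3 h2
  have h5 := h4.hasFDerivAt
  rw [hinv] at h5
  exact h5

end IsTube

end Knot

end

/-! ### The orientation sign of a tube and of a meridional disk -/

noncomputable section

open Asymptotics Filter

theorem ContinuousAt.adaptedFrame {n : ℕ} {X V : Type*} [TopologicalSpace X] [TopologicalSpace V]
    [AddCommGroup V] [Module ℝ V]
    {k x y : X → V} {b : X → Fin n → V} {a : X} (hk : ContinuousAt k a)
    (hb : ∀ i, ContinuousAt (fun q => b q i) a) (hx : ContinuousAt x a) (hy : ContinuousAt y a) :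
    ContinuousAt (fun q => adaptedFrame (k q) (b q) (x q) (y q)) a := by
  rw [continuousAt_pi]
  intro i
  refine Fin.cases hk (fun i => ?_) i
  refine Fin.addCases (fun i => ?_) (fun i => ?_) i
  · simpa only [adaptedFrame_mid] using hb i
  · fin_cases i
    · exact hx.congr (.of_forall fun q => (adaptedFrame_left ..).symm)
    · exact hy.congr (.of_forall fun q => (adaptedFrame_right ..).symm)

namespace Knot

variable {n : ℕ} {K : Knot n} {N : Set (Sph (n + 2))}

/-- The determinant of a frame of the knot followed by the frame of the tubular fibre. -/
def tubeDet (τ : K.source × ℂ → Sph (n + 2)) (p : K.source)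
    (b : Fin n → EuclideanSpace ℝ (Fin n)) : ℝ :=
  euclideanDet _ (adaptedFrame (K.embed p : EuclideanSpace ℝ (Fin (n + 2 + 1)))
    (fun i => tubeDeriv τ p (b i, 0)) (tubeDeriv τ p (0, 1)) (tubeDeriv τ p (0, Complex.I)))

namespace IsTube

variable {τ : K.source × ℂ → Sph (n + 2)} (hτ : K.IsTube N τ)

include hτ

theorem tubeDet_ne_zero (p : K.source) (b : Module.Basis (Fin n) ℝ (EuclideanSpace ℝ (Fin n))) :
    tubeDet τ p b ≠ 0 := by
  refine euclideanDet_adaptedFrame_ne_zero (W := EuclideanSpace ℝ (Fin n)) (fun h => ?_)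
    (tubeDeriv τ p).toLinearMap (hτ.injective_tubeDeriv p) (hτ.inner_tubeDeriv p) b
  have := (K.embed p).2
  rw [h] at this
  simp at this

/-- The frame `β` is constant in the chart at `x₀`; pulled back to nearby tangent spaces it is
`C.symm ∘ β`, and its determinant varies continuously there. -/
theorem continuousAt_tubeDet (x₀ : K.source) (β : Fin n → EuclideanSpace ℝ (Fin n)) :
    ∃ W : K.source → ℝ, ContinuousAt W x₀ ∧ ∀ y ∈ (extChartAt (𝓡 n) x₀).source,
      ∃ C : EuclideanSpace ℝ (Fin n) ≃L[ℝ] EuclideanSpace ℝ (Fin n),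
        (C : EuclideanSpace ℝ (Fin n) →L[ℝ] EuclideanSpace ℝ (Fin n)) =
          mfderiv (𝓡 n) 𝓘(ℝ, EuclideanSpace ℝ (Fin n)) (extChartAt (𝓡 n) x₀) y ∧
        W y = tubeDet τ y fun i => C.symm (β i) := by
  let DT : K.source → EuclideanSpace ℝ (Fin n) × ℂ →L[ℝ] EuclideanSpace ℝ (Fin (n + 2 + 1)) :=
    fun y => fderiv ℝ (tubeChart τ x₀) (extChartAt (𝓡 n) x₀ y, 0)
  have hDT : ContinuousAt DT x₀ := by
    have ho : IsOpen ((extChartAt (𝓡 n) x₀).target ×ˢ (Set.univ : Set ℂ)) :=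
      (isOpen_extChartAt_target x₀).prod isOpen_univ
    have h1 := (hτ.contDiffOn_tubeChart x₀).continuousOn_fderiv_of_isOpen ho (by simp)
    have h2 : ContinuousAt (fderiv ℝ (tubeChart τ x₀)) (extChartAt (𝓡 n) x₀ x₀, 0) :=
      h1.continuousAt (ho.mem_nhds ⟨mem_extChartAt_target x₀, trivial⟩)
    exact ContinuousAt.comp (f := fun y => (extChartAt (𝓡 n) x₀ y, (0 : ℂ))) h2
      ((continuousAt_extChartAt x₀).prodMk continuousAt_const)
  refine ⟨fun y => euclideanDet _ (adaptedFrame (K.embed y : EuclideanSpace ℝ (Fin (n + 2 + 1)))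
    (fun i => DT y (β i, 0)) (DT y (0, 1)) (DT y (0, Complex.I))), ?_, fun y hy => ?_⟩
  · refine continuous_euclideanDet.continuousAt.comp ?_
    refine ContinuousAt.adaptedFrame ?_ (fun i => ?_) ?_ ?_
    · exact continuous_subtype_val.continuousAt.comp
        K.isSmoothEmbedding.isEmbedding.continuous.continuousAt
    all_goals exact hDT.clm_apply continuousAt_const
  · obtain ⟨C, hC, hd⟩ := hτ.hasFDerivAt_tubeChart x₀ hy
    refine ⟨C, hC, ?_⟩
    have : DT y = _ := hd.fderiv
    simp only [this, tubeDet]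
    simp

/-- A frame of the right orientation, constant in the chart, has a continuous and nonzero
determinant, hence one of constant sign. Another basis of the same orientation changes it by a
positive factor. -/
theorem eventually_sign (hn : n ≠ 0) (x₀ : K.source) : ∃ s : ℝ, (s = 1 ∨ s = -1) ∧
    ∀ᶠ y in 𝓝 x₀, ∀ b : Module.Basis (Fin n) ℝ (EuclideanSpace ℝ (Fin n)),
      b.orientation = K.orientation.orient y → 0 < s * tubeDet τ y b := by
  have : NeZero n := ⟨hn⟩
  obtain ⟨c, hc⟩ := K.orientation.locally_const x₀
  let β := (EuclideanSpace.basisFun (Fin n) ℝ).toBasis.adjustToOrientation c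
  have hβ : β.orientation = c := Module.Basis.orientation_adjustToOrientation _ _
  obtain ⟨W, hW, hW'⟩ := hτ.continuousAt_tubeDet x₀ β
  have h0 : W x₀ ≠ 0 := by
    obtain ⟨C, -, h⟩ := hW' x₀ (mem_extChartAt_source x₀)
    rw [h]
    exact hτ.tubeDet_ne_zero x₀ (β.map C.symm.toLinearEquiv)
  obtain ⟨s, hs, hsW⟩ : ∃ s : ℝ, (s = 1 ∨ s = -1) ∧ 0 < s * W x₀ := by
    rcases lt_or_gt_of_ne h0 with h | h
    · exact ⟨-1, .inr rfl, by linarith⟩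
    · exact ⟨1, .inl rfl, by linarith⟩
  refine ⟨s, hs, ?_⟩
  have h1 : ∀ᶠ y in 𝓝 x₀, 0 < s * W y :=
    (continuousAt_const.mul hW).eventually (lt_mem_nhds hsW)
  filter_upwards [h1, hc, (extChartAt_source_mem_nhds x₀ : (extChartAt (𝓡 n) x₀).source ∈ 𝓝 x₀)] with y hy1 hy2 hy3 b hb
  obtain ⟨C, hC, hWC⟩ := hW' y hy3
  have hy4 : y ∈ (chartAt (EuclideanSpace ℝ (Fin n)) x₀).source := by
    rwa [extChartAt_source] at hy3
  have hy5 : y ∈ (trivializationAt (EuclideanSpace ℝ (Fin n))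
        (TangentSpace (𝓡 n) : K.source → Type _) x₀).baseSet := by
    exact hy4
  -- The local orientation is formulated in the tangent bundle trivialization, the determinant in
  -- terms of the chart; both are the same linear map.
  have hC2 : ((trivializationAt (EuclideanSpace ℝ (Fin n))
        (TangentSpace (𝓡 n) : K.source → Type _) x₀).linearEquivAt ℝ y hy5) = C.toLinearEquiv := by
    have h3 : (trivializationAt (EuclideanSpace ℝ (Fin n)) (TangentSpace (𝓡 n) :
        K.source → Type _) x₀).continuousLinearMapAt ℝ y =
        mfderiv (𝓡 n) 𝓘(ℝ, EuclideanSpace ℝ (Fin n)) (extChartAt (𝓡 n) x₀) y :=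
      TangentBundle.continuousLinearMapAt_trivializationAt hy4
    refine LinearEquiv.ext fun v => ?_
    have h4 := congrArg (fun f => f v) (h3.trans hC.symm)
    refine Eq.trans ?_ h4
    rw [Bundle.Trivialization.continuousLinearMapAt_apply,
      Bundle.Trivialization.coe_linearMapAt_of_mem _ hy5]
    rfl
  have h5 := hy2 hy5
  rw [hC2, ← hb] at h5
  have h6 : (β.map C.symm.toLinearEquiv).orientation = b.orientation := by
    rw [Module.Basis.orientation_map, hβ, ← h5]
    exact (Orientation.map (Fin n) C.toLinearEquiv).symm_apply_apply b.orientation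
  obtain ⟨t, ht, ht'⟩ := exists_pos_adaptedFrame_eq_mul (euclideanDet _)
    (W := EuclideanSpace ℝ (Fin n))
    ((tubeDeriv τ y).toLinearMap ∘ₗ LinearMap.inl ℝ _ ℂ)
    (K.embed y : EuclideanSpace ℝ (Fin (n + 2 + 1))) (tubeDeriv τ y (0, 1))
    (tubeDeriv τ y (0, Complex.I)) _ b h6
  have h7 : tubeDet τ y b = t * W y := by rw [hWC]; exact ht'
  rw [h7]
  nlinarith [mul_pos ht hy1]

/-- The local signs are locally constant and the knot is connected. -/
theorem exists_sign (hn : 2 ≤ n) : ∃ s : ℝ, (s = 1 ∨ s = -1) ∧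
    ∀ y, ∀ b : Module.Basis (Fin n) ℝ (EuclideanSpace ℝ (Fin n)),
      b.orientation = K.orientation.orient y → 0 < s * tubeDet τ y b := by
  have := source_simplyConnectedSpace hn K
  have : NeZero n := ⟨by lia⟩
  have hb (y : K.source) : ∃ b : Module.Basis (Fin n) ℝ (EuclideanSpace ℝ (Fin n)),
      b.orientation = K.orientation.orient y :=
    ⟨(EuclideanSpace.basisFun (Fin n) ℝ).toBasis.adjustToOrientation _,
      Module.Basis.orientation_adjustToOrientation _ _⟩
  choose s hs h using hτ.eventually_sign (by lia : n ≠ 0)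
  have hloc : IsLocallyConstant s := by
    refine (IsLocallyConstant.iff_eventually_eq s).2 fun x => ?_
    filter_upwards [h x] with y hy
    obtain ⟨b, hb⟩ := hb y
    have h1 := hy b hb
    have h2 := (h y).self_of_nhds b hb
    rcases hs x with h3 | h3 <;> rcases hs y with h4 | h4 <;> rw [h3] at h1 <;> rw [h4] at h2 <;>
      linarith
  obtain ⟨x₀⟩ : Nonempty K.source := inferInstance
  refine ⟨s x₀, hs x₀, fun y b hb => ?_⟩
  rw [hloc.apply_eq_of_preconnectedSpace x₀ y]
  exact (h y).self_of_nhds b hb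

/-- A meridional disk, in tubular coordinates `(u, v)`, is transverse to the knot with the sign
determined by the tubular parametrization. -/
theorem exists_expansion {s : ℝ} (hs1 : s = 1 ∨ s = -1)
    (hs : ∀ y, ∀ b : Module.Basis (Fin n) ℝ (EuclideanSpace ℝ (Fin n)),
      b.orientation = K.orientation.orient y → 0 < s * tubeDet τ y b) (hn : n ≠ 0)
    (D : K.MeridionalDisk N) {u : C(Disk, K.source)} {v : C(Disk, ℂ)}
    (hD : ∀ z, D.toMap z = τ (u z, v z)) {z₀ : Disk} (hz₀ : ‖(z₀ : ℂ)‖ < 1) (hv : v z₀ = 0) :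
    ∃ A : ℂ →L[ℝ] ℂ, 0 < s * Complex.wedge (A 1) (A Complex.I) ∧
      (fun z : Disk => v z - A ((z : ℂ) - z₀)) =o[𝓝 z₀] fun z : Disk => (z : ℂ) - z₀ := by
  obtain ⟨g, hg, hgD, -, hpos⟩ := D.smooth
  set p := u z₀ with hp
  have hDp : D.toMap z₀ = K.embed p := by rw [hD, hv, hτ.apply_zero]
  specialize hpos z₀ p hDp
  set g' := fderiv ℝ g z₀ with hg'
  have hgd : HasFDerivAt g g' z₀ := (hg.differentiable (by simp) _).hasFDerivAt
  obtain ⟨C, -, hT⟩ := hτ.hasFDerivAt_tubeChart p (mem_extChartAt_source p)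
  set L := (tubeDeriv τ p).comp ((C.symm : EuclideanSpace ℝ (Fin n) →L[ℝ] _).prodMap
          (ContinuousLinearMap.id ℝ ℂ)) with hL
  have hLinj : Function.Injective L := (hτ.injective_tubeDeriv p).comp
    (Function.Injective.prodMap C.symm.injective Function.injective_id)
  -- The coordinates of the disk are only known to be continuous. Their expansion at `z₀` follows
  -- from the smoothness of `g` and the injectivity of the derivative of the tube.
  have hy : Tendsto (fun z : Disk => (extChartAt (𝓡 n) p (u z), v z)) (𝓝 z₀)
      (𝓝 (extChartAt (𝓡 n) p p, 0)) := by
    have h1 : ContinuousAt (fun z : Disk => (extChartAt (𝓡 n) p (u z), v z)) z₀ :=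
      (ContinuousAt.comp (f := u) (continuousAt_extChartAt p) u.continuous.continuousAt).prodMk
        v.continuous.continuousAt
    simpa only [ContinuousAt, hv] using h1
  have hTy : ∀ᶠ z : Disk in 𝓝 z₀, tubeChart τ p (extChartAt (𝓡 n) p (u z), v z) = g z := by
    filter_upwards [u.continuous.continuousAt.eventually (extChartAt_source_mem_nhds p :
      (extChartAt (𝓡 n) p).source ∈ 𝓝 p)] with z hz
    rw [hgD, hD, tubeChart, (extChartAt (𝓡 n) p).left_inv hz]
  have hT0 : tubeChart τ p (extChartAt (𝓡 n) p p, 0) = g z₀ := by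
    rw [← hTy.self_of_nhds, hv]
  obtain ⟨B, hB, hB'⟩ := hT.exists_isLittleO_of_injective hLinj hy (Z := fun z : Disk => (z : ℂ) - z₀)
    (g := g') (by
      refine ((hasFDerivAt_iff_isLittleO.1 hgd).comp_tendsto
        (continuous_subtype_val.tendsto z₀)).congr' ?_ .rfl
      filter_upwards [hTy] with z hz
      rw [hz, hT0]
      rfl)
  have hLB : L.comp B = g' := by
    refine sub_eq_zero.1 (ContinuousLinearMap.eq_zero_of_isLittleO (x₀ := (z₀ : ℂ)) ?_)
    -- As `z₀` is an interior point, an estimate on the disk is an estimate on a full neighbourhood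
    -- in `ℂ`, so it determines the linear map.
    have hmem : Metric.closedBall (0 : ℂ) 1 ∈ 𝓝 (z₀ : ℂ) :=
      mem_of_superset (Metric.isOpen_ball.mem_nhds (by simpa using hz₀))
        Metric.ball_subset_closedBall
    rw [← map_nhds_subtype_coe_eq_nhds z₀.2 hmem, isLittleO_map]
    exact hB'
  let A : ℂ →L[ℝ] ℂ := (ContinuousLinearMap.snd ℝ _ _).comp B
  refine ⟨A, ?_, ?_⟩
  · have : NeZero n := ⟨hn⟩
    let b : Module.Basis (Fin n) ℝ (EuclideanSpace ℝ (Fin n)) :=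
      (EuclideanSpace.basisFun (Fin n) ℝ).toBasis.adjustToOrientation (K.orientation.orient p)
    have hb : b.orientation = K.orientation.orient p :=
      Module.Basis.orientation_adjustToOrientation _ _
    have h1 : 0 < euclideanDet _ (adaptedFrame (K.embed p : EuclideanSpace ℝ (Fin (n + 2 + 1)))
        (fun i => (mfderiv (𝓡 n) 𝓘(ℝ, EuclideanSpace ℝ (Fin (n + 2 + 1)))
          (fun q => (K.embed q : EuclideanSpace ℝ (Fin (n + 2 + 1)))) p (b i) :
            EuclideanSpace ℝ (Fin (n + 2 + 1)))) (g' 1) (g' Complex.I)) := hpos b hb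
    have h2 : 0 < adaptedForm (euclideanDet _) (K.embed p : EuclideanSpace ℝ (Fin (n + 2 + 1)))
        (fun i => tubeDeriv τ p (b i, 0)) (g' 1) (g' Complex.I) := by
      rw [adaptedForm_apply]
      refine h1.trans_eq (congrArg (fun w => euclideanDet _ (adaptedFrame _ w _ _)) ?_)
      exact funext fun i => hτ.mfderiv_embed p (b i)
    -- The derivative of the disk splits into a part tangent to the knot, irrelevant for the
    -- determinant, and the normal part `A`. The intersection sign is thus the sign of `A` times the
    -- sign of the tube.
    have h3 (c : ℂ) : g' c = tubeDeriv τ p (C.symm (B c).1, 0) + tubeDeriv τ p (0, A c) := by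
      rw [← hLB, ← map_add]
      simp only [hL, A, ContinuousLinearMap.comp_apply, Prod.mk_add_mk, add_zero, zero_add]
      rfl
    have h4 (w : EuclideanSpace ℝ (Fin n)) : tubeDeriv τ p (w, 0) ∈
        Submodule.span ℝ (Set.range fun i => tubeDeriv τ p (b i, 0)) := by
      have h5 : w ∈ Submodule.span ℝ (Set.range b) := by rw [b.span_eq]; trivial
      have h6 := Submodule.mem_map_of_mem (f := (tubeDeriv τ p).toLinearMap ∘ₗ
        LinearMap.inl ℝ (EuclideanSpace ℝ (Fin n)) ℂ) h5
      rw [Submodule.map_span, ← Set.range_comp] at h6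
      exact h6
    rw [h3, h3, adaptedForm_add_of_mem_span _ _ _ (h4 _) (h4 _)] at h2
    have h7 := adaptedForm_comp_complex (euclideanDet _)
      (K.embed p : EuclideanSpace ℝ (Fin (n + 2 + 1))) (fun i => tubeDeriv τ p (b i, 0))
      ((tubeDeriv τ p).toLinearMap ∘ₗ LinearMap.inr ℝ (EuclideanSpace ℝ (Fin n)) ℂ)
      (A 1) (A Complex.I)
    have h8 : 0 < Complex.wedge (A 1) (A Complex.I) * tubeDet τ p b := by
      rw [← sub_zero (_ * _)]
      refine h2.trans_eq (h7.trans ?_)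
      rw [sub_zero]
      rfl
    have h9 := hs p b hb
    rcases hs1 with rfl | rfl
    · rw [one_mul] at h9 ⊢
      exact (pos_iff_pos_of_mul_pos h8).2 h9
    · nlinarith
  · refine ((ContinuousLinearMap.snd ℝ (EuclideanSpace ℝ (Fin n)) ℂ).isBigO_comp _ _).trans_isLittleO
      hB |>.congr_left fun z => ?_
    simp [A]

end IsTube
end Knot
end

/-! ### Straightening the normal coordinate of a meridional disk -/

noncomputable section

open Asymptotics Filter ComplexConjugate

namespace Disk

/-- The normal coordinate of a singular meridional disk of a knot in a tubular neighbourhood. -/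
structure IsSingularCoord (w : C(Disk, ℂ)) : Prop where
  norm_le : ∀ z, ‖w z‖ ≤ 1
  norm_eq_one_iff : ∀ z, ‖w z‖ = 1 ↔ ‖(z : ℂ)‖ = 1
  existsUnique : ∃ z₀ : Disk, ‖(z₀ : ℂ)‖ < 1 ∧ ∀ z, w z = 0 ↔ z = z₀

theorem norm_le_one (z : Disk) : ‖(z : ℂ)‖ ≤ 1 := mem_closedBall_zero_iff.1 z.2

/-- The reason why the Möbius map preserves both the disk and its boundary circle. -/
theorem mobius_identity (a z : ℂ) : ‖1 + conj a * z‖ ^ 2 - ‖z + a‖ ^ 2 =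
    (1 - ‖a‖ ^ 2) * (1 - ‖z‖ ^ 2) := by
  simp only [← Complex.normSq_eq_norm_sq, Complex.normSq_apply]
  simp
  ring

theorem mobius_den_ne_zero {a z : ℂ} (ha : ‖a‖ < 1) (hz : ‖z‖ ≤ 1) : 1 + conj a * z ≠ 0 := by
  intro h
  have h1 : conj a * z = -1 := by linear_combination h
  have h2 := congrArg norm h1
  rw [norm_mul, RCLike.norm_conj, norm_neg, norm_one] at h2
  nlinarith [norm_nonneg a, norm_nonneg z]

theorem norm_mobius_le {a z : ℂ} (ha : ‖a‖ < 1) (hz : ‖z‖ ≤ 1) :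
    ‖(z + a) / (1 + conj a * z)‖ ≤ 1 := by
  have h0 := norm_pos_iff.2 (mobius_den_ne_zero ha hz)
  rw [norm_div, div_le_one h0]
  refine (sq_le_sq₀ (norm_nonneg _) h0.le).1 ?_
  have := mobius_identity a z
  have h1 : 0 ≤ (1 - ‖a‖ ^ 2) * (1 - ‖z‖ ^ 2) :=
    mul_nonneg (by nlinarith [norm_nonneg a]) (by nlinarith [norm_nonneg z])
  linarith

theorem norm_mobius_eq_one_iff {a z : ℂ} (ha : ‖a‖ < 1) (hz : ‖z‖ ≤ 1) :
    ‖(z + a) / (1 + conj a * z)‖ = 1 ↔ ‖z‖ = 1 := by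
  have h0 := norm_pos_iff.2 (mobius_den_ne_zero ha hz)
  rw [norm_div, div_eq_one_iff_eq h0.ne', ← sq_eq_sq₀ (norm_nonneg _) h0.le]
  have h1 := mobius_identity a z
  have h2 : 0 < 1 - ‖a‖ ^ 2 := by nlinarith [norm_nonneg a]
  constructor
  · intro h
    rw [h, sub_self] at h1
    rcases mul_eq_zero.1 h1.symm with h3 | h3
    · exact absurd h3 h2.ne'
    · nlinarith [norm_nonneg z]
  · intro h
    rw [h] at h1
    linarith

/-- The isotopy of the disk by Möbius transformations which moves `0` to `a`. -/
theorem exists_mobius {a : ℂ} (ha : ‖a‖ < 1) : ∃ M : C(I × Disk, Disk), (∀ z, M (0, z) = z) ∧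
    (∀ t z, ‖(M (t, z) : ℂ)‖ = 1 ↔ ‖(z : ℂ)‖ = 1) ∧
    (∀ t, ∃ z₁ : Disk, ‖(z₁ : ℂ)‖ < 1 ∧ ∀ z, (M (t, z) : ℂ) = a ↔ z = z₁) ∧
    (∀ z, (M (1, z) : ℂ) = (z + a) / (1 + conj a * z)) := by
  have hta (t : I) : ‖(t : ℂ) * a‖ < 1 := by
    rw [norm_mul, Complex.norm_real, Real.norm_of_nonneg t.2.1]
    nlinarith [t.2.2, norm_nonneg a, t.2.1]
  let M : C(I × Disk, Disk) :=
    { toFun := fun q => ⟨(q.2 + ((q.1 : ℝ) : ℂ) * a) / (1 + conj (((q.1 : ℝ) : ℂ) * a) * q.2), by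
        simpa only [mem_closedBall_zero_iff] using norm_mobius_le (hta q.1) q.2.norm_le_one⟩
      continuous_toFun := by
        have h1 : Continuous fun q : I × Disk => ((q.1 : ℝ) : ℂ) * a :=
          (Complex.continuous_ofReal.comp (continuous_subtype_val.comp continuous_fst)).mul
            continuous_const
        have h2 : Continuous fun q : I × Disk => (q.2 : ℂ) := continuous_subtype_val.comp continuous_snd
        exact Continuous.subtype_mk ((h2.add h1).div
          (continuous_const.add ((Complex.continuous_conj.comp h1).mul h2)) fun q =>
          mobius_den_ne_zero (hta q.1) q.2.norm_le_one) _ }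
  refine ⟨M, fun z => Subtype.ext (by simp [M]), fun t z => norm_mobius_eq_one_iff (hta t) z.norm_le_one,
    fun t => ?_, fun z => by simp [M]⟩
  have h1 : (0 : ℝ) < 1 - t * ‖a‖ ^ 2 := by
    nlinarith [t.2.2, norm_nonneg a, t.2.1]
  -- The point sent to `a` at time `t` is found by solving `z + t * a = a + t * ‖a‖ ^ 2 * z`.
  have h2 : ‖a * ((1 - t) / (1 - t * ‖a‖ ^ 2) : ℝ)‖ < 1 := by
    rw [norm_mul, Complex.norm_real, Real.norm_of_nonneg (div_nonneg (by linarith [t.2.2]) h1.le),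
      mul_div_assoc', div_lt_one h1]
    nlinarith [t.2.2, norm_nonneg a, t.2.1, mul_nonneg t.2.1 (norm_nonneg a)]
  refine ⟨⟨_, by simpa using h2.le⟩, h2, fun z => ?_⟩
  rw [Subtype.ext_iff]
  change ((z : ℂ) + ((t : ℝ) : ℂ) * a) / (1 + conj (((t : ℝ) : ℂ) * a) * z) = a ↔ (z : ℂ) = a * _
  rw [div_eq_iff (mobius_den_ne_zero (hta t) z.norm_le_one)]
  have h3 : ((1 - t * ‖a‖ ^ 2 : ℝ) : ℂ) ≠ 0 := by exact_mod_cast h1.ne'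
  have h4 : a * conj a = ((‖a‖ ^ 2 : ℝ) : ℂ) := by
    rw [Complex.mul_conj, Complex.normSq_eq_norm_sq]
  rw [Complex.ofReal_div, mul_div_assoc', eq_div_iff h3]
  simp only [map_mul, Complex.conj_ofReal]
  push_cast at h4 ⊢
  constructor <;> intro h
  · linear_combination h + (t : ℂ) * z * h4
  · linear_combination h - (t : ℂ) * z * h4

theorem isSingularCoord_comp {w : C(Disk, ℂ)} (hw : IsSingularCoord w) {z₀ : Disk}
    (h₀ : ∀ z, w z = 0 ↔ z = z₀) (M : C(Disk, Disk))
    (hM : ∀ z, ‖(M z : ℂ)‖ = 1 ↔ ‖(z : ℂ)‖ = 1)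
    (hM' : ∃ z₁ : Disk, ‖(z₁ : ℂ)‖ < 1 ∧ ∀ z, (M z : ℂ) = z₀ ↔ z = z₁) :
    IsSingularCoord (w.comp M) where
  norm_le z := hw.norm_le _
  norm_eq_one_iff z := (hw.norm_eq_one_iff _).trans (hM z)
  existsUnique := by
    obtain ⟨z₁, h1, h2⟩ := hM'
    refine ⟨z₁, h1, fun z => ?_⟩
    rw [← h2, ContinuousMap.comp_apply, h₀, Subtype.ext_iff]

/-- The centre of the disk. -/
def zero : Disk := ⟨0, by simp⟩

/-- The disk without its centre. -/
abbrev Punctured : Type := {z : Disk // z ≠ zero}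

theorem _root_.Circle.exists_normalize {X : Type*} [TopologicalSpace X] (f : C(X, ℂ))
    (hf : ∀ x, f x ≠ 0) : ∃ g : C(X, Circle), ∀ x, (g x : ℂ) = f x / ‖f x‖ :=
  ⟨{  toFun := fun z => ⟨f z / ‖f z‖, by
        rw [Submonoid.unitSphere, Submonoid.mem_mk, Subsemigroup.mem_mk, mem_sphere_zero_iff_norm,
          norm_div, Complex.norm_real, norm_norm, div_self (norm_ne_zero_iff.2 (hf z))]⟩
      continuous_toFun := by
        refine Continuous.subtype_mk (Continuous.div (by fun_prop) (by fun_prop) fun z => ?_) _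
        exact_mod_cast norm_ne_zero_iff.2 (hf z) }, fun x => rfl⟩

/-- A map of the disk with an isolated zero at the centre where it preserves the orientation differs
from the identity, off the centre, by a positive factor and by a rotation whose angle is a continuous
function. -/
theorem exists_angle {w : C(Disk, ℂ)} (hw : ∀ z, w z = 0 ↔ z = zero) {B : ℂ →L[ℝ] ℂ}
    (hB : 0 < Complex.wedge (B 1) (B Complex.I))
    (hwB : (fun z : Disk => w z - B z) =o[𝓝 zero] fun z : Disk => (z : ℂ)) :
    ∃ θ : Disk → ℝ, ContinuousOn θ {z | z ≠ zero} ∧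
      ∀ z, z ≠ zero → w z = ‖w z‖ * (z / ‖(z : ℂ)‖ * Circle.exp (θ z)) := by
  -- The complex linear and antilinear parts of `B`: its determinant is `‖a‖ ^ 2 - ‖b‖ ^ 2`.
  obtain ⟨a, b, hab, hBab⟩ : ∃ a b : ℂ, ‖b‖ < ‖a‖ ∧ ∀ z, B z = a * z + b * conj z := by
    refine ⟨(B 1 - Complex.I * B Complex.I) / 2, (B 1 + Complex.I * B Complex.I) / 2, ?_, fun z => ?_⟩
    · refine (sq_lt_sq₀ (norm_nonneg _) (norm_nonneg _)).1 ?_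
      simp only [← Complex.normSq_eq_norm_sq, Complex.normSq_apply]
      simp [Complex.wedge] at hB ⊢
      nlinarith
    · have : z = z.re • (1 : ℂ) + z.im • Complex.I := by simp
      conv_lhs => rw [this, map_add, map_smul, map_smul]
      apply Complex.ext <;> simp <;> ring
  have ha : a ≠ 0 := norm_pos_iff.1 ((norm_nonneg b).trans_lt hab)
  have hne {z : Disk} (hz : z ≠ zero) : (z : ℂ) ≠ 0 := fun h => hz (Subtype.ext h)
  -- On a small circle `w z / (a * z)` is at distance less than one from `1`: the remainder costs at
  -- most `(‖a‖ - ‖b‖) / 2` and the antilinear part `‖b‖`, relative to `‖a‖`. The principal argument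
  -- is therefore continuous there.
  obtain ⟨δ, hδ, hδ1, hδw⟩ : ∃ δ : ℝ, 0 < δ ∧ δ ≤ 1 ∧ ∀ z : Disk, ‖(z : ℂ)‖ = δ →
      w z / z / a ∈ Complex.slitPlane := by
    have h1 := hwB.def (c := (‖a‖ - ‖b‖) / 2) (by linarith)
    obtain ⟨r, hr, h2⟩ := Metric.eventually_nhds_iff.1 h1
    refine ⟨min (r / 2) 1, by positivity, min_le_right _ _, fun z hz => ?_⟩
    have hz0 : 0 < ‖(z : ℂ)‖ := by rw [hz]; positivity
    have h3 := h2 (y := z) (by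
      rw [Subtype.dist_eq, dist_eq_norm]
      change ‖(z : ℂ) - 0‖ < r
      rw [sub_zero, hz]
      linarith [min_le_left (r / 2) 1])
    have h4 : ‖w z / z / a - 1‖ < 1 := by
      have h5 : w z / z / a - 1 = (w z - B z + b * conj (z : ℂ)) / (z * a) := by
        rw [hBab]
        field_simp [norm_pos_iff.1 hz0]
        ring
      rw [h5, norm_div, norm_mul, div_lt_one (by positivity)]
      calc ‖w z - B z + b * conj (z : ℂ)‖ ≤ (‖a‖ - ‖b‖) / 2 * ‖(z : ℂ)‖ + ‖b‖ * ‖(z : ℂ)‖ := by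
            refine (norm_add_le _ _).trans (add_le_add h3 ?_)
            rw [norm_mul, RCLike.norm_conj]
        _ < ‖(z : ℂ)‖ * ‖a‖ := by nlinarith
    refine .inl ?_
    have h6 := (Complex.abs_re_le_norm (w z / z / a - 1)).trans_lt h4
    rw [Complex.sub_re, Complex.one_re, abs_lt] at h6
    linarith
  -- A radial homotopy from the projection onto the circle of radius `δ` to the identity of the
  -- punctured disk.
  let P : C(I × Punctured, Punctured) :=
    { toFun := fun q => ⟨⟨(((1 - q.1) * δ + q.1 * ‖(q.2.1 : ℂ)‖) / ‖(q.2.1 : ℂ)‖ : ℝ) * q.2.1, by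
          have h1 := norm_pos_iff.2 (hne q.2.2)
          rw [mem_closedBall_zero_iff, norm_mul, Complex.norm_real, Real.norm_of_nonneg, div_mul_cancel₀ _ h1.ne']
          · nlinarith [q.1.2.1, q.1.2.2, q.2.1.norm_le_one]
          · have := q.1.2.1
            have : 0 ≤ 1 - (q.1 : ℝ) := by linarith [q.1.2.2]
            positivity⟩, by
          intro h
          have h1 := norm_pos_iff.2 (hne q.2.2)
          have h2 := congrArg Subtype.val h
          simp only [zero, mul_eq_zero, hne q.2.2, or_false, Complex.ofReal_eq_zero, div_eq_zero_iff,
            h1.ne'] at h2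
          rcases q.1.2.1.eq_or_lt with h3 | h3
          · rw [← h3] at h2
            simp [hδ.ne'] at h2
          · nlinarith [q.1.2.2]⟩
      continuous_toFun := by
        refine Continuous.subtype_mk (Continuous.subtype_mk (Continuous.mul
          (Complex.continuous_ofReal.comp (Continuous.div (by fun_prop) (by fun_prop) fun q =>
            (norm_pos_iff.2 (hne q.2.2)).ne')) (by fun_prop)) _) _ }
  have hP0 (z : Punctured) : ‖((P (0, z)).1 : ℂ)‖ = δ := by
    have h1 := norm_pos_iff.2 (hne z.2)
    change ‖((((1 - ((0 : I) : ℝ)) * δ + ((0 : I) : ℝ) * ‖(z.1 : ℂ)‖) / ‖(z.1 : ℂ)‖ : ℝ) : ℂ) * z.1‖ = δ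
    rw [norm_mul, Complex.norm_real, Real.norm_of_nonneg, div_mul_cancel₀ _ h1.ne']
    · simp
    · simp; positivity
  have hP1 (z : Punctured) : P (1, z) = z := by
    have h1 := norm_pos_iff.2 (hne z.2)
    refine Subtype.ext (Subtype.ext ?_)
    change ((((1 - ((1 : I) : ℝ)) * δ + ((1 : I) : ℝ) * ‖(z.1 : ℂ)‖) / ‖(z.1 : ℂ)‖ : ℝ) : ℂ) * z.1 = z.1
    simp [h1.ne']
  let f : C(Punctured, ℂ) := ⟨fun z => w z.1 / z.1, Continuous.div (by fun_prop) (by fun_prop) fun z => hne z.2⟩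
  have hf (z : Punctured) : f z ≠ 0 := div_ne_zero (fun h => z.2 ((hw _).1 h)) (hne z.2)
  obtain ⟨g, hg⟩ := Circle.exists_normalize f hf
  let k : C(Punctured, ℝ) := ⟨fun z => Complex.arg a + Complex.arg (f (P (0, z)) / a), by
    refine continuous_const.add (continuous_iff_continuousAt.2 fun z => ?_)
    refine ContinuousAt.comp (f := fun z : Punctured => f (P (0, z)) / a) (Complex.continuousAt_arg (hδw _ (hP0 z))) ?_
    exact Continuous.continuousAt (by fun_prop)⟩
  have hk (z : Punctured) : (g.comp P) (0, z) = Circle.exp (k z) := by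
    apply Circle.ext
    have h1 := Complex.norm_mul_exp_arg_mul_I a
    have h2 := Complex.norm_mul_exp_arg_mul_I (f (P (0, z)) / a)
    have h3 : ((g.comp P) (0, z) : ℂ) = f (P (0, z)) / ‖f (P (0, z))‖ := hg _
    have h4 : (‖f (P (0, z))‖ : ℂ) ≠ 0 := by exact_mod_cast norm_ne_zero_iff.2 (hf _)
    have h5 : (‖a‖ : ℂ) ≠ 0 := by exact_mod_cast norm_ne_zero_iff.2 ha
    rw [h3, Circle.coe_exp]
    change _ = Complex.exp (((_ + _ : ℝ) : ℂ) * _)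
    rw [Complex.ofReal_add, add_mul, Complex.exp_add, div_eq_iff h4]
    rw [norm_div, Complex.ofReal_div, div_mul_eq_mul_div, div_eq_div_iff h5 ha] at h2
    have h6 := mul_right_cancel₀ h5 ((h2.symm.trans (congrArg (fun x => _ * x) h1.symm)).trans (by ring :
      _ = (‖f (P (0, z))‖ * Complex.exp ((f (P (0, z)) / a).arg * Complex.I) *
        Complex.exp (a.arg * Complex.I)) * (‖a‖ : ℂ)))
    linear_combination h6
  -- The punctured disk is not simply connected, so an angle need not exist for a general map; here
  -- the one on the small circle is extended by homotopy lifting.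
  let l := Circle.isCoveringMap_exp.liftHomotopy (g.comp P) k hk
  have hl (z : Punctured) : Circle.exp (l (1, z)) = g z := by
    have := congrFun (Circle.isCoveringMap_exp.liftHomotopy_lifts (g.comp P) k hk) (1, z)
    refine this.trans ?_
    rw [ContinuousMap.comp_apply, hP1]
  classical
  refine ⟨fun z => if h : z ≠ zero then l (1, ⟨z, h⟩) else 0, ?_, fun z hz => ?_⟩
  · rw [continuousOn_iff_continuous_domRestrict]
    have : ({z : Disk | z ≠ zero}.domRestrict fun z => if h : z ≠ zero then l (1, ⟨z, h⟩) else 0) =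
        fun z : Punctured => l (1, z) := by
      funext z
      exact dif_pos z.2
    rw [this]
    exact l.continuous.comp (by fun_prop)
  · have h1 : (‖(z : ℂ)‖ : ℂ) ≠ 0 := by exact_mod_cast norm_ne_zero_iff.2 (hne hz)
    have h2 : (‖w z‖ : ℂ) ≠ 0 := by exact_mod_cast norm_ne_zero_iff.2 fun h => hz ((hw _).1 h)
    have h3 : ((Circle.exp (l (1, ⟨z, hz⟩)) : Circle) : ℂ) = (w z / z) / ‖w z / z‖ := by
      rw [hl, hg]
      rfl
    simp only [dif_pos hz]
    rw [h3, norm_div, Complex.ofReal_div]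
    have := hne hz
    field_simp

/-- Continuity in polar form: where the modulus vanishes the direction may jump, but it is bounded
and hence harmless. -/
theorem _root_.continuous_ofReal_mul_of_norm_le {X : Type*} [TopologicalSpace X] {ρ : X → ℝ}
    {d : X → ℂ} (hρ : Continuous ρ) (hd : ∀ x, ‖d x‖ ≤ 1) (h : ContinuousOn d {x | ρ x ≠ 0}) :
    Continuous fun x => (ρ x : ℂ) * d x := by
  refine continuous_iff_continuousAt.2 fun x => ?_
  by_cases hx : ρ x = 0
  · have h1 : Tendsto (fun y => |ρ y|) (𝓝 x) (𝓝 0) := by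
      have := hρ.abs.tendsto x
      rwa [hx, abs_zero] at this
    rw [ContinuousAt, hx, Complex.ofReal_zero, zero_mul]
    refine squeeze_zero_norm (fun y => ?_) h1
    rw [norm_mul, Complex.norm_real, Real.norm_eq_abs]
    exact mul_le_of_le_one_right (abs_nonneg _) (hd y)
  · exact (Complex.continuous_ofReal.comp hρ).continuousAt.mul
      (h.continuousAt ((isOpen_ne.preimage hρ).mem_nhds hx))

/-- Interpolate the modulus linearly and the angle `θ` to `0`. The modulus stays zero only at the
centre and equal to one only on the boundary, so every stage is again the normal coordinate of a
singular disk. -/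
theorem exists_homotopy_id {w : C(Disk, ℂ)} (hs : IsSingularCoord w) (hw : ∀ z, w z = 0 ↔ z = zero)
    {B : ℂ →L[ℝ] ℂ} (hB : 0 < Complex.wedge (B 1) (B Complex.I))
    (hwB : (fun z : Disk => w z - B z) =o[𝓝 zero] fun z : Disk => (z : ℂ)) :
    ∃ W : C(I × Disk, ℂ), (∀ z, W (0, z) = w z) ∧ (∀ z, W (1, z) = z) ∧
      ∀ t, IsSingularCoord (W.curry t) := by
  obtain ⟨θ, hθ, hwθ⟩ := exists_angle hw hB hwB
  have hne {z : Disk} (hz : z ≠ zero) : (z : ℂ) ≠ 0 := fun h => hz (Subtype.ext h)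
  let ρ : I × Disk → ℝ := fun q => (1 - q.1) * ‖w q.2‖ + q.1 * ‖(q.2 : ℂ)‖
  have hρ0 (q : I × Disk) : 0 ≤ ρ q :=
    add_nonneg (mul_nonneg (sub_nonneg.2 q.1.2.2) (norm_nonneg _)) (mul_nonneg q.1.2.1 (norm_nonneg _))
  have hρz (t : I) : ρ (t, zero) = 0 := by
    simp only [ρ, (hw zero).2 rfl]
    simp [zero]
  have hρne (t : I) {z : Disk} (hz : z ≠ zero) : 0 < ρ (t, z) := by
    have h1 := norm_pos_iff.2 (hne hz)
    have h2 := norm_pos_iff.2 fun h => hz ((hw z).1 h)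
    rcases t.2.1.eq_or_lt with h3 | h3
    · simp only [ρ, ← h3]
      linarith
    · have := mul_pos h3 h1
      have := mul_nonneg (sub_nonneg.2 t.2.2) h2.le
      simp only [ρ]
      linarith
  let d : I × Disk → ℂ := fun q => q.2 / ‖(q.2 : ℂ)‖ * Circle.exp ((1 - q.1) * θ q.2)
  have hd1 (t : I) {z : Disk} (hz : z ≠ zero) : ‖d (t, z)‖ = 1 := by
    simp only [d]
    rw [norm_mul, Circle.norm_coe, mul_one, norm_div, Complex.norm_real, norm_norm,
      div_self (norm_ne_zero_iff.2 (hne hz))]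
  have hd0 (t : I) : d (t, zero) = 0 := by simp [d, zero]
  have hd (q : I × Disk) : ‖d q‖ ≤ 1 := by
    by_cases hz : q.2 = zero
    · rw [show q = (q.1, zero) from Prod.ext rfl hz, hd0]
      simp
    · exact (hd1 q.1 hz).le
  have hdc : ContinuousOn d {q | ρ q ≠ 0} := by
    have hsub : ∀ q ∈ {q | ρ q ≠ 0}, q.2 ∈ {z : Disk | z ≠ zero} := fun q hq h =>
      hq (by rw [show q = (q.1, zero) from Prod.ext rfl h, hρz])
    have h1 : ContinuousOn (fun q : I × Disk => θ q.2) {q | ρ q ≠ 0} :=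
      hθ.comp continuous_snd.continuousOn hsub
    have h2 : Continuous fun q : I × Disk => (q.2 : ℂ) := continuous_subtype_val.comp continuous_snd
    have h3 : Continuous fun q : I × Disk => (1 - q.1 : ℝ) :=
      continuous_const.sub (continuous_subtype_val.comp continuous_fst)
    refine (h2.continuousOn.div (Complex.continuous_ofReal.comp h2.norm).continuousOn fun q hq => ?_).mul
      ((continuous_subtype_val.comp Circle.exp.continuous).comp_continuousOn (h3.continuousOn.mul h1))
    exact Complex.ofReal_ne_zero.2 (norm_ne_zero_iff.2 (hne (hsub q hq)))
  have hρ : Continuous ρ := by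
    have h2 : Continuous fun q : I × Disk => (q.2 : ℂ) := continuous_subtype_val.comp continuous_snd
    have h3 : Continuous fun q : I × Disk => (q.1 : ℝ) := continuous_subtype_val.comp continuous_fst
    exact ((continuous_const.sub h3).mul (w.continuous.comp continuous_snd).norm).add (h3.mul h2.norm)
  have hn (t : I) (z : Disk) : ‖(ρ (t, z) : ℂ) * d (t, z)‖ = ρ (t, z) := by
    rw [norm_mul, Complex.norm_real, Real.norm_of_nonneg (hρ0 _)]
    by_cases hz : z = zero
    · rw [hz, hρz, zero_mul]
    · rw [hd1 t hz, mul_one]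
  refine ⟨⟨_, continuous_ofReal_mul_of_norm_le hρ hd hdc⟩, fun z => ?_, fun z => ?_, fun t => ⟨fun z => ?_,
    fun z => ?_, zero, by simp [zero], fun z => ?_⟩⟩
  · by_cases hz : z = zero
    · rw [hz, (hw zero).2 rfl]
      change (ρ (0, zero) : ℂ) * _ = 0
      rw [hρz, Complex.ofReal_zero, zero_mul]
    · rw [hwθ z hz]
      simp [ρ, d]
  · by_cases hz : z = zero
    · rw [hz]
      change (ρ (1, zero) : ℂ) * _ = 0
      rw [hρz, Complex.ofReal_zero, zero_mul]
    · simp [ρ, d, mul_div_cancel₀ _ (show (‖(z : ℂ)‖ : ℂ) ≠ 0 from mod_cast norm_ne_zero_iff.2 (hne hz))]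
  · change ‖(ρ (t, z) : ℂ) * d (t, z)‖ ≤ 1
    rw [hn]
    simp only [ρ]
    nlinarith [t.2.1, t.2.2, hs.norm_le z, z.norm_le_one]
  · change ‖(ρ (t, z) : ℂ) * d (t, z)‖ = 1 ↔ _
    rw [hn]
    simp only [ρ]
    constructor
    · intro h
      by_contra h1
      have h2 := (hs.norm_le z).lt_of_ne (mt (hs.norm_eq_one_iff z).1 h1)
      have h3 := z.norm_le_one.lt_of_ne h1
      rcases t.2.1.eq_or_lt with h4 | h4
      · rw [← h4] at h
        linarith
      · nlinarith [t.2.2]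
    · intro h
      rw [h, (hs.norm_eq_one_iff z).2 h]
      ring
  · change (ρ (t, z) : ℂ) * d (t, z) = 0 ↔ _
    rw [← norm_eq_zero, hn]
    refine ⟨fun h => ?_, fun h => h ▸ hρz t⟩
    by_contra hz
    exact (hρne t hz).ne' h

end Disk

/-! ### Meridional disks are homotopic to fibers of the tube -/

namespace Knot

variable {n : ℕ} {K : Knot n} {N : Set (Sph (n + 2))}

namespace IsTube

variable {τ : K.source × ℂ → Sph (n + 2)} (hτ : K.IsTube N τ)

include hτ

theorem exists_coords {X : Type*} [TopologicalSpace X] (f : C(X, Sph (n + 2))) (hf : ∀ x, f x ∈ N) :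
    ∃ (u : C(X, K.source)) (v : C(X, ℂ)), ∀ x, f x = τ (u x, v x) := by
  choose u v _ h using fun x => hτ.exists_of_mem (hf x)
  have h1 : Continuous fun x => (u x, v x) := by
    rw [hτ.isOpenEmbedding.isInducing.continuous_iff]
    exact f.continuous.congr fun x => (h x).symm
  exact ⟨⟨u, h1.fst⟩, ⟨v, h1.snd⟩, fun x => (h x).symm⟩

theorem isSingularDisk_iff {d : C(Disk, Sph (n + 2))} {u : C(Disk, K.source)} {v : C(Disk, ℂ)}
    (h : ∀ z, d z = τ (u z, v z)) : K.IsSingularDisk N d ↔ Disk.IsSingularCoord v := by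
  constructor
  · rintro ⟨h1, h2, h3⟩
    simp only [h, hτ.mem_iff, hτ.mem_frontier_iff, hτ.mem_carrier_iff] at h1 h2 h3
    exact ⟨h1, h2, h3⟩
  · rintro ⟨h1, h2, h3⟩
    constructor <;> simpa only [h, hτ.mem_iff, hτ.mem_frontier_iff, hτ.mem_carrier_iff]

theorem homotopicWith_of_coords {d d' : C(Disk, Sph (n + 2))} (U : C(I × Disk, K.source))
    (W : C(I × Disk, ℂ)) (hW : ∀ t, Disk.IsSingularCoord (W.curry t))
    (h₀ : ∀ z, d z = τ (U (0, z), W (0, z))) (h₁ : ∀ z, d' z = τ (U (1, z), W (1, z))) :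
    d.HomotopicWith d' (K.IsSingularDisk N) :=
  ⟨{  toFun := fun q => τ (U q, W q)
      continuous_toFun := hτ.continuous.comp (U.continuous.prodMk W.continuous)
      map_zero_left := fun z => (h₀ z).symm
      map_one_left := fun z => (h₁ z).symm
      prop' := fun t => (hτ.isSingularDisk_iff (u := U.curry t) (v := W.curry t) fun _ => rfl).2 (hW t) }⟩

omit hτ in
/-- The fibre disk of a tubular neighbourhood over `q`, parametrized through `κ`. -/
def fibreDisk (hτ : K.IsTube N τ) (κ : ℂ ≃ₗᵢ[ℝ] ℂ) (q : K.source) : C(Disk, Sph (n + 2)) :=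
  ⟨fun z => τ (q, κ z), hτ.continuous.comp (continuous_const.prodMk
    (κ.continuous.comp continuous_subtype_val))⟩

/-- All meridional disks are homotopic, through singular disks, to a fibre of the tubular
neighbourhood. -/
theorem exists_homotopicWith_fibreDisk (hn : 2 ≤ n) : ∃ κ : ℂ ≃ₗᵢ[ℝ] ℂ,
    (κ = LinearIsometryEquiv.refl ℝ ℂ ∨ κ = Complex.conjLIE) ∧ ∀ (D : K.MeridionalDisk N) (q : K.source),
      D.toMap.HomotopicWith (hτ.fibreDisk κ q) (K.IsSingularDisk N) := by
  obtain ⟨s, hs1, hs⟩ := hτ.exists_sign hn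
  -- If the tube reverses orientation, fibers are parametrized through conjugation. This depends
  -- only on the tube, hence is the same for all disks.
  obtain ⟨κ, hκ, hκs⟩ : ∃ κ : ℂ ≃ₗᵢ[ℝ] ℂ, (κ = LinearIsometryEquiv.refl ℝ ℂ ∨ κ = Complex.conjLIE) ∧
      ∀ (A : ℂ →L[ℝ] ℂ) (c : ℝ), c ≠ 0 → 0 < s * Complex.wedge (A 1) (A Complex.I) →
        0 < Complex.wedge (A (c * κ 1)) (A (c * κ Complex.I)) := by
    have h (A : ℂ →L[ℝ] ℂ) (c : ℝ) (z : ℂ) : A (c * z) = c * A z := by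
      rw [← Complex.real_smul, map_smul, Complex.real_smul]
    rcases hs1 with rfl | rfl
    · refine ⟨_, .inl rfl, fun A c hc hA => ?_⟩
      have := mul_pos (sq_pos_of_ne_zero hc) hA
      simp only [h, LinearIsometryEquiv.coe_refl, id]
      simp only [Complex.wedge, Complex.re_ofReal_mul, Complex.im_ofReal_mul] at this ⊢
      linarith
    · refine ⟨_, .inr rfl, fun A c hc hA => ?_⟩
      have := mul_pos (sq_pos_of_ne_zero hc) hA
      simp only [h, Complex.conjLIE_apply, Complex.conj_I, map_one, map_neg]
      simp only [Complex.wedge, Complex.re_ofReal_mul, Complex.im_ofReal_mul, Complex.neg_re,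
        Complex.neg_im] at this ⊢
      linarith
  refine ⟨κ, hκ, fun D q => ?_⟩
  have hκκ (z : ℂ) : κ (κ z) = z := by
    rcases hκ with rfl | rfl
    · rfl
    · simp
  obtain ⟨u, v, hD⟩ := hτ.exists_coords D.toMap D.isSingularDisk.mem
  have hv : Disk.IsSingularCoord v := (hτ.isSingularDisk_iff hD).1 D.isSingularDisk
  obtain ⟨z₀, hz₀, hvz⟩ := hv.existsUnique
  obtain ⟨A, hA, hvA⟩ := hτ.exists_expansion hs1 hs (by lia) D hD hz₀ ((hvz z₀).2 rfl)
  obtain ⟨M, hM0, hM, hMz, hM1⟩ := Disk.exists_mobius hz₀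
  have hvM (t : I) : Disk.IsSingularCoord (v.comp (M.curry t)) :=
    Disk.isSingularCoord_comp hv hvz _ (hM t) (hMz t)
  have hκmem (z : Disk) : κ z ∈ Metric.closedBall (0 : ℂ) 1 := by
    simpa only [mem_closedBall_zero_iff, κ.norm_map] using z.norm_le_one
  let κD : C(Disk, Disk) := ⟨fun z => ⟨κ z, hκmem z⟩,
    (κ.continuous.comp continuous_subtype_val).subtype_mk hκmem⟩
  have hκD (z : Disk) : κD (κD z) = z := Subtype.ext (hκκ z)
  have hκ0 : κD Disk.zero = Disk.zero := Subtype.ext (map_zero κ)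
  have hκs' {w : C(Disk, ℂ)} (hw : Disk.IsSingularCoord w) : Disk.IsSingularCoord (w.comp κD) := by
    obtain ⟨z₁, hz₁, hwz⟩ := hw.existsUnique
    refine Disk.isSingularCoord_comp hw hwz κD (fun z => by simp [κD]) ⟨κD z₁, ?_, fun z => ?_⟩
    · simpa [κD] using hz₁
    · rw [← Subtype.ext_iff]
      exact ⟨fun h => by rw [← h, hκD], fun h => by rw [h, hκD]⟩
  -- Reparametrization of the disk: `κ` makes the derivative of the normal coordinate orientation
  -- preserving, and the Möbius map moves the zero to the centre. The constant `c` below is the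
  -- derivative of the Möbius map at `0`.
  let m : C(Disk, Disk) := (M.curry 1).comp κD
  let c : ℝ := 1 - ‖(z₀ : ℂ)‖ ^ 2
  have hc : c ≠ 0 := by
    have : 0 < c := by simp only [c]; nlinarith [norm_nonneg (z₀ : ℂ)]
    exact this.ne'
  have hm0 : m Disk.zero = z₀ := by
    refine Subtype.ext ((congrArg (fun z => (M (1, z) : ℂ)) hκ0).trans ?_)
    rw [hM1]
    simp [Disk.zero]
  have hmc : (fun z : Disk => (m z : ℂ) - z₀ - c * κ z) =o[𝓝 Disk.zero] fun z : Disk => (z : ℂ) := by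
    have h1 : HasDerivAt (fun z : ℂ => (z + z₀) / (1 + conj (z₀ : ℂ) * z)) c 0 := by
      have h2 := ((hasDerivAt_id (0 : ℂ)).add_const (z₀ : ℂ)).fun_div
        (((hasDerivAt_id (0 : ℂ)).const_mul (conj (z₀ : ℂ))).const_add 1) (by simp)
      refine h2.congr_deriv ?_
      have h4 : (z₀ : ℂ) * conj (z₀ : ℂ) = ((‖(z₀ : ℂ)‖ ^ 2 : ℝ) : ℂ) := by
        rw [Complex.mul_conj, Complex.normSq_eq_norm_sq]
      simp [c, h4]
    have h2 : Tendsto (fun z : Disk => κ z) (𝓝 Disk.zero) (𝓝 0) := by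
      have := (κ.continuous.comp continuous_subtype_val).tendsto Disk.zero
      have h3 : κ ((Disk.zero : Disk) : ℂ) = 0 := map_zero κ
      rwa [Function.comp_apply, h3] at this
    refine ((hasDerivAt_iff_isLittleO.1 h1).comp_tendsto h2).congr_left (fun z => ?_) |>.trans_isBigO ?_
    · have h3 : (m z : ℂ) = (κ z + z₀) / (1 + conj (z₀ : ℂ) * κ z) := hM1 _
      rw [h3]
      simp [mul_comm]
    · refine IsBigO.of_bound 1 (.of_forall fun z => ?_)
      simp
  let w : C(Disk, ℂ) := v.comp m
  have hw : Disk.IsSingularCoord w := hκs' (hvM 1)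
  have hwz (z : Disk) : w z = 0 ↔ z = Disk.zero := by
    obtain ⟨z₁, -, h⟩ := hw.existsUnique
    rw [h, ← (h Disk.zero).1 ((hvz _).2 hm0)]
  obtain ⟨W, hW0, hW1, hW⟩ := Disk.exists_homotopy_id (B := A.comp (c • (κ : ℂ →L[ℝ] ℂ))) hw hwz
    (hκs A c hc hA) (by
      have h1 : (fun z : Disk => (m z : ℂ) - z₀) =O[𝓝 Disk.zero] fun z : Disk => (z : ℂ) := by
        have h2 : (fun z : Disk => (c : ℂ) * κ z) =O[𝓝 Disk.zero] fun z : Disk => (z : ℂ) :=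
          IsBigO.of_bound ‖(c : ℂ)‖ (.of_forall fun z => by simp)
        exact (hmc.isBigO.add h2).congr_left fun z => by ring
      have h2 : Tendsto m (𝓝 Disk.zero) (𝓝 z₀) := by
        have := m.continuous.tendsto Disk.zero
        rwa [hm0] at this
      refine (((hvA.comp_tendsto h2).trans_isBigO h1).add
        ((A.isBigO_comp _ _).trans_isLittleO hmc)).congr_left fun z => ?_
      have h3 : A (c * κ z) = c * A (κ z) := by
        rw [← Complex.real_smul, map_smul, Complex.real_smul]
      simp only [w, ContinuousMap.comp_apply, Function.comp_apply, map_sub,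
        ContinuousLinearMap.comp_apply, smul_apply, Complex.real_smul, h3,
        LinearIsometryEquiv.coe_coe'']
      ring)
  have step1 : D.toMap.HomotopicWith (D.toMap.comp (M.curry 1)) (K.IsSingularDisk N) :=
    hτ.homotopicWith_of_coords (u.comp M) (v.comp M) hvM
      (fun z => by simp [hM0, hD]) (fun z => by simp [hD])
  have := source_simplyConnectedSpace hn K
  -- The coordinate in the knot is unconstrained: it contracts since the disk is contractible, and
  -- the resulting constant moves to `q` since the knot is path connected.
  have hu : (u.comp (M.curry 1)).Homotopic (ContinuousMap.const _ q) := by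
    have : ContractibleSpace Disk :=
      (convex_closedBall (0 : ℂ) 1).contractibleSpace ⟨0, by simp⟩
    obtain ⟨y, hy⟩ := id_nullhomotopic Disk
    have h1 := (ContinuousMap.Homotopic.refl (u.comp (M.curry 1))).comp hy
    refine ContinuousMap.Homotopic.trans h1 ?_
    have h2 : (ContinuousMap.const Disk (u (M (1, y)))).Homotopic (ContinuousMap.const Disk q) :=
      ContinuousMap.homotopic_const_iff.2 (PathConnectedSpace.joined _ _)
    exact h2
  obtain ⟨U⟩ := hu
  -- The straightening `W` starts at the normal coordinate composed with `κ`; composing with the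
  -- involution `κ` again undoes this at time `0` and turns the identity at time `1` into `κ`.
  refine step1.trans (hτ.homotopicWith_of_coords U.toContinuousMap
    (W.comp ((ContinuousMap.id I).prodMap κD)) (fun t => hκs' (hW t)) (fun z => ?_) (fun z => ?_))
  · have h1 : U.toContinuousMap (0, z) = _ := U.apply_zero z
    have h2 : W (0, κD z) = v (M (1, z)) := by
      rw [hW0]
      simp [w, m, hκD]
    rw [h1]
    simp [hD, h2]
  · have h1 : U.toContinuousMap (1, z) = _ := U.apply_one z
    rw [h1]
    simp [fibreDisk, hW1, κD]

end IsTube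
end Knot
end

/-! ### Peripheral loops and the meridian -/

noncomputable section


namespace Path.Homotopic.Quotient

variable {X : Type*} [TopologicalSpace X] {x y z : X}

/-- Conjugation by a path class. -/
def conj (Q : Path.Homotopic.Quotient x y) : FundamentalGroup X y →* FundamentalGroup X x where
  toFun R := Q.trans (Path.Homotopic.Quotient.trans R Q.symm)
  map_one' := by
    change Q.trans (Path.Homotopic.Quotient.trans (.refl _) Q.symm) = .refl _
    simp
  map_mul' R S := by
    -- In `FundamentalGroup` the product `R * S` runs through `S` first.
    change Q.trans ((Path.Homotopic.Quotient.trans S R).trans Q.symm) =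
      Path.Homotopic.Quotient.trans (Q.trans (Path.Homotopic.Quotient.trans S Q.symm))
        (Q.trans (Path.Homotopic.Quotient.trans R Q.symm))
    simp [Knot.symm_trans_cancel]

theorem conj_apply (Q : Path.Homotopic.Quotient x y) (R : FundamentalGroup X y) :
    Q.conj R = Q.trans (Path.Homotopic.Quotient.trans R Q.symm) := rfl

/-- The angle of loops as a homomorphism. -/
def angleHom (f : C(X, Circle)) (x : X) : FundamentalGroup X x →* Multiplicative ℝ where
  toFun P := Multiplicative.ofAdd (Path.Homotopic.Quotient.angle f P)
  map_one' := congrArg _ (angle_refl f x)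
  map_mul' P Q := by
    rw [← ofAdd_add, add_comm]
    exact congrArg _ (angle_trans f Q P)

theorem angle_zpow (f : C(X, Circle)) (P : FundamentalGroup X x) (k : ℤ) :
    Path.Homotopic.Quotient.angle f (P ^ k : FundamentalGroup X x) = k * Path.Homotopic.Quotient.angle f P := by
  have h := map_zpow (angleHom f x) P k
  have h2 := congrArg Multiplicative.toAdd h
  rw [toAdd_zpow, zsmul_eq_mul] at h2
  exact h2

end Path.Homotopic.Quotient

/-- Lifts with a common starting point end at the same point when the angles agree, and the line is
simply connected. -/
theorem Path.homotopic_of_angle_eq {x y : Circle} {γ δ : Path x y}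
    (h : γ.angle (.id _) = δ.angle (.id _)) : γ.Homotopic δ := by
  obtain ⟨a, ha⟩ := γ.exists_circle_lift (.id _)
  obtain ⟨b, hb⟩ := δ.exists_circle_lift (.id _)
  rw [γ.angle_eq _ a.continuous ha, δ.angle_eq _ b.continuous hb] at h
  have h0 : Circle.exp (a 0 - b 0) = 1 := by
    rw [Circle.exp_sub, ha, hb, ContinuousMap.id_apply, ContinuousMap.id_apply, γ.source, δ.source,
      div_self']
  let a' : Path (a 0) (a 1) := ⟨a, rfl, rfl⟩
  let b' : Path (a 0) (a 1) :=
    ⟨⟨fun t => b t + (a 0 - b 0), by fun_prop⟩, by simp, by simp; linarith⟩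
  have h1 := (SimplyConnectedSpace.paths_homotopic a' b').map ⟨Circle.exp, Circle.exp.continuous⟩
  obtain rfl : Circle.exp (a 0) = x := (ha 0).trans γ.source
  obtain rfl : Circle.exp (a 1) = y := (ha 1).trans γ.target
  have h2 : γ = a'.map (ContinuousMap.mk Circle.exp Circle.exp.continuous).continuous :=
    Path.ext (funext fun t => (ha t).symm)
  have h3 : δ = b'.map (ContinuousMap.mk Circle.exp Circle.exp.continuous).continuous := by
    refine Path.ext (funext fun t => (hb t).symm.trans ?_)
    change _ = Circle.exp (b t + (a 0 - b 0))
    rw [Circle.exp_add, h0, mul_one]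
  rw [h2, h3]
  exact h1

/-- Applied to `K × S¹`, the boundary of the tube, whose fundamental group is thereby detected by
the angle of the circle factor. -/
theorem Path.homotopic_of_angle_snd_eq {M : Type*} [TopologicalSpace M] [SimplyConnectedSpace M]
    {x y : M × Circle} {γ δ : Path x y} (h : γ.angle .snd = δ.angle .snd) : γ.Homotopic δ := by
  have h1 : (γ.map continuous_fst).Homotopic (δ.map continuous_fst) :=
    SimplyConnectedSpace.paths_homotopic _ _
  have h2 : (γ.map continuous_snd).Homotopic (δ.map continuous_snd) :=
    Path.homotopic_of_angle_eq (by
      obtain ⟨a, ha⟩ := γ.exists_circle_lift .snd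
      obtain ⟨b, hb⟩ := δ.exists_circle_lift .snd
      rw [γ.angle_eq _ a.continuous ha, δ.angle_eq _ b.continuous hb] at h
      rw [Path.angle_eq _ (γ.map continuous_snd) a.continuous ha,
        Path.angle_eq _ (δ.map continuous_snd) b.continuous hb, h])
  obtain ⟨F⟩ := h1
  obtain ⟨G⟩ := h2
  exact ⟨Path.Homotopic.prodHomotopy F G⟩

namespace Knot

variable {n : ℕ} {K : Knot n} {N : Set (Sph (n + 2))}

/-- A path class of the exterior which is represented by a path in the boundary. -/
def IsPeripheral {x y : Exterior N} (P : Path.Homotopic.Quotient x y) : Prop :=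
  ∃ γ : Path x y, Path.Homotopic.Quotient.mk γ = P ∧ ∀ t, (γ t : Sph (n + 2)) ∈ frontier N

theorem IsPeripheral.symm {x y : Exterior N} {P : Path.Homotopic.Quotient x y} (h : IsPeripheral P) :
    IsPeripheral P.symm := by
  obtain ⟨γ, rfl, h⟩ := h
  exact ⟨γ.symm, rfl, fun t => h _⟩

theorem IsPeripheral.trans {x y z : Exterior N} {P : Path.Homotopic.Quotient x y}
    {Q : Path.Homotopic.Quotient y z}
    (h : IsPeripheral P) (h' : IsPeripheral Q) : IsPeripheral (P.trans Q) := by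
  obtain ⟨γ, rfl, h⟩ := h
  obtain ⟨δ, rfl, h'⟩ := h'
  refine ⟨γ.trans δ, rfl, fun t => ?_⟩
  rw [Path.trans_apply]
  split_ifs
  exacts [h _, h' _]

theorem isPeripheral_bdryLoop {d : C(Disk, Sph (n + 2))} (h : K.IsSingularDisk N d) :
    IsPeripheral (.mk (bdryLoop h)) :=
  ⟨_, rfl, fun t => h.circlePt_mem_frontier t⟩

/-- The path followed by the base point of the boundary in a homotopy of singular disks. -/
def track {d d' : C(Disk, Sph (n + 2))} (H : d.HomotopyWith d' (K.IsSingularDisk N))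
    (h : K.IsSingularDisk N d) (h' : K.IsSingularDisk N d') : Path (bdryPt h 0) (bdryPt h' 0) where
  toFun t := ⟨H (t, Disk.circlePt 0), (H.prop' t).circlePt_not_mem_interior 0⟩
  continuous_toFun := by fun_prop
  source' := Subtype.ext (H.apply_zero _)
  target' := Subtype.ext (H.apply_one _)

theorem isPeripheral_track {d d' : C(Disk, Sph (n + 2))}
    (H : d.HomotopyWith d' (K.IsSingularDisk N)) (h : K.IsSingularDisk N d)
    (h' : K.IsSingularDisk N d') : IsPeripheral (.mk (track H h h')) :=
  ⟨_, rfl, fun t => (H.prop' t).circlePt_mem_frontier 0⟩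

theorem bdryLoop_trans_track {d d' : C(Disk, Sph (n + 2))}
    (H : d.HomotopyWith d' (K.IsSingularDisk N)) (h : K.IsSingularDisk N d)
    (h' : K.IsSingularDisk N d') : ((bdryLoop h).trans (track H h h')).Homotopic
      ((track H h h').trans (bdryLoop h')) := by
  refine Path.homotopic_of_square ⟨fun q => ⟨H (q.1, Disk.circlePt q.2),
    (H.prop' q.1).circlePt_not_mem_interior q.2⟩, by fun_prop⟩ _ _ _ _ (fun s => ?_) (fun s => ?_)
    (fun s => ?_) (fun s => ?_)
  · exact Subtype.ext (H.apply_zero _).symm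
  · refine Subtype.ext (congrArg (fun z => H (s, z)) ?_)
    simp [Disk.circlePt_zero, Disk.circlePt_one]
  · rfl
  · exact Subtype.ext (H.apply_one _).symm

/-- The boundary circles sweep out a square with sides the two boundary loops and, twice, the track
of the base point. -/
theorem conj_track {d d' : C(Disk, Sph (n + 2))}
    (H : d.HomotopyWith d' (K.IsSingularDisk N)) (h : K.IsSingularDisk N d)
    (h' : K.IsSingularDisk N d') :
    (Path.Homotopic.Quotient.mk (track H h h')).conj (Path.Homotopic.Quotient.mk (bdryLoop h')) =
      Path.Homotopic.Quotient.mk (bdryLoop h) := by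
  have h1 := Path.Homotopic.Quotient.eq.2 (bdryLoop_trans_track H h h')
  rw [Path.Homotopic.Quotient.mk_trans, Path.Homotopic.Quotient.mk_trans] at h1
  rw [Path.Homotopic.Quotient.conj_apply, ← Path.Homotopic.Quotient.trans_assoc]
  refine (congrArg (fun P => Path.Homotopic.Quotient.trans P _) h1.symm).trans ?_
  simp

namespace IsTube

variable {τ : K.source × ℂ → Sph (n + 2)}

theorem not_mem_interior_of_circle (hτ : K.IsTube N τ) (q : K.source × Circle) :
    τ (q.1, q.2) ∉ interior N := by
  rw [hτ.mem_interior_iff, Circle.norm_coe]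
  exact lt_irrefl _

/-- The parametrization of the boundary of a tubular neighbourhood. -/
def torus (hτ : K.IsTube N τ) : C(K.source × Circle, Exterior N) where
  toFun q := ⟨τ (q.1, q.2), hτ.not_mem_interior_of_circle q⟩
  continuous_toFun := Continuous.subtype_mk (hτ.continuous.comp
    (continuous_fst.prodMk (continuous_subtype_val.comp continuous_snd))) _

variable (hτ : K.IsTube N τ)

include hτ

theorem injective_torus : Function.Injective hτ.torus := by
  rintro ⟨p, s⟩ ⟨q, t⟩ h
  have h1 := hτ.injective (congrArg Subtype.val h)
  simp only [Prod.mk.injEq, Circle.coe_inj] at h1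
  exact Prod.ext h1.1 h1.2

theorem exists_lift_torus {X : Type*} [TopologicalSpace X] (f : C(X, Exterior N))
    (hf : ∀ x, (f x : Sph (n + 2)) ∈ frontier N) :
    ∃ g : C(X, K.source × Circle), ∀ x, f x = hτ.torus (g x) := by
  obtain ⟨u, v, h⟩ := hτ.exists_coords (ContinuousMap.comp ⟨_, continuous_subtype_val⟩ f)
    fun x => hτ.isClosed.frontier_subset (hf x)
  have hv (x : X) : ‖v x‖ = 1 := hτ.mem_frontier_iff.1 ((h x).symm ▸ hf x :
    τ (u x, v x) ∈ frontier N)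
  refine ⟨⟨fun x => (u x, ⟨v x, mem_sphere_zero_iff_norm.2 (hv x)⟩),
    u.continuous.prodMk (v.continuous.subtype_mk _)⟩, fun x => Subtype.ext (h x)⟩

/-- Every peripheral loop is a power of a loop which turns once around the tube. -/
theorem exists_zpow_of_isPeripheral [SimplyConnectedSpace K.source] {x : Exterior N} (m : Path x x)
    {q : K.source × Circle} (l : Path q q) (hl : ∀ t, m t = hτ.torus (l t))
    (hangle : |l.angle .snd| = 2 * Real.pi) {P : Path.Homotopic.Quotient x x} (hP : IsPeripheral P) :
    ∃ k : ℤ, P = FundamentalGroup.fromPath (Path.Homotopic.Quotient.mk m) ^ k := by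
  obtain ⟨γ, rfl, hγ⟩ := hP
  obtain ⟨g, hg⟩ := hτ.exists_lift_torus γ.toContinuousMap hγ
  have hx : x = hτ.torus q := by rw [← m.source, hl, l.source]
  subst hx
  let γ' : Path q q := ⟨g, hτ.injective_torus ((hg 0).symm.trans γ.source),
    hτ.injective_torus ((hg 1).symm.trans γ.target)⟩
  obtain ⟨j, hj⟩ := Path.Homotopic.Quotient.exists_int_angle_eq .snd (.mk γ')
  -- The angle of a loop is a multiple of `2π`, hence of the angle of `l`; equal angles then give
  -- homotopic loops in `K × S¹`, which are pushed to the exterior.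
  obtain ⟨k, hk⟩ : ∃ k : ℤ, Path.Homotopic.Quotient.angle .snd (.mk γ') = k * l.angle .snd := by
    rcases (abs_eq (by positivity)).1 hangle with h | h
    · exact ⟨j, by rw [hj, h]⟩
    · exact ⟨-j, by rw [hj, h]; push_cast; ring⟩
  have h1 : Path.Homotopic.Quotient.mk γ' = FundamentalGroup.fromPath (Path.Homotopic.Quotient.mk l) ^ k := by
    obtain ⟨δ, hδ⟩ := Path.Homotopic.Quotient.mk_surjective
      (FundamentalGroup.fromPath (Path.Homotopic.Quotient.mk l) ^ k)
    refine Eq.trans (Path.Homotopic.Quotient.eq.2 (Path.homotopic_of_angle_snd_eq ?_)) hδ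
    have h2 := Path.Homotopic.Quotient.angle_zpow .snd (Path.Homotopic.Quotient.mk l : FundamentalGroup _ q) k
    rw [← hδ] at h2
    exact hk.trans h2.symm
  refine ⟨k, ?_⟩
  have h2 := congrArg (FundamentalGroup.map hτ.torus q) h1
  rw [map_zpow] at h2
  have h3 : FundamentalGroup.map hτ.torus q (Path.Homotopic.Quotient.mk γ') = Path.Homotopic.Quotient.mk γ := by
    change Path.Homotopic.Quotient.mk (γ'.map hτ.torus.continuous) = Path.Homotopic.Quotient.mk γ
    exact congrArg _ (Path.ext (funext fun t => (hg t).symm))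
  have h4 : FundamentalGroup.map hτ.torus q (Path.Homotopic.Quotient.mk l) = Path.Homotopic.Quotient.mk m := by
    change Path.Homotopic.Quotient.mk (l.map hτ.torus.continuous) = Path.Homotopic.Quotient.mk m
    exact congrArg _ (Path.ext (funext fun t => (hl t).symm))
  rw [h3, h4] at h2
  exact h2

omit hτ in
/-- The action of a real linear isometry of `ℂ` on the circle. -/
def circleMap (κ : ℂ ≃ₗᵢ[ℝ] ℂ) : C(Circle, Circle) where
  toFun s := ⟨κ s, mem_sphere_zero_iff_norm.2 ((κ.norm_map _).trans s.norm_coe)⟩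
  continuous_toFun := (κ.continuous.comp continuous_subtype_val).subtype_mk _

omit hτ in
/-- A loop which runs once around the tube. -/
def fibreLoop (κ : ℂ ≃ₗᵢ[ℝ] ℂ) (q : K.source) : Path (q, circleMap κ 1) (q, circleMap κ 1) where
  toFun t := (q, circleMap κ (Circle.exp (2 * Real.pi * t)))
  continuous_toFun := by fun_prop
  source' := by simp
  target' := by simp

omit hτ in
theorem abs_angle_fibreLoop {κ : ℂ ≃ₗᵢ[ℝ] ℂ}
    (hκ : κ = LinearIsometryEquiv.refl ℝ ℂ ∨ κ = Complex.conjLIE) (q : K.source) :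
    |(fibreLoop κ q).angle .snd| = 2 * Real.pi := by
  rcases hκ with rfl | rfl
  · rw [Path.angle_eq _ (fibreLoop _ q) (h := fun t : I => 2 * Real.pi * t) (by fun_prop) fun t => rfl]
    simp [abs_of_pos Real.pi_pos]
  · rw [Path.angle_eq _ (fibreLoop _ q) (h := fun t : I => -(2 * Real.pi * t)) (by fun_prop) fun t => by
      apply Circle.ext
      rw [Circle.exp_neg, Circle.coe_inv_eq_conj]
      rfl]
    simp [abs_of_pos Real.pi_pos]

theorem isSingularDisk_fibreDisk (κ : ℂ ≃ₗᵢ[ℝ] ℂ) (q : K.source) :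
    K.IsSingularDisk N (hτ.fibreDisk κ q) := by
  refine (hτ.isSingularDisk_iff (u := .const _ q) (v := ⟨fun z => κ z, by fun_prop⟩)
    fun z => rfl).2 ⟨fun z => ?_, fun z => ?_, Disk.zero, ?_, fun z => ?_⟩
  · simpa using z.norm_le_one
  · exact Eq.congr_left (κ.norm_map _)
  · simp [Disk.zero]
  · exact (map_eq_zero_iff κ κ.injective).trans (Subtype.ext_iff (a2 := Disk.zero)).symm

theorem bdryLoop_fibreDisk (κ : ℂ ≃ₗᵢ[ℝ] ℂ) (q : K.source) (t : I) :
    bdryLoop (hτ.isSingularDisk_fibreDisk κ q) t = hτ.torus (fibreLoop κ q t) := by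
  refine Subtype.ext (congrArg τ (Prod.ext rfl (congrArg κ ?_)))
  simp [Disk.circlePt, Disk.rotate, Disk.one]

/-- Every peripheral loop is a power of the boundary of a meridional disk. -/
theorem exists_zpow_bdryLoop (hn : 2 ≤ n) (D : K.MeridionalDisk N)
    {P : Path.Homotopic.Quotient D.exteriorPt D.exteriorPt}
    (hP : IsPeripheral P) :
    ∃ k : ℤ, P = FundamentalGroup.fromPath
      (Path.Homotopic.Quotient.mk (bdryLoop D.isSingularDisk)) ^ k := by
  have := source_simplyConnectedSpace hn K
  obtain ⟨κ, hκ, h⟩ := hτ.exists_homotopicWith_fibreDisk hn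
  obtain ⟨q⟩ : Nonempty K.source := inferInstance
  obtain ⟨H⟩ := h D q
  have hf := hτ.isSingularDisk_fibreDisk κ q
  have hT := isPeripheral_track H D.isSingularDisk hf
  have hc := conj_track H D.isSingularDisk hf
  set T := Path.Homotopic.Quotient.mk (track H D.isSingularDisk hf)
  -- The loop is carried along the track to a fiber disk, whose boundary has explicit coordinates,
  -- and the relation found there is conjugated back.
  obtain ⟨k, hk⟩ := hτ.exists_zpow_of_isPeripheral (bdryLoop hf) (fibreLoop κ q)
    (hτ.bdryLoop_fibreDisk κ q) (abs_angle_fibreLoop hκ q) ((hT.symm.trans hP).trans hT)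
  refine ⟨k, ?_⟩
  rw [← hc, ← map_zpow, ← hk, Path.Homotopic.Quotient.conj_apply]
  simp [trans_symm_cancel]

/-- Both disks deform to the same fiber of the tube, with the same parametrization `κ`. -/
theorem exists_homotopyWith (hn : 2 ≤ n) (D D' : K.MeridionalDisk N) :
    D.toMap.HomotopicWith D'.toMap (K.IsSingularDisk N) := by
  have := source_simplyConnectedSpace hn K
  obtain ⟨κ, -, h⟩ := hτ.exists_homotopicWith_fibreDisk hn
  obtain ⟨q⟩ : Nonempty K.source := inferInstance
  exact (h D q).trans (h D' q).symm

end IsTube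
end Knot
end

/-! ### Fibers and their complements near the knot -/

noncomputable section


/-- A boundary point is sent to the boundary of the model by every chart of the maximal atlas. -/
theorem isBoundaryPoint_iff_of_mem_maximalAtlas {E H M : Type*} [NormedAddCommGroup E]
    [NormedSpace ℝ E] [TopologicalSpace H] {J : ModelWithCorners ℝ E H} [TopologicalSpace M]
    [ChartedSpace H M] [IsManifold J ∞ M] {e : OpenPartialHomeomorph M H}
    (he : e ∈ IsManifold.maximalAtlas J ∞ M) {x : M} (hx : x ∈ e.source) :
    J.IsBoundaryPoint x ↔ e.extend J x ∈ frontier (Set.range J) := by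
  have h : IsLocalDiffeomorphAt J J ∞ e x :=
    ⟨{  toPartialEquiv := e.toPartialEquiv
        open_source := e.open_source
        open_target := e.open_target
        contMDiffOn_toFun := contMDiffOn_of_mem_maximalAtlas he
        contMDiffOn_invFun := contMDiffOn_symm_of_mem_maximalAtlas he }, hx, fun y hy => rfl⟩
  rw [h.isBoundaryPoint_iff (by simp), ModelWithCorners.isBoundaryPoint_iff]
  simp [chartAt_self_eq]

/-- A ball minus half of a hyperplane in it is connected. -/
theorem isPreconnected_ball_diff_halfSpace {m : ℕ} {y₀ : EuclideanSpace ℝ (Fin (m + 1))} {ε : ℝ}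
    (hε : 0 < ε) (hy₀ : y₀ 0 = 0) :
    IsPreconnected {q : EuclideanSpace ℝ (Fin (m + 1)) × ℝ | q ∈ Metric.ball y₀ ε ×ˢ Metric.ball 0 ε ∧
      ¬(q.2 = 0 ∧ 0 ≤ q.1 0)} := by
  let Q : Set (EuclideanSpace ℝ (Fin (m + 1)) × ℝ) := Metric.ball y₀ ε ×ˢ Metric.ball 0 ε
  have hQ : Convex ℝ Q := (convex_ball _ _).prod (convex_ball _ _)
  let f : EuclideanSpace ℝ (Fin (m + 1)) × ℝ →ₗ[ℝ] ℝ :=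
    (EuclideanSpace.proj 0).toLinearMap ∘ₗ LinearMap.fst ℝ _ ℝ
  have h1 : Convex ℝ (Q ∩ {q | 0 < q.2}) :=
    hQ.inter (convex_halfSpace_gt (LinearMap.snd ℝ _ ℝ).isLinear 0)
  have h2 : Convex ℝ (Q ∩ {q | q.2 < 0}) :=
    hQ.inter (convex_halfSpace_lt (LinearMap.snd ℝ _ ℝ).isLinear 0)
  have h3 : Convex ℝ (Q ∩ {q | q.1 0 < 0}) := hQ.inter (convex_halfSpace_lt f.isLinear 0)
  -- The set is the union of three convex pieces: above the hyperplane, below it, and on the side of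
  -- the missing half. Points over `y₁` connect the third with the other two.
  let y₁ : EuclideanSpace ℝ (Fin (m + 1)) := y₀ - EuclideanSpace.single 0 (ε / 2)
  have hy₁ : y₁ 0 < 0 := by simp [y₁, hy₀, hε]
  have hp (s : ℝ) (hs : |s| < ε) : (y₁, s) ∈ Q := by
    refine ⟨?_, by simpa using hs⟩
    simp [y₁, abs_of_pos hε, hε]
  have hab : |ε / 2| < ε := by rw [abs_of_pos (by linarith)]; linarith
  have hab' : |-(ε / 2)| < ε := by rwa [abs_neg]
  have n1 : ((Q ∩ {q | 0 < q.2}) ∩ (Q ∩ {q | q.1 0 < 0})).Nonempty :=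
    ⟨_, ⟨hp _ hab, half_pos hε⟩, ⟨hp _ hab, hy₁⟩⟩
  have e1 := IsPreconnected.union' n1 h1.isPreconnected h3.isPreconnected
  have n2 : (((Q ∩ {q | 0 < q.2}) ∪ (Q ∩ {q | q.1 0 < 0})) ∩ (Q ∩ {q | q.2 < 0})).Nonempty :=
    ⟨_, .inr ⟨hp _ hab', hy₁⟩, ⟨hp _ hab', neg_lt_zero.2 (half_pos hε)⟩⟩
  have e2 := IsPreconnected.union' n2 e1 h2.isPreconnected
  convert e2 using 1
  ext q
  simp only [Set.mem_ofPred_eq, Set.mem_union, Set.mem_inter_iff]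
  constructor
  · rintro ⟨hq, h⟩
    rcases lt_trichotomy q.2 0 with h4 | h4 | h4
    · exact .inr ⟨hq, h4⟩
    · exact .inl (.inr ⟨hq, not_le.1 fun h5 => h ⟨h4, h5⟩⟩)
    · exact .inl (.inl ⟨hq, h4⟩)
  · rintro ((⟨hq, h⟩ | ⟨hq, h⟩) | ⟨hq, h⟩)
    · exact ⟨hq, fun h' => h.ne' h'.1⟩
    · exact ⟨hq, fun h' => h'.2.not_gt h⟩
    · exact ⟨hq, fun h' => h.ne h'.1⟩

namespace Knot

variable {n : ℕ} {K : Knot n}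

/-- A chart of the sphere at a boundary point of a Seifert surface `V` in which `V` is a half space
of a hyperplane and `K` its boundary. -/
theorem IsSeifertSurface.exists_chart {V : Set (Sph (n + 2))} (hV : K.IsSeifertSurface V)
    {x : Sph (n + 2)} (hx : x ∈ K.carrier) {O : Set (Sph (n + 2))} (hO : O ∈ 𝓝 x) :
    ∃ (ψ : EuclideanSpace ℝ (Fin (n + 1)) × ℝ → Sph (n + 2)) (y₀ : EuclideanSpace ℝ (Fin (n + 1)))
      (ε : ℝ), 0 < ε ∧ y₀ 0 = 0 ∧ ContinuousOn ψ (Metric.ball y₀ ε ×ˢ Metric.ball 0 ε) ∧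
      ψ '' (Metric.ball y₀ ε ×ˢ Metric.ball 0 ε) ∈ 𝓝 x ∧
      ψ '' (Metric.ball y₀ ε ×ˢ Metric.ball 0 ε) ⊆ O ∧
      ∀ q ∈ Metric.ball y₀ ε ×ˢ Metric.ball 0 ε, (ψ q ∈ V ↔ q.2 = 0 ∧ 0 ≤ q.1 0) ∧
        (ψ q ∈ K.carrier ↔ q.2 = 0 ∧ 0 = q.1 0) := by
  obtain ⟨W, _, _, _, g, -, -, hg, rfl, hK⟩ := hV
  rw [← hK] at hx ⊢
  obtain ⟨w, hw, rfl⟩ := hx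
  have him := hg.isImmersion.isImmersionAt w
  let F := him.complement
  let d := him.domChart.extend (𝓡∂ (n + 1))
  let c := him.codChart.extend (𝓡 (n + 2))
  -- The immersion has codimension one, so the complement in its normal form can be replaced by `ℝ`.
  have hfin : Module.finrank ℝ F = Module.finrank ℝ ℝ := by
    have h1 : FiniteDimensional ℝ F := Module.Finite.of_injective
      ((him.equiv : _ →ₗ[ℝ] EuclideanSpace ℝ (Fin (n + 2))) ∘ₗ LinearMap.inr ℝ
        (EuclideanSpace ℝ (Fin (n + 1))) F)
      (him.equiv.injective.comp fun a b h => congrArg Prod.snd h)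
    have h2 := him.equiv.toLinearEquiv.finrank_eq
    rw [Module.finrank_prod, finrank_euclideanSpace_fin, finrank_euclideanSpace_fin] at h2
    rw [Module.finrank_self]
    change n + 1 + Module.finrank ℝ him.complement = n + 2 at h2
    exact Nat.add_left_cancel (n := n + 1) h2
  have : FiniteDimensional ℝ F := Module.finite_of_finrank_eq_succ (n := 0) (by rw [hfin, Module.finrank_self])
  let ι : F ≃L[ℝ] ℝ := ContinuousLinearEquiv.ofFinrankEq hfin
  let e : (EuclideanSpace ℝ (Fin (n + 1)) × ℝ) ≃L[ℝ] EuclideanSpace ℝ (Fin (n + 2)) :=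
    ((ContinuousLinearEquiv.refl ℝ _).prodCongr ι.symm).trans him.equiv
  have he0 (y : EuclideanSpace ℝ (Fin (n + 1))) : e (y, 0) = him.equiv (y, 0) := by
    change him.equiv (y, ι.symm 0) = _
    rw [map_zero]
  let C := him.codChart
  have hws : w ∈ him.domChart.source := him.mem_domChart_source
  have hC {w' : W} (h : w' ∈ him.domChart.source) : C (g w') = e (d w', 0) := by
    have h0 : w' ∈ d.source := by rwa [him.domChart.extend_source]
    have h1 := him.writtenInCharts (d.map_source h0)
    rw [he0]
    refine Eq.trans ?_ h1
    change C (g w') = C (g (d.symm (d w')))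
    rw [d.left_inv h0]
  have hsrc {w' : W} (h : w' ∈ him.domChart.source) : g w' ∈ C.source :=
    him.source_subset_preimage_source h
  -- As `g` is an embedding, no other part of the surface comes near `g w`: inside `O'` the surface
  -- is seen entirely in the chart.
  obtain ⟨O', hO', hO's⟩ := hg.isEmbedding.isInducing.isOpen_iff.1 him.domChart.open_source
  have hmem {w' : W} : g w' ∈ O' ↔ w' ∈ him.domChart.source := by rw [← hO's]; rfl
  have hbd {w' : W} (h : w' ∈ him.domChart.source) :
      w' ∈ (𝓡∂ (n + 1)).boundary W ↔ 0 = d w' 0 := by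
    rw [ModelWithCorners.boundary, Set.mem_ofPred_eq,
      isBoundaryPoint_iff_of_mem_maximalAtlas him.domChart_mem_maximalAtlas h,
      frontier_range_modelWithCornersEuclideanHalfSpace]
    rfl
  have hT : IsOpen (C.target ∩ C.symm ⁻¹' (O' ∩ interior O)) :=
    C.isOpen_inter_preimage_symm (hO'.inter isOpen_interior)
  have hy₀T : e (d w, 0) ∈ C.target ∩ C.symm ⁻¹' (O' ∩ interior O) := by
    rw [← hC hws]
    refine ⟨C.map_source (hsrc hws), ?_⟩
    rw [Set.mem_preimage, C.left_inv (hsrc hws)]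
    exact ⟨hmem.2 hws, mem_interior_iff_mem_nhds.2 hO⟩
  have h1 := (e.continuous.continuousAt (x := (d w, 0))).preimage_mem_nhds (hT.mem_nhds hy₀T)
  have h2 : d.target ∈ 𝓝[Set.range (𝓡∂ (n + 1))] (d w) :=
    him.domChart.extend_target_mem_nhdsWithin hws
  obtain ⟨ε₁, hε₁, hball₁⟩ := Metric.mem_nhds_iff.1 h1
  obtain ⟨ε₂, hε₂, hball₂⟩ := Metric.mem_nhdsWithin_iff.1 h2
  let ε := min ε₁ ε₂
  have hε : 0 < ε := lt_min hε₁ hε₂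
  have hQ {q} (hq : q ∈ Metric.ball (d w) ε ×ˢ Metric.ball (0 : ℝ) ε) :
      e q ∈ C.target ∩ C.symm ⁻¹' (O' ∩ interior O) := by
    apply hball₁
    rw [← ball_prod_same]
    exact ⟨Metric.ball_subset_ball (min_le_left _ _) hq.1,
      Metric.ball_subset_ball (min_le_left _ _) hq.2⟩
  have hkey {q} (hq : q ∈ Metric.ball (d w) ε ×ˢ Metric.ball (0 : ℝ) ε) {w' : W}
      (h : g w' = C.symm (e q)) : w' ∈ him.domChart.source ∧ q = (d w', 0) := by
    have h3 : w' ∈ him.domChart.source := hmem.1 (h ▸ (hQ hq).2.1)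
    refine ⟨h3, e.injective ?_⟩
    rw [← hC h3, h, C.right_inv (hQ hq).1]
  have hex {q} (hq : q ∈ Metric.ball (d w) ε ×ˢ Metric.ball (0 : ℝ) ε) (h0 : q.2 = 0)
      (h0' : 0 ≤ q.1 0) : ∃ w', g w' = C.symm (e q) := by
    have h3 : q.1 ∈ d.target := hball₂ ⟨Metric.ball_subset_ball (min_le_right _ _) hq.1, by
      rw [range_modelWithCornersEuclideanHalfSpace]; exact h0'⟩
    have h4 : d.symm q.1 ∈ him.domChart.source := by
      have h5 := d.map_target h3
      rwa [him.domChart.extend_source] at h5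
    refine ⟨d.symm q.1, ?_⟩
    rw [← C.left_inv (hsrc h4), hC h4, d.right_inv h3, ← h0]
  refine ⟨C.symm ∘ e, d w, ε, hε, ((hbd hws).1 hw).symm,
    C.continuousOn_symm.comp e.continuous.continuousOn fun q hq => (hQ hq).1, ?_, ?_, ?_⟩
  · rw [Set.image_comp]
    have ho : IsOpen (e '' (Metric.ball (d w) ε ×ˢ Metric.ball (0 : ℝ) ε)) :=
      e.toHomeomorph.isOpenMap _ (Metric.isOpen_ball.prod Metric.isOpen_ball)
    refine (C.isOpen_image_symm_of_subset_target ho ?_).mem_nhds ?_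
    · rintro _ ⟨q, hq, rfl⟩
      exact (hQ hq).1
    · refine ⟨_, ⟨(d w, 0), ⟨Metric.mem_ball_self hε, Metric.mem_ball_self hε⟩, rfl⟩, ?_⟩
      rw [← hC hws, C.left_inv (hsrc hws)]
  · rintro _ ⟨q, hq, rfl⟩
    exact interior_subset (hQ hq).2.2
  · intro q hq
    refine ⟨⟨?_, fun h => hex hq h.1 h.2⟩, ⟨?_, fun h => ?_⟩⟩
    · rintro ⟨w', h⟩
      obtain ⟨h3, rfl⟩ := hkey hq h
      refine ⟨rfl, ?_⟩
      have h4 : d w' ∈ Set.range (𝓡∂ (n + 1)) := ⟨_, rfl⟩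
      rwa [range_modelWithCornersEuclideanHalfSpace] at h4
    · rintro ⟨w', hw', h⟩
      obtain ⟨h3, rfl⟩ := hkey hq h
      exact ⟨rfl, (hbd h3).1 hw'⟩
    · obtain ⟨w', hw'⟩ := hex hq h.1 h.2.le
      obtain ⟨h3, h4⟩ := hkey hq hw'
      refine ⟨w', (hbd h3).2 ?_, hw'⟩
      rw [h.2, h4]

/-- Near a boundary point `x`, the interior of a Seifert surface and its complement are
connected. -/
theorem IsSeifertSurface.exists_mem_nhds_isPreconnected {V : Set (Sph (n + 2))}
    (hV : K.IsSeifertSurface V) {x : Sph (n + 2)} (hx : x ∈ K.carrier) {O : Set (Sph (n + 2))}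
    (hO : O ∈ 𝓝 x) : ∃ B ∈ 𝓝 x, B ⊆ O ∧ IsPreconnected (B ∩ (V \ K.carrier)) ∧
      IsPreconnected (B \ V) := by
  obtain ⟨ψ, y₀, ε, hε, hy₀, hψ, hψx, hψO, h⟩ := hV.exists_chart hx hO
  refine ⟨_, hψx, hψO, ?_, ?_⟩
  · let f : EuclideanSpace ℝ (Fin (n + 1)) →ₗ[ℝ] ℝ := (EuclideanSpace.proj 0).toLinearMap
    have h1 : Convex ℝ ((Metric.ball y₀ ε ∩ {y | 0 < y 0}) ×ˢ {(0 : ℝ)}) :=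
      ((convex_ball _ _).inter (convex_halfSpace_gt f.isLinear 0)).prod (convex_singleton _)
    have h2 : (Metric.ball y₀ ε ∩ {y | 0 < y 0}) ×ˢ {(0 : ℝ)} ⊆
        Metric.ball y₀ ε ×ˢ Metric.ball 0 ε := by
      rintro q ⟨hq, hq'⟩
      refine ⟨hq.1, ?_⟩
      rw [hq']
      exact Metric.mem_ball_self hε
    convert h1.isPreconnected.image ψ (hψ.mono h2) using 1
    ext z
    constructor
    · rintro ⟨⟨q, hq, rfl⟩, hz, hz'⟩
      have h3 := (h q hq).1.1 hz
      refine ⟨q, ⟨⟨hq.1, lt_of_le_of_ne h3.2 fun h4 => hz' ((h q hq).2.2 ⟨h3.1, h4⟩)⟩, h3.1⟩, rfl⟩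
    · rintro ⟨q, hq, rfl⟩
      have h3 := h2 hq
      exact ⟨⟨q, h3, rfl⟩, (h q h3).1.2 ⟨hq.2, hq.1.2.le⟩,
        fun h4 => hq.1.2.ne ((h q h3).2.1 h4).2⟩
  · convert (isPreconnected_ball_diff_halfSpace hε hy₀).image ψ
      (hψ.mono fun q hq => hq.1) using 1
    ext z
    constructor
    · rintro ⟨⟨q, hq, rfl⟩, hz⟩
      exact ⟨q, ⟨hq, fun h3 => hz ((h q hq).1.2 h3)⟩, rfl⟩
    · rintro ⟨q, hq, rfl⟩
      exact ⟨⟨q, hq.1, rfl⟩, fun h3 => hq.2 ((h q hq.1).1.1 h3)⟩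

/-- Near a point of the knot, the fiber over `s` and the union of the other fibers are
connected. -/
theorem IsFibration.exists_mem_nhds_isPreconnected {π : C(K.Complement, Circle)}
    (hπ : K.IsFibration π) (s : Circle) {x : Sph (n + 2)} (hx : x ∈ K.carrier)
    {O : Set (Sph (n + 2))} (hO : O ∈ 𝓝 x) :
    ∃ B ∈ 𝓝 x, B ⊆ O ∧ IsPreconnected {y : K.Complement | (y : Sph (n + 2)) ∈ B ∧ π y = s} ∧
      IsPreconnected {y : K.Complement | (y : Sph (n + 2)) ∈ B ∧ π y ≠ s} := by
  let V := closure {x | ∃ y : K.Complement, π y = s ∧ (y : Sph (n + 2)) = x}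
  have hV : K.IsSeifertSurface V := hπ.2 s
  have hKV : K.carrier ⊆ V := by
    obtain ⟨W, _, _, _, g, -, -, -, h1, h2⟩ := hV
    rw [← h1, ← h2]
    exact Set.image_subset_range _ _
  -- The fiber is closed in the complement, so taking its closure in the sphere adds only points of
  -- the knot.
  have hmem (y : K.Complement) : (y : Sph (n + 2)) ∈ V ↔ π y = s := by
    have h1 : IsClosed {y | π y = s} := isClosed_eq π.continuous continuous_const
    have h2 := h1.closure_eq
    rw [(Topology.IsInducing.subtypeVal (t := {x | x ∉ K.carrier})).closure_eq_preimage_closure_image] at h2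
    exact Set.ext_iff.1 h2 y
  obtain ⟨B, hB, hBO, h1, h2⟩ := hV.exists_mem_nhds_isPreconnected hx hO
  refine ⟨B, hB, hBO, ?_, ?_⟩
  · rw [← (Topology.IsInducing.subtypeVal (t := {x | x ∉ K.carrier})).isPreconnected_image]
    convert h1 using 1
    ext z
    constructor
    · rintro ⟨y, hy, rfl⟩
      exact ⟨hy.1, (hmem y).2 hy.2, y.2⟩
    · rintro ⟨hz, hz', hz''⟩
      exact ⟨⟨z, hz''⟩, ⟨hz, (hmem _).1 hz'⟩, rfl⟩
  · rw [← (Topology.IsInducing.subtypeVal (t := {x | x ∉ K.carrier})).isPreconnected_image]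
    convert h2 using 1
    ext z
    constructor
    · rintro ⟨y, hy, rfl⟩
      exact ⟨hy.1, fun h => hy.2 ((hmem y).1 h)⟩
    · rintro ⟨hz, hz'⟩
      exact ⟨⟨z, fun h => hz' (hKV h)⟩, ⟨hz, fun h => hz' ((hmem _).2 h)⟩, rfl⟩

end Knot

end

noncomputable section


/-! ### Polar coordinates -/

theorem Circle.isOpenQuotientMap_exp : IsOpenQuotientMap Circle.exp :=
  ⟨Circle.exp_surjective, Circle.exp.continuous, Circle.isCoveringMap_exp.isLocalHomeomorph.isOpenMap⟩

theorem isOpenEmbedding_polarCoordinates :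
    Topology.IsOpenEmbedding fun q : ℝ × Circle => (Real.exp q.1 * q.2 : ℂ) := by
  refine .of_continuous_injective_isOpenMap (by fun_prop) ?_ ?_
  · rintro ⟨s, z⟩ ⟨s', z'⟩ h
    have h1 := congrArg norm h
    simp only [norm_mul, Circle.norm_coe, mul_one, Complex.norm_real, Real.norm_eq_abs,
      Real.abs_exp, Real.exp_eq_exp] at h1
    subst h1
    have h2 : (Real.exp s : ℂ) ≠ 0 := by exact_mod_cast (Real.exp_pos s).ne'
    exact Prod.ext rfl (Circle.ext (mul_left_cancel₀ h2 h))
  · rw [(IsOpenQuotientMap.id.prodMap Circle.isOpenQuotientMap_exp).isOpenMap_iff]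
    convert Complex.isOpenMap_exp.comp Complex.equivRealProdCLM.symm.toHomeomorph.isOpenMap using 1
    funext q
    simp [Complex.exp_add, Complex.equivRealProdCLM_symm_apply]

/-- A map to the circle has a degree `d` along a circle factor, and differs by a map with a
logarithm from the `d`-th power of the projection to this factor. -/
theorem Circle.exists_zpow_mul_exp {A : Type*} [TopologicalSpace A] [SimplyConnectedSpace A]
    [LocallyPathConnectedSpace A] (f : C(A × Circle, Circle)) :
    ∃ (d : ℤ) (h : C(A × Circle, ℝ)), ∀ q, f q = q.2 ^ d * Circle.exp (h q) := by
  have hq : IsOpenQuotientMap (Prod.map id Circle.exp : A × ℝ → A × Circle) :=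
    IsOpenQuotientMap.id.prodMap Circle.isOpenQuotientMap_exp
  obtain ⟨H, hH⟩ := Circle.exists_lift (f.comp ⟨_, hq.continuous⟩)
  obtain ⟨a₀⟩ : Nonempty A := inferInstance
  have hper (q : A × ℝ) : Circle.exp (H (q.1, q.2 + 2 * Real.pi)) = Circle.exp (H q) := by
    rw [hH, hH]
    exact congrArg f (Prod.ext rfl (Circle.exp_add_two_pi _))
  -- The degree: one turn in the circle factor changes a lift by `2πd`, the same at every point by
  -- connectedness. Subtracting `d * t` makes the lift periodic.
  obtain ⟨d, hd⟩ := Circle.exp_eq_exp.1 (hper (a₀, 0))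
  have hdq (q : A × ℝ) : H (q.1, q.2 + 2 * Real.pi) = H q + d * (2 * Real.pi) := by
    have := Circle.sub_eq_of_lifts (h := fun q : A × ℝ => H (q.1, q.2 + 2 * Real.pi))
      (k := H) (by fun_prop) H.continuous hper q (a₀, 0)
    linarith
  let G : C(A × ℝ, ℝ) := ⟨fun q => H q - d * q.2, by fun_prop⟩
  have hG (q r : A × ℝ) (h : Prod.map id Circle.exp q = Prod.map id Circle.exp r) : G q = G r := by
    obtain ⟨a, s⟩ := q
    obtain ⟨b, t⟩ := r
    obtain rfl : a = b := congrArg Prod.fst h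
    obtain ⟨k, rfl⟩ := Circle.exp_eq_exp.1 (congrArg Prod.snd h : Circle.exp s = Circle.exp t)
    have : Function.Periodic (fun t => G (a, t)) (2 * Real.pi) := fun t => by
      have := hdq (a, t)
      change H _ - _ = H _ - _
      linear_combination this
    exact this.int_mul k t
  refine ⟨d, ⟨fun q => G (q.1, Complex.arg q.2), ?_⟩, fun q => ?_⟩
  -- The argument is discontinuous, but by periodicity the value does not depend on the chosen
  -- preimage, and continuity descends along the quotient map.
  · rw [← hq.continuous_comp_iff]
    convert G.continuous using 1
    funext q
    exact hG _ _ (Prod.ext rfl (Circle.exp_arg (Circle.exp q.2)))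
  · change f q = _ * Circle.exp (H _ - d * _)
    rw [Circle.exp_sub, hH, ← zsmul_eq_mul, Circle.exp_zsmul]
    simp

/-- Every interval of length `2π` contains a preimage of a point of the circle. -/
theorem Circle.exists_mem_Icc_exp_eq (w : Circle) (u : ℝ) :
    ∃ a ∈ Set.Icc u (u + 2 * Real.pi), Circle.exp a = w := by
  refine ⟨toIcoMod Real.two_pi_pos u (Complex.arg w), Set.Ico_subset_Icc_self
    (toIcoMod_mem_Ico _ _ _), ?_⟩
  refine (Circle.exp_eq_exp.2 ⟨-toIcoDiv Real.two_pi_pos u (Complex.arg w), ?_⟩).trans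
    (Circle.exp_arg w)
  rw [toIcoMod, zsmul_eq_mul, Int.cast_neg]
  ring

/-- A logarithm of a map which misses a point varies by at most `2π` on a connected set. -/
theorem IsPreconnected.abs_sub_le_of_exp_ne {A : Type*} [TopologicalSpace A] {S : Set A}
    (hS : IsPreconnected S) {f : A → ℝ} (hf : ContinuousOn f S) {w : Circle}
    (h : ∀ a ∈ S, Circle.exp (f a) ≠ w) {a b : A} (ha : a ∈ S) (hb : b ∈ S) :
    |f a - f b| ≤ 2 * Real.pi := by
  have key {a b : A} (ha : a ∈ S) (hb : b ∈ S) : f a - f b ≤ 2 * Real.pi := by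
    by_contra! hab
    obtain ⟨c, hc, rfl⟩ := Circle.exists_mem_Icc_exp_eq w (f b)
    obtain ⟨x, hx, hxc⟩ := (hS.image f hf).ordConnected.out (Set.mem_image_of_mem f hb)
      (Set.mem_image_of_mem f ha) ⟨hc.1, by linarith [hc.2]⟩
    exact h x hx (by rw [hxc])
  rw [abs_le]
  constructor <;> linarith [key ha hb, key hb ha]

/-- A map of the circle to itself of degree one is surjective. -/
theorem Circle.exists_mul_exp_eq {h : Circle → ℝ} (hh : Continuous h) (w : Circle) :
    ∃ z : Circle, z * Circle.exp (h z) = w := by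
  obtain ⟨a, ha, rfl⟩ := Circle.exists_mem_Icc_exp_eq w (h 1)
  -- Over one turn `t + h (exp t)` increases from `h 1` to `h 1 + 2π`.
  have := intermediate_value_Icc (f := fun t => t + h (Circle.exp t)) Real.two_pi_pos.le
    (by fun_prop)
  simp only [Circle.exp_zero, Circle.exp_two_pi, zero_add] at this
  rw [add_comm] at ha
  obtain ⟨t, -, ht⟩ := this ⟨ha.1, ha.2⟩
  exact ⟨Circle.exp t, by rw [← Circle.exp_add]; exact congrArg _ ht⟩

/-! ### The degree of the fibration along a meridian -/

namespace Knot

variable {n : ℕ} {K : Knot n} {N : Set (Sph (n + 2))} {τ : K.source × ℂ → Sph (n + 2)}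

namespace IsTube

theorem exp_mul_notMem_carrier (hτ : K.IsTube N τ) (q : (K.source × ℝ) × Circle) :
    τ (q.1.1, Real.exp q.1.2 * q.2) ∉ K.carrier := by
  rw [hτ.mem_carrier_iff]
  simp

/-- Polar coordinates in a tubular neighbourhood. -/
def polar (hτ : K.IsTube N τ) : C((K.source × ℝ) × Circle, K.Complement) where
  toFun q := ⟨τ (q.1.1, Real.exp q.1.2 * q.2), hτ.exp_mul_notMem_carrier q⟩
  continuous_toFun := Continuous.subtype_mk (hτ.continuous.comp (by fun_prop)) _

variable (hτ : K.IsTube N τ)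

include hτ

theorem isOpenEmbedding_subtypeVal :
    Topology.IsOpenEmbedding (Subtype.val : K.Complement → Sph (n + 2)) :=
  hτ.isClosed_carrier.isOpen_compl.isOpenEmbedding_subtypeVal

theorem isOpenEmbedding_polar : Topology.IsOpenEmbedding hτ.polar := by
  refine .of_comp _ hτ.isOpenEmbedding_subtypeVal ?_
  exact (hτ.isOpenEmbedding.comp
    (Topology.IsOpenEmbedding.id.prodMap isOpenEmbedding_polarCoordinates)).comp
    (Homeomorph.prodAssoc K.source ℝ Circle).isOpenEmbedding

theorem exists_polar_eq {y : K.Complement} {p : K.source} {c : ℂ}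
    (h : τ (p, c) = y) : ∃ z : Circle, hτ.polar ((p, Real.log ‖c‖), z) = y := by
  have hc : c ≠ 0 := fun h0 => y.2 (h ▸ hτ.mem_carrier_iff.2 h0)
  have hc' : (‖c‖ : ℂ) ≠ 0 := by exact_mod_cast norm_ne_zero_iff.2 hc
  refine ⟨⟨c / ‖c‖, by simp [Submonoid.unitSphere, hc]⟩, Subtype.ext ?_⟩
  rw [← h]
  refine congrArg τ (Prod.ext rfl ?_)
  change (Real.exp (Real.log ‖c‖) : ℂ) * (c / ‖c‖) = c
  rw [Real.exp_log (norm_pos_iff.2 hc)]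
  field_simp

/-- The projection of a fibered knot has no logarithm. -/
theorem not_exists_log {π : C(K.Complement, Circle)} (hπ : K.IsFibration π)
    (f : C(K.Complement, ℝ)) (hf : ∀ y, π y = Circle.exp (f y)) {y₀ : K.Complement}
    (hy₀ : π y₀ = 1) : False := by
  -- The logarithm is locally bounded even at the knot: the fiber over `1` and the union of the
  -- other fibers are connected there, and `π` misses `-1` on the first and `1` on the second.
  have hloc (x : Sph (n + 2)) : ∃ B ∈ 𝓝 x, ∃ C, ∀ y : K.Complement, (y : Sph (n + 2)) ∈ B → |f y| ≤ C := by
    by_cases hx : x ∈ K.carrier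
    · obtain ⟨B, hB, -, h1, h2⟩ := hπ.exists_mem_nhds_isPreconnected 1 hx Filter.univ_mem
      have hbd (S : Set K.Complement) (hS : IsPreconnected S) (w : Circle) (hw : ∀ y ∈ S, π y ≠ w) :
          ∃ C, ∀ y ∈ S, |f y| ≤ C := by
        rcases S.eq_empty_or_nonempty with rfl | ⟨a, ha⟩
        · exact ⟨0, by simp⟩
        · refine ⟨|f a| + 2 * Real.pi, fun y hy => ?_⟩
          have := hS.abs_sub_le_of_exp_ne f.continuous.continuousOn
            (fun y hy => (hf y) ▸ hw y hy) hy ha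
          have h3 := abs_sub_abs_le_abs_sub (f y) (f a)
          linarith
      obtain ⟨C₁, hC₁⟩ := hbd _ h1 (Circle.exp Real.pi) (fun y hy => by
        rw [hy.2]; intro h
        have := congrArg (fun z : Circle => (z : ℂ)) h
        simp [Complex.ext_iff] at this
        norm_num at this)
      obtain ⟨C₂, hC₂⟩ := hbd _ h2 1 fun y hy => hy.2
      refine ⟨B, hB, max C₁ C₂, fun y hy => ?_⟩
      by_cases h : π y = 1
      · exact (hC₁ y ⟨hy, h⟩).trans (le_max_left _ _)
      · exact (hC₂ y ⟨hy, h⟩).trans (le_max_right _ _)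
    · have h1 : ∀ᶠ y in 𝓝 (⟨x, hx⟩ : K.Complement), |f y| < |f ⟨x, hx⟩| + 1 :=
        (f.continuous.abs.tendsto _).eventually_lt_const (by linarith)
      refine ⟨_, hτ.isOpenEmbedding_subtypeVal.isOpenMap.image_mem_nhds h1, |f ⟨x, hx⟩| + 1, ?_⟩
      rintro y ⟨y', hy', h⟩
      obtain rfl := Subtype.ext h
      exact le_of_lt hy'
  choose B hB C hC using hloc
  obtain ⟨t, -, ht⟩ := isCompact_univ.elim_nhds_subcover B fun x _ => hB x
  obtain ⟨M, hM⟩ : ∃ M, ∀ x ∈ t, C x ≤ M := (t.image C).exists_le.imp fun M h x hx =>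
    h _ (Finset.mem_image_of_mem C hx)
  have hfM (y : K.Complement) : |f y| ≤ M := by
    obtain ⟨x, hx, hy⟩ := Set.mem_iUnion₂.1 (ht (Set.mem_univ (y : Sph (n + 2))))
    exact (hC x y hy).trans (hM x hx)
  have hM0 : 0 ≤ M := (abs_nonneg _).trans (hfM y₀)
  -- By compactness of the sphere the logarithm is bounded by `M`, so it cannot increase by `2 * M +
  -- 1` along a path.
  obtain ⟨c, hc, -, hcπ⟩ := exists_path_over_line hπ.1 (2 * M + 1) (by linarith) hy₀
  have hI : (0 : ℝ) ∈ Set.Icc 0 (2 * M + 1) := ⟨le_rfl, by linarith⟩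
  have hI' : 2 * M + 1 ∈ Set.Icc 0 (2 * M + 1) := ⟨by linarith, le_rfl⟩
  have : PreconnectedSpace (Set.Icc 0 (2 * M + 1)) :=
    isPreconnected_iff_preconnectedSpace.1 isPreconnected_Icc
  have := Circle.sub_eq_of_lifts (A := Set.Icc 0 (2 * M + 1)) (h := fun t => f (c t))
    (k := fun t => (t : ℝ)) (f.continuous.comp (continuousOn_iff_continuous_domRestrict.1 hc))
    continuous_subtype_val (fun t => by rw [← hf, hcπ t t.2]) ⟨_, hI'⟩ ⟨_, hI⟩
  have h1 := abs_le.1 (hfM (c 0))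
  have h2 := abs_le.1 (hfM (c (2 * M + 1)))
  simp only at this
  linarith [h1.1, h1.2, h2.1, h2.2]

/-- If `π` has a logarithm near the knot, it has a logarithm on the complement. -/
theorem exists_log (hn : 2 ≤ n) (π : C(K.Complement, Circle))
    (h : C((K.source × ℝ) × Circle, ℝ)) (hh : ∀ q, π (hτ.polar q) = Circle.exp (h q)) :
    ∃ f : C(K.Complement, ℝ), ∀ y, π y = Circle.exp (f y) := by
  -- A cutoff equal to one on the tube of half the radius and to zero outside the interior of `N`;
  -- it extends the logarithm from the tube to `k` on the whole complement.
  obtain ⟨χ, hχ0, hχ1, -⟩ := exists_continuous_zero_one_of_isClosed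
    (isOpen_interior (s := N)).isClosed_compl
    (((isCompact_univ (X := K.source)).prod (isCompact_closedBall (0 : ℂ) (1 / 2))).image
      hτ.continuous).isClosed (by
      rw [Set.disjoint_left]
      rintro _ hx ⟨⟨p, c⟩, hc, rfl⟩
      have hc' : ‖c‖ ≤ 1 / 2 := by simpa using hc
      exact hx (hτ.mem_interior_iff.2 (hc'.trans_lt (by norm_num))))
  let k (y : K.Complement) : ℝ := χ y * Function.extend hτ.polar h 0 y
  have hk : Continuous k := by
    refine continuous_iff_continuousAt.2 fun y => ?_
    by_cases hy : (y : Sph (n + 2)) ∈ N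
    · obtain ⟨p, c, -, hpc⟩ := hτ.exists_of_mem hy
      obtain ⟨z, rfl⟩ := hτ.exists_polar_eq hpc
      refine (χ.continuous.comp continuous_subtype_val).continuousAt.mul ?_
      rw [← hτ.isOpenEmbedding_polar.continuousAt_iff,
        Function.extend_comp hτ.isOpenEmbedding_polar.injective]
      exact h.continuous.continuousAt
    · have h1 : ∀ᶠ y' : K.Complement in 𝓝 y, (0 : ℝ) = k y' := by
        filter_upwards [(hτ.isClosed.isOpen_compl.preimage continuous_subtype_val).mem_nhds hy]
          with y' hy'
        have : χ y' = 0 := hχ0 fun h => hy' (interior_subset h)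
        simp [k, this]
      exact continuousAt_const.congr h1
  -- Dividing by `exp k` makes `π` equal to `1` near the knot. The quotient extends continuously
  -- over the knot and has a logarithm because the sphere is simply connected.
  let φ : Sph (n + 2) → Circle :=
    Function.extend Subtype.val (fun y : K.Complement => π y / Circle.exp (k y)) 1
  have hφ (y : K.Complement) : φ y = π y / Circle.exp (k y) :=
    Subtype.val_injective.extend_apply _ _ y
  have hφc : Continuous φ := by
    refine continuous_iff_continuousAt.2 fun x => ?_
    by_cases hx : x ∈ K.carrier
    · obtain ⟨p, rfl⟩ := hx
      rw [← hτ.apply_zero]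
      have h1 : τ '' (Set.univ ×ˢ Metric.ball 0 (1 / 2)) ∈ 𝓝 (τ (p, 0)) :=
        hτ.isOpenEmbedding.isOpenMap.image_mem_nhds
          ((isOpen_univ.prod Metric.isOpen_ball).mem_nhds ⟨trivial, by simp⟩)
      refine continuousAt_const.congr (f := fun _ => (1 : Circle)) ?_
      filter_upwards [h1] with x hx
      by_cases hxK : x ∈ K.carrier
      · have h2 : φ x = (1 : Sph (n + 2) → Circle) x :=
          Function.extend_apply' _ _ x fun ⟨y, hy⟩ => y.2 (hy ▸ hxK)
        exact h2.symm
      · obtain ⟨⟨p', c⟩, hc, hpc⟩ := hx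
        have h2 : χ x = 1 := hχ1 ⟨(p', c), ⟨trivial, Metric.ball_subset_closedBall hc.2⟩, hpc⟩
        obtain ⟨z, hz⟩ := hτ.exists_polar_eq (y := ⟨x, hxK⟩) hpc
        refine Eq.symm ((hφ ⟨x, hxK⟩).trans ?_)
        have h3 : k ⟨x, hxK⟩ = h ((p', Real.log ‖c‖), z) := by
          simp only [k, h2, one_mul]
          rw [← hz, hτ.isOpenEmbedding_polar.injective.extend_apply]
        rw [h3, ← hh, hz, div_self']
    · refine (hτ.isOpenEmbedding_subtypeVal.continuousAt_iff (x := ⟨x, hx⟩)).1 ?_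
      have : φ ∘ Subtype.val = fun y : K.Complement => π y / Circle.exp (k y) := funext hφ
      rw [this]
      fun_prop
  have := Sph.simplyConnectedSpace (m := n + 2) (hn.trans (Nat.le_add_right n 2))
  obtain ⟨θ, hθ⟩ := Circle.exists_lift ⟨φ, hφc⟩
  refine ⟨⟨fun y => θ y + k y, by fun_prop⟩, fun y => ?_⟩
  change _ = Circle.exp (θ y + k y)
  rw [Circle.exp_add, hθ]
  change _ = φ y * _
  rw [hφ, div_mul_cancel]

/-- The projection of a fibered knot is not a proper power in polar coordinates. -/
theorem natAbs_le_one_of_zpow_mul_exp [Nonempty K.source] {π : C(K.Complement, Circle)}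
    (hπ : K.IsFibration π) {d : ℤ}
    {h : C((K.source × ℝ) × Circle, ℝ)}
    (hd : ∀ q, π (hτ.polar q) = q.2 ^ d * Circle.exp (h q)) : d.natAbs ≤ 1 := by
  by_contra! hd2
  have hd0 : d ≠ 0 := by rintro rfl; simp at hd2
  have hdR : (d : ℝ) ≠ 0 := by exact_mod_cast hd0
  -- A `d`-th root of `π` near the knot, of degree one in the angular coordinate.
  let v : C((K.source × ℝ) × Circle, Circle) := ⟨fun q => q.2 * Circle.exp (h q / d), by fun_prop⟩
  have hv (q) : π (hτ.polar q) = v q ^ d := by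
    rw [hd]
    change _ = (q.2 * Circle.exp (h q / d)) ^ d
    rw [mul_zpow, ← Circle.exp_zsmul, zsmul_eq_mul, mul_div_cancel₀ _ hdR]
  obtain ⟨p⟩ := ‹Nonempty K.source›
  have hp : τ (p, 0) ∈ K.carrier := hτ.mem_carrier_iff.2 rfl
  obtain ⟨B, hB, hBN, hB1, -⟩ := hπ.exists_mem_nhds_isPreconnected 1 hp
    (isOpen_interior.mem_nhds (hτ.carrier_subset hp))
  let S : Set ((K.source × ℝ) × Circle) := hτ.polar ⁻¹' {y | (y : Sph (n + 2)) ∈ B ∧ π y = 1}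
  have hS : IsPreconnected S := by
    rw [← hτ.isOpenEmbedding_polar.isInducing.isPreconnected_image, Set.image_preimage_eq_of_subset]
    · exact hB1
    · rintro y ⟨hy, -⟩
      obtain ⟨p, c, -, hpc⟩ := hτ.exists_of_mem (interior_subset (hBN hy))
      obtain ⟨z, hz⟩ := hτ.exists_polar_eq hpc
      exact ⟨_, hz⟩
  have hfin : {w : Circle | w ^ d = 1}.Finite := by
    have := (Polynomial.nthRootsFinset d.natAbs (1 : ℂ)).finite_toSet.preimage
      (Circle.coe_injective.injOn)
    refine this.subset fun (w : Circle) hw => ?_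
    refine (Polynomial.mem_nthRootsFinset (by lia) (1 : ℂ)).2 (?_ : (w : ℂ) ^ d.natAbs = 1)
    have hw' : w ^ d.natAbs = 1 := by
      rcases Int.natAbs_eq d with e | e
      · rw [← zpow_natCast, ← e]; exact hw
      · rw [← zpow_natCast, ← inv_inj, ← zpow_neg, ← e, inv_one]; exact hw
    rw [← Circle.coe_pow, hw', Circle.coe_one]
  -- On the local fiber over `1` the root takes values in a finite set, and this fiber is connected.
  have hconst (q r) (hq : q ∈ S) (hr : r ∈ S) : v q = v r :=
    hS.constant_of_mapsTo hfin.isDiscrete v.continuous.continuousOn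
      (fun q hq => (hv q).symm.trans hq.2) hq hr
  obtain ⟨ζ, hζ, hζ1⟩ : ∃ ζ : Circle, ζ ^ d = 1 ∧ ζ ≠ 1 := by
    refine ⟨Circle.exp (2 * Real.pi / d), ?_, fun h1 => ?_⟩
    · rw [← Circle.exp_zsmul, zsmul_eq_mul, mul_div_cancel₀ _ hdR, Circle.exp_two_pi]
    · obtain ⟨k, hk⟩ := Circle.exp_eq_one.1 h1
      rw [div_eq_iff hdR] at hk
      have h2 : ((k * d : ℤ) : ℝ) = 1 := by
        push_cast
        apply mul_left_cancel₀ Real.two_pi_pos.ne'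
        linear_combination -hk
      have h3 : k * d = 1 := by exact_mod_cast h2
      have := Int.isUnit_iff_natAbs_eq.1 (IsUnit.of_mul_eq_one_right _ h3)
      lia
  -- A root of unity which `v` omits on the local fiber over `1`. It is omitted off this fiber as
  -- well, since there `v ^ d ≠ 1`.
  obtain ⟨w, hw, hwS⟩ : ∃ w : Circle, w ^ d = 1 ∧ ∀ q ∈ S, v q ≠ w := by
    rcases S.eq_empty_or_nonempty with hS0 | ⟨r, hr⟩
    · exact ⟨1, one_zpow _, by simp [hS0]⟩
    · refine ⟨v r * ζ, ?_, fun q hq h1 => hζ1 ?_⟩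
      · rw [mul_zpow, hζ, mul_one, ← hv, hr.2]
      · rw [hconst q r hq hr] at h1
        exact mul_eq_left.1 h1.symm
  have hwB (q) (hq : (hτ.polar q : Sph (n + 2)) ∈ B) : v q ≠ w := fun h1 =>
    hwS q ⟨hq, by rw [hv, h1, hw]⟩ h1
  have h1 : ∀ᶠ c in 𝓝 (0 : ℂ), τ (p, c) ∈ B := by
    have : Filter.Tendsto (fun c : ℂ => τ (p, c)) (𝓝 0) (𝓝 (τ (p, 0))) :=
      (hτ.continuous.comp (by fun_prop)).tendsto _
    exact this hB
  obtain ⟨ε, hε, hball⟩ := Metric.eventually_nhds_iff.1 h1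
  -- On a circle of radius `ε / 2` around the knot `v` has degree one and hence takes the value `w`.
  obtain ⟨z, hz⟩ := Circle.exists_mul_exp_eq (h := fun z => h ((p, Real.log (ε / 2)), z) / d)
    (by fun_prop) w
  refine hwB ((p, Real.log (ε / 2)), z) (hball ?_) hz
  simp only [dist_zero_right, norm_mul, Circle.norm_coe, mul_one, Complex.norm_real]
  rw [Real.exp_log (half_pos hε), Real.norm_of_nonneg (half_pos hε).le]
  exact half_lt_self hε

/-- The projection of a fibered knot has degree `1` or `-1` along the boundary of a meridional
disk. -/
theorem abs_angle_bdryLoop (hn : 2 ≤ n) {π : C(K.Complement, Circle)} (hπ : K.IsFibration π)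
    (D : K.MeridionalDisk N) (hD : π D.basePt = 1) :
    |(bdryLoop D.isSingularDisk).angle (π.comp (exteriorIncl hτ.carrier_subset))| =
      2 * Real.pi := by
  have := source_simplyConnectedSpace hn K
  obtain ⟨d, h, hd⟩ := Circle.exists_zpow_mul_exp (π.comp hτ.polar)
  have hd1 : |(d : ℝ)| = 1 := by
    have h1 := hτ.natAbs_le_one_of_zpow_mul_exp hπ hd
    have h2 : d ≠ 0 := by
      rintro rfl
      obtain ⟨f, hf⟩ := hτ.exists_log hn π h (fun q => by simpa using hd q)
      exact hτ.not_exists_log hπ f hf hD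
    have h3 : |d| = 1 := by rw [Int.abs_eq_natAbs]; lia
    exact_mod_cast congrArg (Int.cast : ℤ → ℝ) h3
  obtain ⟨κ, hκ, h1⟩ := hτ.exists_homotopicWith_fibreDisk hn
  obtain ⟨q⟩ : Nonempty K.source := inferInstance
  obtain ⟨H⟩ := h1 D q
  have hf := hτ.isSingularDisk_fibreDisk κ q
  -- Conjugation along the track does not change the angle, so it suffices to treat the boundary of
  -- a fiber disk. There the exponent `d` contributes `d` times `±2π`, and the logarithm `h` returns
  -- to its initial value.
  have hc := congrArg (Path.Homotopic.Quotient.angle (π.comp (exteriorIncl hτ.carrier_subset)))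
    (conj_track H D.isSingularDisk hf)
  rw [Path.Homotopic.Quotient.conj_apply] at hc
  erw [Path.Homotopic.Quotient.angle_trans, Path.Homotopic.Quotient.angle_trans] at hc
  rw [Path.Homotopic.Quotient.angle_symm] at hc
  simp only [Path.Homotopic.Quotient.angle_mk] at hc
  rw [← hc, add_comm, neg_add_cancel_right]
  obtain ⟨θ, hθ⟩ := (fibreLoop κ q).exists_circle_lift .snd
  let u (t : I) : (K.source × ℝ) × Circle := ((q, 0), (fibreLoop κ q t).2)
  have hu : Continuous u := by fun_prop
  have hu' (t : I) : exteriorIncl hτ.carrier_subset (bdryLoop hf t) = hτ.polar (u t) := by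
    rw [hτ.bdryLoop_fibreDisk]
    refine Subtype.ext (congrArg τ (Prod.ext rfl ?_))
    simp [u]
  rw [Path.angle_eq _ _ (h := fun t => d * θ t + h (u t)) (by fun_prop) fun t => by
    rw [Circle.exp_add, ← zsmul_eq_mul, Circle.exp_zsmul, hθ]
    exact (hd (u t)).symm.trans (congrArg π (hu' t).symm)]
  have hu01 : u 1 = u 0 := by simp [u]
  have h2 := abs_angle_fibreLoop hκ q
  rw [Path.angle_eq _ _ θ.continuous hθ] at h2
  rw [hu01, add_sub_add_right_eq_sub, ← mul_sub, abs_mul, hd1, one_mul, h2]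

end IsTube
end Knot
end

/-! ### The group of the fiber inside the group of the exterior -/

noncomputable section


theorem MonoidHom.exists_mulEquiv_conj {G Γ : Type*} [Group G] [Group Γ] (J : G →* Γ)
    (hJ : Function.Injective J) (m : Γ) (h : ∀ g, m * J g * m⁻¹ ∈ J.range)
    (h' : ∀ g, m⁻¹ * J g * m ∈ J.range) : ∃ φ : G ≃* G, ∀ g, J (φ g) = m * J g * m⁻¹ := by
  choose a ha using h
  choose b hb using h'
  refine ⟨{
    toFun := a
    invFun := b
    left_inv := fun g => hJ (by rw [hb, ha]; group)
    right_inv := fun g => hJ (by rw [ha, hb]; group)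
    map_mul' := fun g k => hJ (by rw [ha, map_mul, map_mul, ha, ha]; group) }, ha⟩

theorem Path.Homotopic.Quotient.angle_map {X Y : Type*} [TopologicalSpace X] [TopologicalSpace Y]
    (f : C(X, Y)) (p : C(Y, Circle)) {x y : X} (P : Path.Homotopic.Quotient x y) :
    (P.map f).angle p = P.angle (p.comp f) := by
  induction P using Path.Homotopic.Quotient.ind with | mk γ =>
  obtain ⟨h, hh⟩ := γ.exists_circle_lift (p.comp f)
  exact (Path.angle_eq p (γ.map f.continuous) h.continuous hh).trans
    (Path.angle_eq (p.comp f) γ h.continuous hh).symm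

namespace Knot

variable {n : ℕ} {K : Knot n} {N : Set (Sph (n + 2))}

/-- The boundary of a meridional disk as an element of the fundamental group of the exterior. -/
def MeridionalDisk.meridian (D : K.MeridionalDisk N) :
    FundamentalGroup (Exterior N) D.exteriorPt :=
  FundamentalGroup.fromPath (Path.Homotopic.Quotient.mk (bdryLoop D.isSingularDisk))

namespace IsTube

variable {τ : K.source × ℂ → Sph (n + 2)} (hτ : K.IsTube N τ)

include hτ

/-- The fundamental group of the fiber is the subgroup of the fundamental group of the exterior of
the loops along which the projection has angle zero, and the monodromy is the conjugation by a
meridian. -/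
theorem exists_fiberHom {π : C(K.Complement, Circle)} (hπ : K.IsFibration π)
    (D : K.MeridionalDisk N) (hD : π D.basePt = 1) :
    ∃ J : FundamentalGroup (K.Fiber π 1) ⟨D.basePt, hD⟩ →*
        FundamentalGroup (Exterior N) D.exteriorPt, Function.Injective J ∧
      (∀ P, P ∈ J.range ↔ Path.Homotopic.Quotient.angle
        (π.comp (exteriorIncl hτ.carrier_subset)) P = 0) ∧
      ∀ φ : FundamentalGroup (K.Fiber π 1) ⟨D.basePt, hD⟩ ≃*
        FundamentalGroup (K.Fiber π 1) ⟨D.basePt, hD⟩, IsMonodromy D hD φ ↔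
          ∀ g, J (φ g) = D.meridian * J g * D.meridian⁻¹ := by
  let ι := exteriorIncl hτ.carrier_subset
  let A : FundamentalGroup (Exterior N) D.exteriorPt →* FundamentalGroup K.Complement D.basePt :=
    FundamentalGroup.map ι D.exteriorPt
  let i : FundamentalGroup (K.Fiber π 1) ⟨D.basePt, hD⟩ →* FundamentalGroup K.Complement D.basePt :=
    FundamentalGroup.map (K.fiberIncl π 1) ⟨D.basePt, hD⟩
  have hA : Function.Bijective A := by
    constructor
    · intro P Q h
      obtain ⟨γ, rfl⟩ := Path.Homotopic.Quotient.mk_surjective P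
      obtain ⟨δ, rfl⟩ := Path.Homotopic.Quotient.mk_surjective Q
      exact Path.Homotopic.Quotient.eq.2
        (hτ.homotopic_of_map_exteriorIncl (Path.Homotopic.Quotient.exact h))
    · intro P
      obtain ⟨γ, rfl⟩ := Path.Homotopic.Quotient.mk_surjective P
      obtain ⟨δ, hδ⟩ := hτ.exists_homotopic_map_exteriorIncl (a := D.exteriorPt)
        (b := D.exteriorPt) γ
      exact ⟨Path.Homotopic.Quotient.mk δ, (Path.Homotopic.Quotient.eq.2 hδ).symm⟩
  have hi : Function.Injective i := by
    intro P Q h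
    obtain ⟨γ, rfl⟩ := Path.Homotopic.Quotient.mk_surjective P
    obtain ⟨δ, rfl⟩ := Path.Homotopic.Quotient.mk_surjective Q
    exact Path.Homotopic.Quotient.eq.2
      (Path.homotopic_of_map_fiber hπ.1 γ δ (Path.Homotopic.Quotient.exact h))
  have hir (P : FundamentalGroup K.Complement D.basePt) :
      P ∈ i.range ↔ Path.Homotopic.Quotient.angle π P = 0 := by
    constructor
    · rintro ⟨Q, rfl⟩
      obtain ⟨γ, rfl⟩ := Path.Homotopic.Quotient.mk_surjective Q
      refine (Path.angle_eq π _ (h := fun _ => 0) continuous_const fun t => ?_).trans (sub_self _)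
      rw [Circle.exp_zero]
      exact (γ t).2.symm
    · intro h
      obtain ⟨γ, rfl⟩ := Path.Homotopic.Quotient.mk_surjective P
      obtain ⟨δ, hδ⟩ := Path.exists_homotopic_map_fiber hπ.1
        (x := ⟨D.basePt, hD⟩) (y := ⟨D.basePt, hD⟩) γ h
      exact ⟨Path.Homotopic.Quotient.mk δ, (Path.Homotopic.Quotient.eq.2 hδ).symm⟩
  let e := MulEquiv.ofBijective A hA
  have hAJ (g) : A (e.symm (i g)) = i g := e.apply_symm_apply _
  refine ⟨e.symm.toMonoidHom.comp i, e.symm.injective.comp hi, fun P => ?_, fun φ => ?_⟩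
  · refine Iff.trans ?_ ((hir (A P)).trans (iff_of_eq (congrArg (· = 0)
      (Path.Homotopic.Quotient.angle_map ι π _))))
    constructor
    · rintro ⟨g, rfl⟩
      exact ⟨g, (hAJ g).symm⟩
    · rintro ⟨g, hg⟩
      exact ⟨g, hA.1 ((hAJ g).trans hg)⟩
  · have key (g k : FundamentalGroup (K.Fiber π 1) ⟨D.basePt, hD⟩) :
        e.symm (i k) = D.meridian * e.symm (i g) * D.meridian⁻¹ ↔
          A D.meridian * i g * (A D.meridian)⁻¹ = i k := by
      rw [← hA.1.eq_iff, map_mul, map_mul, map_inv, hAJ, hAJ, eq_comm]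
    -- Because multiplication reverses concatenation, conjugating by the meridian on the left gives
    -- the loop `(∂D)⁻¹ · γ · ∂D` of `IsMonodromy`.
    have key' (γ δ : Path (⟨D.basePt, hD⟩ : K.Fiber π 1) ⟨D.basePt, hD⟩) :
        (D.loop.symm.trans ((γ.map (K.fiberIncl π 1).continuous).trans D.loop)).Homotopic
          (δ.map (K.fiberIncl π 1).continuous) ↔
        A D.meridian * i (FundamentalGroup.fromPath (Path.Homotopic.Quotient.mk γ)) *
          (A D.meridian)⁻¹ = i (FundamentalGroup.fromPath (Path.Homotopic.Quotient.mk δ)) :=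
      Path.Homotopic.Quotient.eq.symm
    constructor
    · intro h g
      obtain ⟨γ, rfl⟩ := Path.Homotopic.Quotient.mk_surjective g
      obtain ⟨δ, hδ⟩ := Path.Homotopic.Quotient.mk_surjective
        (φ (FundamentalGroup.fromPath (Path.Homotopic.Quotient.mk γ)))
      have h1 := (key' γ δ).1 ((h γ δ).1 hδ.symm)
      have h2 := (key _ _).2 h1
      exact (congrArg (fun k => e.symm (i k)) hδ).symm.trans h2
    · intro h γ δ
      rw [key', ← key, ← (e.symm.injective.comp hi).eq_iff]
      exact (Eq.congr_left (h _)).trans eq_comm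

end IsTube
end Knot
end

/-! ### Representing nooses by loops modulo the meridian -/

noncomputable section


theorem Path.Homotopic.Quotient.trans_symm_rev {X : Type*} [TopologicalSpace X] {x y z : X}
    (P : Path.Homotopic.Quotient x y) (Q : Path.Homotopic.Quotient y z) :
    (P.trans Q).symm = Q.symm.trans P.symm := by
  induction P using Path.Homotopic.Quotient.ind
  induction Q using Path.Homotopic.Quotient.ind
  rw [← mk_trans, ← mk_symm, Path.trans_symm, mk_trans, mk_symm, mk_symm]

theorem Path.Homotopic.Quotient.conj_trans {X : Type*} [TopologicalSpace X] {x y z : X}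
    (P : Path.Homotopic.Quotient x y) (Q : Path.Homotopic.Quotient y z) (R : FundamentalGroup X z) :
    (P.trans Q).conj R = P.conj (Q.conj R) := by
  rw [conj_apply, conj_apply, conj_apply, trans_symm_rev]
  simp

namespace Knot

variable {n : ℕ} {K : Knot n} {N : Set (Sph (n + 2))}

theorem isPeripheral_refl (D : K.MeridionalDisk N) :
    IsPeripheral (Path.Homotopic.Quotient.refl D.exteriorPt) :=
  ⟨Path.refl _, rfl, fun _ => D.isSingularDisk.circlePt_mem_frontier 0⟩

theorem isPeripheral_meridian_zpow (D : K.MeridionalDisk N) (k : ℤ) :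
    IsPeripheral (FundamentalGroup.toPath (D.meridian ^ k)) := by
  induction k using Int.induction_on with
  | zero => exact isPeripheral_refl D
  | succ k ih =>
    rw [zpow_add_one]
    exact (isPeripheral_bdryLoop D.isSingularDisk).trans ih
  | pred k ih =>
    rw [zpow_sub_one]
    exact (isPeripheral_bdryLoop D.isSingularDisk).symm.trans ih

/-- Turns around the boundary of the disk of a noose can be removed. -/
theorem Noose.mk_eq_of_zpow {p : Exterior N} {D : K.MeridionalDisk N} (k : ℤ)
    {α β : Path D.exteriorPt p}
    (h : Path.Homotopic.Quotient.mk β = Path.Homotopic.Quotient.trans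
      (D.meridian ^ k : FundamentalGroup _ _) (Path.Homotopic.Quotient.mk α)) :
    (Quot.mk _ ⟨D, β⟩ : K.KnotQuandle N p) = Quot.mk _ ⟨D, α⟩ := by
  have step (γ : Path D.exteriorPt p) : (Quot.mk _ ⟨D, (bdryLoop D.isSingularDisk).trans γ⟩ :
      K.KnotQuandle N p) = Quot.mk _ ⟨D, γ⟩ :=
    (Quot.sound (Noose.homotopic_loop_trans D γ)).trans (Noose.mk_eq_of_path (by simp))
  have hmul (P : FundamentalGroup (Exterior N) D.exteriorPt) (γ : Path D.exteriorPt p) :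
      Path.Homotopic.Quotient.trans (P * D.meridian : FundamentalGroup _ _) (Path.Homotopic.Quotient.mk γ) =
        Path.Homotopic.Quotient.trans (Path.Homotopic.Quotient.mk (bdryLoop D.isSingularDisk))
          (Path.Homotopic.Quotient.trans P (.mk γ)) :=
    Path.Homotopic.Quotient.trans_assoc _ _ _
  induction k using Int.induction_on generalizing α β with
  | zero => exact Noose.mk_eq_of_path (h.trans (Path.Homotopic.Quotient.refl_trans _))
  | succ k ih =>
    obtain ⟨γ, hγ⟩ := Path.Homotopic.Quotient.mk_surjective
      (Path.Homotopic.Quotient.trans (D.meridian ^ (k : ℤ) : FundamentalGroup _ _) (Path.Homotopic.Quotient.mk α))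
    rw [zpow_add_one, hmul, ← hγ, ← Path.Homotopic.Quotient.mk_trans] at h
    rw [Noose.mk_eq_of_path h, step, ih hγ]
  | pred k ih =>
    rw [← step, ← ih (α := α) (β := (bdryLoop D.isSingularDisk).trans β)]
    rw [Path.Homotopic.Quotient.mk_trans, h, ← hmul, ← zpow_add_one, sub_add_cancel]

/-- Moving the disk of a noose. -/
theorem Noose.mk_eq_of_homotopyWith {p : Exterior N} {D D' : K.MeridionalDisk N}
    (H : D.toMap.HomotopyWith D'.toMap (K.IsSingularDisk N)) (α : Path D.exteriorPt p) :
    (Quot.mk _ ⟨D, α⟩ : K.KnotQuandle N p) =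
      Quot.mk _ ⟨D', (track H D.isSingularDisk D'.isSingularDisk).symm.trans α⟩ := by
  have hd (t : I) : K.IsSingularDisk N (H.toContinuousMap.comp
      ((ContinuousMap.const _ t).prodMk (.id _))) := H.prop' t
  let T := track H D.isSingularDisk D'.isSingularDisk
  -- At time `t` the path first runs back along the track to the original base point.
  let A (t : I) : Path (bdryPt (hd t) 0) D.exteriorPt :=
    { toFun := fun s => T ⟨t * (1 - s), unitInterval.mul_mem t.2 (σ s).2⟩
      continuous_toFun := by fun_prop
      source' := by simp; rfl
      target' := by simp }
  have hA : Continuous ↿A := T.continuous.comp (Continuous.subtype_mk (by fun_prop :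
    Continuous fun q : I × I => (q.1 : ℝ) * (1 - q.2)) _)
  have hP := Path.trans_continuous_family _ hA (fun _ => α)
    (by exact α.continuous.comp continuous_snd)
  have h1 : Noose.Homotopic (⟨D, (Path.refl _).trans α⟩ : K.Noose N p) ⟨D', T.symm.trans α⟩ := by
    refine ⟨{
      disk := H.toContinuousMap
      path := ⟨_, hP⟩
      isSingularDisk := hd
      path_zero := fun t => congrArg Subtype.val ((A t).trans α).source
      path_one := fun t => ((A t).trans α).target
      disk_left := H.apply_zero
      path_left := fun s => ?_
      disk_right := H.apply_one
      path_right := fun s => ?_ }⟩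
    · refine path_trans_congr (fun t => ?_) (fun t => rfl) s
      change T _ = _
      simp
    · refine path_trans_congr (fun t => ?_) (fun t => rfl) s
      refine congrArg T (Subtype.ext ?_)
      simp
  exact (Noose.mk_eq_of_path (by simp)).trans (Quot.sound h1)

namespace IsTube

variable {τ : K.source × ℂ → Sph (n + 2)} (hτ : K.IsTube N τ)

include hτ

/-- A peripheral path between the base points of two meridional disks transports one meridian to
the other. -/
theorem conj_meridian (hn : 2 ≤ n) {D D' : K.MeridionalDisk N}
    {P : Path.Homotopic.Quotient D.exteriorPt D'.exteriorPt} (hP : IsPeripheral P) :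
    P.conj D'.meridian = D.meridian := by
  obtain ⟨H⟩ := hτ.exists_homotopyWith hn D D'
  have hT := isPeripheral_track H D.isSingularDisk D'.isSingularDisk
  have hc := conj_track H D.isSingularDisk D'.isSingularDisk
  set T := Path.Homotopic.Quotient.mk (track H D.isSingularDisk D'.isSingularDisk)
  -- The path differs from the track of a homotopy of disks by a power of the meridian, which
  -- commutes with the meridian.
  obtain ⟨k, hk⟩ := hτ.exists_zpow_bdryLoop hn D (hP.trans hT.symm)
  have hk' : P.trans T.symm = FundamentalGroup.toPath (D.meridian ^ k) := hk
  have h1 : P = (FundamentalGroup.toPath (D.meridian ^ k)).trans T := by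
    rw [← hk']
    simp
  have h2 : T.conj D'.meridian = D.meridian := hc
  rw [h1, Path.Homotopic.Quotient.conj_trans, h2]
  change (D.meridian ^ k)⁻¹ * D.meridian * D.meridian ^ k = _
  group

end IsTube

variable {D : K.MeridionalDisk N}

/-- `P` is represented by the path of the noose `ν`, extended by a peripheral path to a loop. -/
def Noose.Represents (ν : K.Noose N D.exteriorPt)
    (P : FundamentalGroup (Exterior N) D.exteriorPt) : Prop :=
  ∃ η : Path.Homotopic.Quotient D.exteriorPt ν.disk.exteriorPt,
    IsPeripheral η ∧ η.trans (Path.Homotopic.Quotient.mk ν.path) = P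

theorem Noose.represents_mk (α : Path D.exteriorPt D.exteriorPt) :
    (⟨D, α⟩ : K.Noose N D.exteriorPt).Represents (Path.Homotopic.Quotient.mk α) :=
  ⟨_, isPeripheral_refl D, Path.Homotopic.Quotient.refl_trans _⟩

/-- During a homotopy the starting point of the path moves in the boundary of `N`; its trace is
added to the peripheral path. -/
theorem Noose.Represents.of_homotopic {ν μ : K.Noose N D.exteriorPt}
    {P : FundamentalGroup (Exterior N) D.exteriorPt} (h : ν.Represents P) (e : ν.Homotopic μ) :
    μ.Represents P := by
  obtain ⟨η, hη, rfl⟩ := h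
  obtain ⟨F⟩ := e
  let T : Path ν.disk.exteriorPt μ.disk.exteriorPt :=
    { toFun := fun t => F.path (t, 0)
      continuous_toFun := by fun_prop
      source' := (F.path_left 0).trans ν.path.source
      target' := (F.path_right 0).trans μ.path.source }
  have hT : IsPeripheral (.mk T) := ⟨T, rfl, fun t => by
    have h1 := (F.isSingularDisk t).circlePt_mem_frontier 0
    exact (F.path_zero t).symm ▸ h1⟩
  have h1 : (ν.path.trans (Path.refl _)).Homotopic (T.trans μ.path) :=
    Path.homotopic_of_square F.path _ _ _ _ (fun s => (F.path_left s).symm)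
      (fun s => (F.path_one s).symm) (fun s => rfl) (fun s => (F.path_right s).symm)
  have h2 := Path.Homotopic.Quotient.eq.2 h1
  rw [Path.Homotopic.Quotient.mk_trans, Path.Homotopic.Quotient.mk_trans,
    Path.Homotopic.Quotient.mk_refl, Path.Homotopic.Quotient.trans_refl] at h2
  refine ⟨_, hη.trans hT, ?_⟩
  rw [h2, Path.Homotopic.Quotient.trans_assoc]

namespace IsTube

variable {τ : K.source × ℂ → Sph (n + 2)} (hτ : K.IsTube N τ)

include hτ

/-- In the order of concatenation this is m⁻¹PQ⁻¹mQ. The middle `m` is the boundary of the second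
disk, transported by `conj_meridian`. The peripheral factor m⁻¹ is inserted so that the result again
has angle zero when P and Q do. -/
theorem represents_op (hn : 2 ≤ n) {ν μ : K.Noose N D.exteriorPt}
    {P Q : FundamentalGroup (Exterior N) D.exteriorPt} (hP : ν.Represents P)
    (hQ : μ.Represents Q) :
    (ν.op true μ).Represents (Q * (D.meridian * (Q⁻¹ * P) * D.meridian⁻¹)) := by
  obtain ⟨η, hη, rfl⟩ := hP
  obtain ⟨θ, hθ, rfl⟩ := hQ
  have hm : FundamentalGroup.toPath D.meridian = θ.trans ((Path.Homotopic.Quotient.mk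
    (bdryLoop μ.disk.isSingularDisk)).trans θ.symm) := (hτ.conj_meridian hn hθ).symm
  have hm' : IsPeripheral (FundamentalGroup.toPath D.meridian).symm :=
    (isPeripheral_bdryLoop D.isSingularDisk).symm
  refine ⟨(FundamentalGroup.toPath D.meridian).symm.trans η, hm'.trans hη, ?_⟩
  change Path.Homotopic.Quotient.trans _ (Path.Homotopic.Quotient.mk (ν.path.trans
      (μ.path.symm.trans ((bdryLoop μ.disk.isSingularDisk).trans μ.path)))) =
    Path.Homotopic.Quotient.trans (Path.Homotopic.Quotient.trans
      (FundamentalGroup.toPath D.meridian).symm (Path.Homotopic.Quotient.trans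
        (Path.Homotopic.Quotient.trans (η.trans (.mk ν.path)) (θ.trans (.mk μ.path)).symm)
        (FundamentalGroup.toPath D.meridian))) (θ.trans (.mk μ.path))
  -- Only the second occurrence of the meridian is to be expanded through the disk of `μ`.
  generalize (FundamentalGroup.toPath D.meridian).symm = M
  rw [hm, Path.Homotopic.Quotient.trans_symm_rev]
  simp only [Path.Homotopic.Quotient.mk_trans, Path.Homotopic.Quotient.mk_symm,
    Path.Homotopic.Quotient.trans_assoc, symm_trans_cancel]
  exact Path.Homotopic.Quotient.trans_assoc _ _ _

/-- Once the disks agree, the two paths differ by a peripheral loop, that is by turns around the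
disk, which a rotation removes. -/
theorem mk_eq_of_represents (hn : 2 ≤ n) {ν μ : K.Noose N D.exteriorPt}
    {P : FundamentalGroup (Exterior N) D.exteriorPt} (hν : ν.Represents P)
    (hμ : μ.Represents P) : (Quot.mk _ ν : K.KnotQuandle N D.exteriorPt) = Quot.mk _ μ := by
  obtain ⟨η, hη, rfl⟩ := hν
  obtain ⟨θ, hθ, h⟩ := hμ
  obtain ⟨D₁, α⟩ := ν
  obtain ⟨D₂, β⟩ := μ
  obtain ⟨H⟩ := hτ.exists_homotopyWith hn D₁ D₂
  have hT := isPeripheral_track H D₁.isSingularDisk D₂.isSingularDisk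
  rw [Noose.mk_eq_of_homotopyWith H α]
  obtain ⟨k, hk⟩ := hτ.exists_zpow_bdryLoop hn D₂ ((hθ.symm.trans hη).trans hT)
  have hk' : FundamentalGroup.toPath (D₂.meridian ^ k) = _ := hk.symm
  refine (Noose.mk_eq_of_zpow k (Eq.trans ?_
    (congrArg (fun R => Path.Homotopic.Quotient.trans R _) hk'.symm))).symm
  have h1 : Path.Homotopic.Quotient.mk β = θ.symm.trans (η.trans (.mk α)) := by
    rw [← h, symm_trans_cancel]
  rw [h1]
  simp [trans_symm_cancel]

variable {π : C(K.Complement, Circle)} (hπ : K.IsFibration π)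

include hπ

/-- Some representative exists because all disks are homotopic. Its angle is a multiple of `2π`, and
a power of the meridian, whose angle is `±2π`, cancels it. -/
theorem exists_represents (hn : 2 ≤ n) (hD : π D.basePt = 1) (ν : K.Noose N D.exteriorPt) :
    ∃ P, ν.Represents P ∧ Path.Homotopic.Quotient.angle
      (π.comp (exteriorIncl hτ.carrier_subset)) P = 0 := by
  obtain ⟨H⟩ := hτ.exists_homotopyWith hn D ν.disk
  have hT := isPeripheral_track H D.isSingularDisk ν.disk.isSingularDisk
  set T := Path.Homotopic.Quotient.mk (track H D.isSingularDisk ν.disk.isSingularDisk)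
  obtain ⟨k, hk⟩ := Path.Homotopic.Quotient.exists_int_angle_eq
    (π.comp (exteriorIncl hτ.carrier_subset)) (T.trans (.mk ν.path))
  obtain ⟨j, hj⟩ : ∃ j : ℤ, (j : ℝ) * (bdryLoop D.isSingularDisk).angle
      (π.comp (exteriorIncl hτ.carrier_subset)) = -(k * (2 * Real.pi)) := by
    rcases (abs_eq (by positivity)).1 (hτ.abs_angle_bdryLoop hn hπ D hD) with h | h
    · exact ⟨-k, by rw [h]; push_cast; ring⟩
    · exact ⟨k, by rw [h]; ring⟩
  refine ⟨(FundamentalGroup.toPath (D.meridian ^ j)).trans (T.trans (.mk ν.path)),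
    ⟨_, (isPeripheral_meridian_zpow D j).trans hT, Path.Homotopic.Quotient.trans_assoc _ _ _⟩, ?_⟩
  have h1 := Path.Homotopic.Quotient.angle_zpow (π.comp (exteriorIncl hτ.carrier_subset))
    D.meridian j
  have h2 := h1.trans hj
  refine (Path.Homotopic.Quotient.angle_trans _ _ _).trans ?_
  rw [hk]
  exact (congrArg (· + _) h2).trans (neg_add_cancel _)

/-- Two representatives differ by a power of the meridian, and only the zeroth power has angle zero.
-/
theorem eq_of_represents (hn : 2 ≤ n) (hD : π D.basePt = 1) {ν : K.Noose N D.exteriorPt}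
    {P Q : FundamentalGroup (Exterior N) D.exteriorPt} (hP : ν.Represents P)
    (hQ : ν.Represents Q)
    (hP0 : Path.Homotopic.Quotient.angle (π.comp (exteriorIncl hτ.carrier_subset)) P = 0)
    (hQ0 : Path.Homotopic.Quotient.angle (π.comp (exteriorIncl hτ.carrier_subset)) Q = 0) :
    P = Q := by
  obtain ⟨η, hη, rfl⟩ := hP
  obtain ⟨θ, hθ, rfl⟩ := hQ
  obtain ⟨k, hk⟩ := hτ.exists_zpow_bdryLoop hn D (hη.trans hθ.symm)
  have h1 := Path.Homotopic.Quotient.angle_zpow (π.comp (exteriorIncl hτ.carrier_subset))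
    D.meridian k
  have h2 : (η.trans θ.symm).angle (π.comp (exteriorIncl hτ.carrier_subset)) =
    k * (bdryLoop D.isSingularDisk).angle (π.comp (exteriorIncl hτ.carrier_subset)) :=
    (congrArg _ hk).trans h1
  rw [Path.Homotopic.Quotient.angle_trans] at hP0 hQ0 h2
  rw [Path.Homotopic.Quotient.angle_symm] at h2
  have h3 := hτ.abs_angle_bdryLoop hn hπ D hD
  have h4 : (bdryLoop D.isSingularDisk).angle (π.comp (exteriorIncl hτ.carrier_subset)) ≠ 0 := by
    rw [← abs_pos, h3]
    exact Real.two_pi_pos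
  have h5 : (k : ℝ) * (bdryLoop D.isSingularDisk).angle
      (π.comp (exteriorIncl hτ.carrier_subset)) = 0 := by
    rw [← h2]; linarith
  have h6 : k = 0 := by exact_mod_cast (mul_eq_zero.1 h5).resolve_right h4
  have h7 : η.trans θ.symm = .refl _ := by rw [hk, h6]; rfl
  have h8 : η = θ := by
    have := congrArg (·.trans θ) h7
    simpa using this
  rw [h8]

end IsTube
end Knot
end

/-- For a fibered `n`-knot with `n ≥ 2`, the monodromy is a well-defined automorphism `φ` of the
fundamental group `G` of the fiber, and the knot quandle is isomorphic to `(G, φ)`. -/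
theorem corollary3p2 (n : ℕ) (hn : 2 ≤ n) (K : Knot n)
    (π : C(K.Complement, Circle)) (hπ : K.IsFibration π)
    (N : Set (Sph (n + 2))) (hN : K.IsTubularNeighborhood N)
    (D₀ : K.MeridionalDisk N) (h₀ : π D₀.basePt = 1) :
    (∃! φ : FundamentalGroup (K.Fiber π 1) ⟨D₀.basePt, h₀⟩ ≃*
        FundamentalGroup (K.Fiber π 1) ⟨D₀.basePt, h₀⟩, Knot.IsMonodromy D₀ h₀ φ) ∧
      ∀ φ : FundamentalGroup (K.Fiber π 1) ⟨D₀.basePt, h₀⟩ ≃*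
        FundamentalGroup (K.Fiber π 1) ⟨D₀.basePt, h₀⟩, Knot.IsMonodromy D₀ h₀ φ →
        ∃ f : ShelfHom (K.KnotQuandle N D₀.exteriorPt) (GenAlexanderQuandle φ),
          Function.Bijective f := by
  obtain ⟨τ, h1, h2, h3, h4⟩ := hN
  have hτ : K.IsTube N τ := ⟨h1, h2, h3, h4⟩
  obtain ⟨J, hJ, hJr, hJφ⟩ := hτ.exists_fiberHom hπ D₀ h₀
  refine ⟨?_, fun φ hφ => ?_⟩
  -- The range of `J` is the kernel of a homomorphism, hence stable under conjugation by the
  -- meridian and its inverse.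
  · have hang (P : FundamentalGroup (Knot.Exterior N) D₀.exteriorPt) (g) :
        Path.Homotopic.Quotient.angle (π.comp (Knot.exteriorIncl hτ.carrier_subset))
          (P * J g * P⁻¹ : FundamentalGroup _ _) = 0 := by
      have h5 : Path.Homotopic.Quotient.angleHom
          (π.comp (Knot.exteriorIncl hτ.carrier_subset)) _ (J g) = 1 :=
        congrArg Multiplicative.ofAdd ((hJr _).1 ⟨g, rfl⟩)
      have h6 : Path.Homotopic.Quotient.angleHom
          (π.comp (Knot.exteriorIncl hτ.carrier_subset)) _ (P * J g * P⁻¹) = 1 := by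
        rw [map_mul, map_mul, h5, map_inv, mul_one, mul_inv_cancel]
      exact congrArg Multiplicative.toAdd h6
    obtain ⟨φ, hφ⟩ := J.exists_mulEquiv_conj hJ D₀.meridian
      (fun g => (hJr _).2 (hang _ g)) (fun g => (hJr _).2 (by
        have h5 := hang D₀.meridian⁻¹ g
        rwa [inv_inv] at h5))
    exact ⟨φ, (hJφ φ).2 hφ, fun ψ hψ => MulEquiv.ext fun g => hJ
      (((hJφ ψ).1 hψ g).trans (hφ g).symm)⟩
  · have hφJ := (hJφ φ).1 hφ
    have hex (ν : K.Noose N D₀.exteriorPt) : ∃ g, ν.Represents (J g) := by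
      obtain ⟨P, hP, hP0⟩ := hτ.exists_represents hπ hn h₀ ν
      obtain ⟨g, rfl⟩ := (hJr P).2 hP0
      exact ⟨g, hP⟩
    have huniq {ν : K.Noose N D₀.exteriorPt} {g k} (hg : ν.Represents (J g))
        (hk : ν.Represents (J k)) : g = k :=
      hJ (hτ.eq_of_represents hπ hn h₀ hg hk ((hJr _).1 ⟨g, rfl⟩) ((hJr _).1 ⟨k, rfl⟩))
    choose c hc using hex
    -- The inverse compensates for the reversed multiplication of `FundamentalGroup`, under which
    -- the product of nooses reads `y * φ (y⁻¹ * x)`.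
    let f : K.KnotQuandle N D₀.exteriorPt → FundamentalGroup (K.Fiber π 1) ⟨D₀.basePt, h₀⟩ :=
      Quot.lift (fun ν => (c ν)⁻¹) fun ν μ h =>
        congrArg _ (huniq ((hc ν).of_homotopic h) (hc μ))
    refine ⟨⟨f, fun {y x} => ?_⟩, fun x y h => ?_, fun g => ?_⟩
    · induction x using Quot.ind with | mk ν =>
      induction y using Quot.ind with | mk μ =>
      change (c (ν.op true μ))⁻¹ = φ ((c ν)⁻¹ * ((c μ)⁻¹)⁻¹) * (c μ)⁻¹
      have h5 := hτ.represents_op hn (hc ν) (hc μ)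
      rw [← map_inv, ← map_mul, ← hφJ, ← map_mul] at h5
      rw [huniq (hc _) h5, mul_inv_rev, ← map_inv, mul_inv_rev]
    · induction x using Quot.ind with | mk ν =>
      induction y using Quot.ind with | mk μ =>
      have h5 : c ν = c μ := inv_injective h
      exact hτ.mk_eq_of_represents hn (hc ν) (h5 ▸ hc μ)
    · obtain ⟨α, hα⟩ := Path.Homotopic.Quotient.mk_surjective (J (g⁻¹))
      refine ⟨Quot.mk _ ⟨D₀, α⟩, ?_⟩
      change (c _)⁻¹ = g
      exact (congrArg _ (huniq (hc _) (hα ▸ Knot.Noose.represents_mk α))).trans (inv_inv _)
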